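/- **Conventions.** A real matrix $A=(a_{ij})_{i,j\in I}$ with $I$ countable is a Borcherds–Cartan matrix if $DA$ is symmetric for some diagonal $D$ with positive entries, $a_{ii}>0$ implies $a_{ii}=2$, $a_{ij}\le 0$ for $i\ne j$, and $a_{ij}\in\mathbb Z_{\le 0}$ for $j\neq i$ when $a_{ii}>0$. The complex Lie algebra $\mathfrak g(A)$ has generators $e_i,f_i,h_i$ $(i\in I)$ and relations $[h_i,h_j]=0$, $[h_i,e_k]=a_{ik}e_k$, $[h_i,f_k]=-a_{ik}f_k$, $[e_i,f_j]=\delta_{ij}h_i$; $(\operatorname{ad}e_i)^{1-2a_{ij}/a_{ii}}e_j=(\operatorname{ad}f_i)^{1-2a_{ij}/a_{ii}}f_j=0$ if $i\ne j$, $a_{ii}>0$; $[e_i,e_j]=[f_i,f_j]=0$ if $a_{ij}=0$. Let $\mathfrak h(A)$ be the subalgebra generated by the $h_i$. A BKM algebra over $\mathbb C$ is a Lie algebra identified with $(\mathfrak g(A)/C)\rtimes D$, where $C\subseteq\mathfrak h(A)$ is a central ideal and $D$ is a commutative Lie algebra of derivations with $d(e_i)\in\mathbb C e_i$ and $d(f_i)\in\mathbb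 Cf_i$, with opposite eigenvalues; its Cartan subalgebra is $\mathfrak h_{\mathbb C}=(\mathfrak h(A)/C)\rtimes D$, and $\mathfrak n_{\mathbb C}$ is the subalgebra generated by the $e_i$. Roots are the nonzero eigenvalues of $\mathfrak h_{\mathbb C}$; simple roots are the roots that are the eigenvalue of some $e_i$; a root is positive if it is a non-negative integer combination of simple roots, and negative if minus it is a positive root. We assume that no root is both positive and negative. A BKM algebra over a subring $R\subseteq\mathbb C$ is a Lie algebra $\mathfrak g$ over $R$ such that $\mathfrak g_{\mathbb C}=\mathfrak g\otimes_R\mathbb C$ is a BKM algebra over $\mathbb C$, with a subalgebra $\mathfrak h$ such that $\mathfrak h\otimes_R\mathbb C$ is the Cartan subalgebra, the roots are $R$-valued on $\mathfrak h$, and $\mathfrak g$ is the direct sum of $\mathfrak h$ and its root spaces. Its positive subalgebra is $\mathfrak n=\mathfrak g\cap\mathfrak n_{\mathbb C}$. Let $R$ be closed under complex conjugation. A nondegenerate contravariant hermitian form on $\mathfrak g$ is an $R$-valued hermitian form $\langle\,,\rangle$ on $\mathfrak g$ with zero radical, whose sesquilinear extension to $\mathfrak g_{\mathbb C}$ satisfies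 $\langle[u,x],y\rangle=-\langle x,[\omega(u),y]\rangle$ for a conjugate-linear Lie algebra involution $\omega$ of $\mathfrak g_{\mathbb C}$ with $\omega(e_i)=\varepsilon f_i$ for all $i$, where $\varepsilon\in\{1,-1\}$ is fixed. Let $(x,y)=\langle x,\omega(y)\rangle$ be the associated invariant bilinear form. For $\alpha\in\mathfrak h_{\mathbb C}^*$ represented by $t_\alpha\in\mathfrak h_{\mathbb C}$, i.e. $(s,t_\alpha)=\alpha(s)$ for all $s\in\mathfrak h_{\mathbb C}$, put $(\alpha,\beta)=\beta(t_\alpha)$ for $\beta\in\mathfrak h_{\mathbb C}^*$. A Weyl vector is a $\rho\in\mathfrak h_{\mathbb C}^*$ with $(\rho,\alpha)=-(\alpha,\alpha)/2$ for all simple roots $\alpha$. The form on $\bigwedge^*\mathfrak n$ and on $\bigwedge^*\mathfrak n_{\mathbb C}$ is $\langle x_1\wedge\cdots\wedge x_k,\,y_1\wedge\cdots\wedge y_k\rangle=\det(\langle x_i,y_j\rangle)$, with different degrees orthogonal, and $$\delta(x_1\wedge\cdots\wedge x_k)=\sum_{i<j}(-1)^{i+j+1}[x_i,x_j]\wedge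 x_1\wedge\cdots\hat x_i\cdots\hat x_j\cdots\wedge x_k .$$ **Theorem.** Let $R\subseteq\mathbb C$ be a subring closed under complex conjugation, let $\mathfrak g$ be a BKM algebra over $R$ with Weyl vector $\rho$ and a nondegenerate contravariant hermitian form, and let $\mathfrak n$ be its positive subalgebra. Every weight $\alpha$ of $\bigwedge^*\mathfrak n_{\mathbb C}$ is represented by a unique $t_\alpha\in\mathfrak h_{\mathbb C}$, the operator $\delta$ on $\bigwedge^*\mathfrak n_{\mathbb C}$ has a unique adjoint $d$, and the Laplacian $\Delta=d\delta+\delta d$ acts on the $\alpha$ weight space of $\bigwedge^*\mathfrak n_{\mathbb C}$ as multiplication by $(\alpha,\alpha+2\rho)/2$. Moreover, if $d$ is an $R$-linear adjoint of $\delta$ on $\bigwedge^*\mathfrak n$, then $\Delta=d\delta+\delta d$ acts on the $\alpha$ weight space of $\bigwedge^*\mathfrak n$ as multiplication by $(\alpha,\alpha+2\rho)/2$, as an identity in $\bigwedge^*\mathfrak n_{\mathbb C}$. -/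

import Mathlib

open scoped TensorProduct ComplexConjugate

noncomputable section

/-! ### Exterior algebra: derivations, the Chevalley–Eilenberg boundary, the form of determinants -/

section Exterior

variable {k M : Type*} [CommRing k] [AddCommGroup M] [Module k M]

/-- Step of the recursion `D_T (y ∧ w) = T y ∧ w + y ∧ D_T w`, for all `T` at once. -/
def extDerStep : M →ₗ[k] ExteriorAlgebra k M × (Module.End k M →ₗ[k] ExteriorAlgebra k M) →ₗ[k]
    (Module.End k M →ₗ[k] ExteriorAlgebra k M) :=
  LinearMap.mk₂ k
    (fun y p =>
      (LinearMap.mulRight k p.1) ∘ₗ (ExteriorAlgebra.ι k) ∘ₗ (LinearMap.applyₗ y)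
        + (LinearMap.mulLeft k (ExteriorAlgebra.ι k y)) ∘ₗ p.2)
    (fun y y' p => by ext T; simp [add_mul]; abel)
    (fun c y p => by ext T; simp)
    (fun y p q => by ext T; simp [mul_add]; abel)
    (fun c y p => by ext T; simp)

theorem extDerStep_apply (y : M) (w : ExteriorAlgebra k M)
    (φ : Module.End k M →ₗ[k] ExteriorAlgebra k M) (T : Module.End k M) :
    extDerStep y (w, φ) T = ExteriorAlgebra.ι k (T y) * w + ExteriorAlgebra.ι k y * φ T := rfl

theorem extDerStep_step (y : M) (w : ExteriorAlgebra k M)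
    (φ : Module.End k M →ₗ[k] ExteriorAlgebra k M) :
    extDerStep y (ExteriorAlgebra.ι k y * w, extDerStep y (w, φ))
      = (0 : QuadraticForm k M) y • φ := by
  ext T
  have h : ExteriorAlgebra.ι k (T y) * ExteriorAlgebra.ι k y
      + ExteriorAlgebra.ι k y * ExteriorAlgebra.ι k (T y) = 0 :=
    ExteriorAlgebra.ι_add_mul_swap _ _
  have h2 : ExteriorAlgebra.ι k y * ExteriorAlgebra.ι k y = 0 := ExteriorAlgebra.ι_sq_zero y
  rw [extDerStep_apply, extDerStep_apply, mul_add, ← mul_assoc, ← mul_assoc, ← mul_assoc, h2,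
    ← add_assoc, ← add_mul, h]
  simp

/-- `extDer w T` is `D_T w`, where `D_T` is the unique derivation of the exterior algebra of `M`
that extends the endomorphism `T` of `M`. -/
def extDer : ExteriorAlgebra k M →ₗ[k] Module.End k M →ₗ[k] ExteriorAlgebra k M :=
  CliffordAlgebra.foldr' (0 : QuadraticForm k M) extDerStep extDerStep_step 0

theorem extDer_one (T : Module.End k M) : extDer (1 : ExteriorAlgebra k M) T = 0 := by
  have h := CliffordAlgebra.foldr'_algebraMap (0 : QuadraticForm k M) extDerStep
    extDerStep_step 0 1
  rw [map_one] at h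
  change CliffordAlgebra.foldr' (0 : QuadraticForm k M) extDerStep extDerStep_step 0 1 T = 0
  rw [h]; simp

theorem extDer_ι_mul (T : Module.End k M) (y : M) (w : ExteriorAlgebra k M) :
    extDer (ExteriorAlgebra.ι k y * w) T
      = ExteriorAlgebra.ι k (T y) * w + ExteriorAlgebra.ι k y * extDer w T :=
  LinearMap.congr_fun (CliffordAlgebra.foldr'_ι_mul (0 : QuadraticForm k M) extDerStep
    extDerStep_step 0 y w) T

end Exterior

section ChevalleyEilenberg

variable (k n : Type*) [CommRing k] [LieRing n] [LieAlgebra k n]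

/-- Step of the recursion `δ (x ∧ w) = x · w - x ∧ δ w`. -/
def ceStep : n →ₗ[k] ExteriorAlgebra k n × ExteriorAlgebra k n →ₗ[k] ExteriorAlgebra k n :=
  LinearMap.mk₂ k
    (fun x p => extDer p.1 (LieAlgebra.ad k n x) - ExteriorAlgebra.ι k x * p.2)
    (fun x x' p => by simp [add_mul]; abel)
    (fun c x p => by simp [smul_sub])
    (fun x p q => by simp [mul_add]; abel)
    (fun c x p => by simp [smul_sub])

theorem ceStep_step (x : n) (w v : ExteriorAlgebra k n) :
    ceStep k n x (ExteriorAlgebra.ι k x * w, ceStep k n x (w, v))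
      = (0 : QuadraticForm k n) x • v := by
  have h2 : ExteriorAlgebra.ι k x * ExteriorAlgebra.ι k x = 0 := ExteriorAlgebra.ι_sq_zero x
  change extDer (ExteriorAlgebra.ι k x * w) (LieAlgebra.ad k n x)
    - ExteriorAlgebra.ι k x *
      (extDer w (LieAlgebra.ad k n x) - ExteriorAlgebra.ι k x * v) = _
  rw [extDer_ι_mul, mul_sub, ← mul_assoc, h2]
  simp

/-- The Chevalley–Eilenberg boundary of the trivial module,
`δ (x₁ ∧ ⋯ ∧ xₙ) = ∑_{i<j} (-1)^(i+j+1) [xᵢ, xⱼ] ∧ x₁ ∧ ⋯ x̂ᵢ ⋯ x̂ⱼ ⋯ ∧ xₙ`.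
It is built by splitting off the terms with `i = 1`: their sum is `x₁ · (x₂ ∧ ⋯ ∧ xₙ)`, for the
adjoint action by derivations, and the other terms add up to `- x₁ ∧ δ (x₂ ∧ ⋯ ∧ xₙ)`. -/
def ceBoundary : ExteriorAlgebra k n →ₗ[k] ExteriorAlgebra k n :=
  CliffordAlgebra.foldr' (0 : QuadraticForm k n) (ceStep k n) (ceStep_step k n) 0

theorem ceBoundary_one : ceBoundary k n 1 = 0 := by
  have h := CliffordAlgebra.foldr'_algebraMap (0 : QuadraticForm k n) (ceStep k n)
    (ceStep_step k n) 0 1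
  rw [map_one] at h
  change CliffordAlgebra.foldr' (0 : QuadraticForm k n) (ceStep k n) (ceStep_step k n) 0 1 = 0
  rw [h]; simp

theorem ceBoundary_ι_mul (x : n) (w : ExteriorAlgebra k n) :
    ceBoundary k n (ExteriorAlgebra.ι k x * w)
      = extDer w (LieAlgebra.ad k n x) - ExteriorAlgebra.ι k x * ceBoundary k n w :=
  CliffordAlgebra.foldr'_ι_mul (0 : QuadraticForm k n) (ceStep k n) (ceStep_step k n) 0 x w

theorem ceBoundary_ι (x : n) : ceBoundary k n (ExteriorAlgebra.ι k x) = 0 := by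
  have h := ceBoundary_ι_mul k n x 1
  rwa [mul_one, extDer_one, ceBoundary_one, mul_zero, sub_zero] at h

theorem ceBoundary_ι_mul_ι (x y : n) :
    ceBoundary k n (ExteriorAlgebra.ι k x * ExteriorAlgebra.ι k y)
      = ExteriorAlgebra.ι k ⁅x, y⁆ := by
  have h := extDer_ι_mul (LieAlgebra.ad k n x) y 1
  rw [mul_one, mul_one, extDer_one, mul_zero, add_zero, LieAlgebra.ad_apply] at h
  rw [ceBoundary_ι_mul, ceBoundary_ι, mul_zero, sub_zero, h]

end ChevalleyEilenberg

section ExteriorForm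

variable {M : Type*} [AddCommGroup M] [Module ℂ M]

/-- For a sesquilinear form `H` (linear in the first, conjugate-linear in the second variable),
the linear functional `x ↦ conj (H y x)`. -/
def conjFunctional (H : M →ₗ[ℂ] M →ₗ⋆[ℂ] ℂ) (y : M) : Module.Dual ℂ M where
  toFun x := conj (H y x)
  map_add' x x' := by simp
  map_smul' c x := by simp

/-- Step of the recursion `⟨y ∧ w, x⟩ = ⟨w, conj (H y ·) ⌋ x⟩`. -/
def extFormStep (H : M →ₗ[ℂ] M →ₗ⋆[ℂ] ℂ) :
    M →ₗ[ℂ] (ExteriorAlgebra ℂ M →ₗ⋆[ℂ] ℂ) →ₗ[ℂ] (ExteriorAlgebra ℂ M →ₗ⋆[ℂ] ℂ) :=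
  LinearMap.mk₂ ℂ
    (fun y φ => φ.comp (CliffordAlgebra.contractLeft (Q := (0 : QuadraticForm ℂ M))
      (conjFunctional H y)))
    (fun y y' φ => by
      have h : conjFunctional H (y + y') = conjFunctional H y + conjFunctional H y' := by
        ext x; simp [conjFunctional]
      ext x; simp [h])
    (fun c y φ => by
      have h : conjFunctional H (c • y) = conj c • conjFunctional H y := by
        ext x; simp [conjFunctional]
      ext x; simp [h])
    (fun y φ ψ => by ext x; simp)
    (fun c y φ => by ext x; simp)

theorem extFormStep_step (H : M →ₗ[ℂ] M →ₗ⋆[ℂ] ℂ) (y : M) (φ : ExteriorAlgebra ℂ M →ₗ⋆[ℂ] ℂ) :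
    extFormStep H y (extFormStep H y φ) = (0 : QuadraticForm ℂ M) y • φ := by
  ext x
  change φ (CliffordAlgebra.contractLeft (conjFunctional H y)
    (CliffordAlgebra.contractLeft (conjFunctional H y) x)) = _
  rw [CliffordAlgebra.contractLeft_contractLeft]
  simp

/-- The projection of the exterior algebra to its degree zero part, followed by conjugation. -/
def extFormInit : ExteriorAlgebra ℂ M →ₗ⋆[ℂ] ℂ where
  toFun x := conj (ExteriorAlgebra.algebraMapInv x)
  map_add' x x' := by simp
  map_smul' c x := by simp

/-- The sesquilinear form on the exterior algebra induced by a sesquilinear form `H` on `M`: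
`⟨y₁ ∧ ⋯ ∧ yₙ, x₁ ∧ ⋯ ∧ xₙ⟩ = det (H yᵢ xⱼ)`, and different degrees are orthogonal. -/
def extForm (H : M →ₗ[ℂ] M →ₗ⋆[ℂ] ℂ) :
    ExteriorAlgebra ℂ M →ₗ[ℂ] ExteriorAlgebra ℂ M →ₗ⋆[ℂ] ℂ :=
  CliffordAlgebra.foldr (0 : QuadraticForm ℂ M) (extFormStep H) (extFormStep_step H) extFormInit

end ExteriorForm

/-! ### Borcherds–Kac–Moody algebras over `ℂ` -/

/-- Borcherds–Cartan matrices. -/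
structure IsBorcherdsCartan {ι : Type} (A : Matrix ι ι ℝ) : Prop where
  symmetrizable : ∃ d : ι → ℝ, (∀ i, 0 < d i) ∧ ∀ i j, d i * A i j = d j * A j i
  diag : ∀ i, 0 < A i i → A i i = 2
  off_diag : ∀ i j, i ≠ j → A i j ≤ 0
  integral : ∀ i j, 0 < A i i → i ≠ j → ∃ m : ℕ, A i j = -(m : ℝ)

namespace BKM

section Presentation

variable {ι : Type} (A : Matrix ι ι ℝ)

/-- The free Lie algebra on symbols `hᵢ`, `eᵢ`, `fᵢ`. -/
abbrev Free (ι : Type) : Type := FreeLieAlgebra ℂ (CartanMatrix.Generators ι)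

/-- The free generator `hᵢ`. -/
def genH (i : ι) : Free ι := FreeLieAlgebra.of ℂ (CartanMatrix.Generators.H i)

/-- The free generator `eᵢ`. -/
def genE (i : ι) : Free ι := FreeLieAlgebra.of ℂ (CartanMatrix.Generators.E i)

/-- The free generator `fᵢ`. -/
def genF (i : ι) : Free ι := FreeLieAlgebra.of ℂ (CartanMatrix.Generators.F i)

/-- The elements of the free Lie algebra that are set to zero in `𝔤(A)`. -/
inductive Relator : Free ι → Prop
  | hh (i j : ι) : Relator ⁅genH i, genH j⁆
  | he (i j : ι) : Relator (⁅genH i, genE j⁆ - (A i j : ℂ) • genE j)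
  | hf (i j : ι) : Relator (⁅genH i, genF j⁆ + (A i j : ℂ) • genF j)
  | ef (i : ι) : Relator (⁅genE i, genF i⁆ - genH i)
  | ef_ne (i j : ι) : i ≠ j → Relator ⁅genE i, genF j⁆
  | serreE (i j : ι) (m : ℕ) : i ≠ j → 0 < A i i → (m : ℝ) = -2 * (A i j / A i i) + 1 →
      Relator (((LieAlgebra.ad ℂ (Free ι) (genE i)) ^ m) (genE j))
  | serreF (i j : ι) (m : ℕ) : i ≠ j → 0 < A i i → (m : ℝ) = -2 * (A i j / A i i) + 1 →
      Relator (((LieAlgebra.ad ℂ (Free ι) (genF i)) ^ m) (genF j))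
  | ee (i j : ι) : A i j = 0 → Relator ⁅genE i, genE j⁆
  | ff (i j : ι) : A i j = 0 → Relator ⁅genF i, genF j⁆

/-- The Lie algebra `𝔤(A)` given by generators and relations. -/
abbrev Alg : Type :=
  Free ι ⧸ (LieSubmodule.lieSpan ℂ (Free ι) {x | Relator A x} : LieIdeal ℂ (Free ι))

/-- The generator `hᵢ` of `𝔤(A)`. -/
def algH (i : ι) : Alg A := LieSubmodule.Quotient.mk (genH i)

/-- The generator `eᵢ` of `𝔤(A)`. -/
def algE (i : ι) : Alg A := LieSubmodule.Quotient.mk (genE i)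

/-- The generator `fᵢ` of `𝔤(A)`. -/
def algF (i : ι) : Alg A := LieSubmodule.Quotient.mk (genF i)

/-- The subalgebra `𝔥(A)` of `𝔤(A)` generated by the `hᵢ`. -/
def algCartan : LieSubalgebra ℂ (Alg A) := LieSubalgebra.lieSpan ℂ (Alg A) (Set.range (algH A))

end Presentation

/-- An identification of a complex Lie algebra `L` with a Borcherds–Kac–Moody algebra
`(𝔤(A) / C) ⋊ D`, where `C` is a central ideal, contained in `𝔥(A)`, and `D` is a commutative Lie
algebra of derivations of `𝔤(A) / C` for which the generators are eigenvectors. -/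
structure Structure (L : Type*) [LieRing L] [LieAlgebra ℂ L] where
  ι : Type
  countable : Countable ι
  A : Matrix ι ι ℝ
  isBorcherdsCartan : IsBorcherdsCartan A
  C : LieIdeal ℂ (Alg A)
  central : ∀ c ∈ C, ∀ x : Alg A, ⁅c, x⁆ = 0
  C_le : ∀ c ∈ C, c ∈ algCartan A
  D : LieSubalgebra ℂ (LieDerivation ℂ (Alg A ⧸ C) (Alg A ⧸ C))
  commutative : ∀ d ∈ D, ∀ d' ∈ D, ⁅d, d'⁆ = 0
  /-- the derivations in `D` are degree derivations -/
  diagonal : ∀ d ∈ D, ∀ i, ∃ c : ℂ,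
    d (LieSubmodule.Quotient.mk (algE A i)) = c • LieSubmodule.Quotient.mk (algE A i) ∧
    d (LieSubmodule.Quotient.mk (algF A i)) = -c • LieSubmodule.Quotient.mk (algF A i)
  equiv : L ≃ₗ⁅ℂ⁆ ((Alg A ⧸ C) ⋊⁅D.incl⁆ D)

namespace Structure

variable {L : Type*} [LieRing L] [LieAlgebra ℂ L] (P : Structure L)

/-- The image in `L` of an element of `𝔤(A)`. -/
def ofAlg (x : Alg P.A) : L :=
  P.equiv.symm (LieAlgebra.SemiDirectSum.inl P.D.incl (LieSubmodule.Quotient.mk x))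

/-- The element of `L` that corresponds to a derivation in `D`. -/
def ofDer (d : P.D) : L := P.equiv.symm (LieAlgebra.SemiDirectSum.inr P.D.incl d)

/-- The Chevalley generator `eᵢ`. -/
def e (i : P.ι) : L := P.ofAlg (algE P.A i)

/-- The Chevalley generator `fᵢ`. -/
def f (i : P.ι) : L := P.ofAlg (algF P.A i)

/-- The Chevalley generator `hᵢ`. -/
def h (i : P.ι) : L := P.ofAlg (algH P.A i)

/-- The Cartan subalgebra `(𝔥(A) / C) ⋊ D`. -/
def cartan : LieSubalgebra ℂ L :=
  LieSubalgebra.lieSpan ℂ L (Set.range P.h ∪ Set.range P.ofDer)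

/-- The positive subalgebra, generated by the `eᵢ`. -/
def pos : LieSubalgebra ℂ L := LieSubalgebra.lieSpan ℂ L (Set.range P.e)

/-- The simultaneous eigenspace of the Cartan subalgebra for the functional `α`. -/
def rootSpace (α : Module.Dual ℂ P.cartan) : Submodule ℂ L where
  carrier := {v | ∀ s : P.cartan, ⁅(s : L), v⁆ = α s • v}
  zero_mem' s := by simp
  add_mem' {v w} hv hw s := by rw [lie_add, hv s, hw s, smul_add]
  smul_mem' c v hv s := by rw [lie_smul, hv s, smul_comm]

/-- Roots: the nonzero eigenvalues of the Cartan subalgebra. -/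
def IsRoot (α : Module.Dual ℂ P.cartan) : Prop := α ≠ 0 ∧ ∃ v ∈ P.rootSpace α, v ≠ 0

/-- Simple roots: the roots that are the eigenvalue of some `eᵢ`. -/
def IsSimpleRoot (α : Module.Dual ℂ P.cartan) : Prop :=
  P.IsRoot α ∧ ∃ i, P.e i ∈ P.rootSpace α

/-- Positive roots: the roots that are non-negative integer combinations of simple roots. -/
def IsPositiveRoot (α : Module.Dual ℂ P.cartan) : Prop :=
  P.IsRoot α ∧ α ∈ AddSubmonoid.closure {β | P.IsSimpleRoot β}

/-- Negative roots: the roots `α` such that `-α` is positive. -/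
def IsNegativeRoot (α : Module.Dual ℂ P.cartan) : Prop :=
  P.IsRoot α ∧ P.IsPositiveRoot (-α)

/-- The exterior algebra of the positive subalgebra. -/
abbrev Ext : Type _ := ExteriorAlgebra ℂ P.pos

/-- The `α` weight space of the exterior algebra of the positive subalgebra: the Cartan subalgebra
acts by the derivations that extend its adjoint action (computed in the exterior algebra of `L`). -/
def weightSpace (α : Module.Dual ℂ P.cartan) : Submodule ℂ P.Ext where
  carrier := {x | ∀ s : P.cartan,
    extDer (ExteriorAlgebra.map (P.pos : Submodule ℂ L).subtype x) (LieAlgebra.ad ℂ L (s : L))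
      = α s • ExteriorAlgebra.map (P.pos : Submodule ℂ L).subtype x}
  zero_mem' s := by simp
  add_mem' {v w} hv hw s := by
    rw [map_add, map_add, LinearMap.add_apply, hv s, hw s, smul_add]
  smul_mem' c v hv s := by
    rw [map_smul, map_smul, LinearMap.smul_apply, hv s, smul_comm]

end Structure

/-! ### Borcherds–Kac–Moody algebras over a subring of `ℂ` -/

/-- The structure of a BKM algebra over `R` on a Lie algebra `g` over `R`. -/
structure IntegralStructure (R : Subring ℂ) (g : Type*) [LieRing g] [LieAlgebra R g] where
  complex : Structure (ℂ ⊗[R] g)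
  cartan : LieSubalgebra R g
  cartan_baseChange :
    (cartan : Submodule R g).baseChange ℂ = (complex.cartan : Submodule ℂ (ℂ ⊗[R] g))
  root_integral : ∀ α, complex.IsRoot α → ∀ s : complex.cartan, ∀ h ∈ cartan,
    (s : ℂ ⊗[R] g) = 1 ⊗ₜ[R] h → α s ∈ R
  /-- `g` is the sum of the Cartan subalgebra and the root spaces, ... -/
  iSup_eq_top : (cartan : Submodule R g) ⊔ ⨆ α : {α // complex.IsRoot α},
    ((complex.rootSpace α).restrictScalars R).comap (TensorProduct.mk R ℂ g 1) = ⊤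
  /-- ... and this sum is direct. -/
  independent : iSupIndep (fun o : Option {α // complex.IsRoot α} =>
    o.elim (cartan : Submodule R g) fun α =>
      ((complex.rootSpace α).restrictScalars R).comap (TensorProduct.mk R ℂ g 1))

namespace IntegralStructure

variable {R : Subring ℂ} {g : Type*} [LieRing g] [LieAlgebra R g] (G : IntegralStructure R g)

/-- The positive subalgebra of `g`: the elements that lie in the positive subalgebra of `g ⊗ ℂ`. -/
def pos : LieSubalgebra R g where
  carrier := {x | (1 : ℂ) ⊗ₜ[R] x ∈ G.complex.pos}
  zero_mem' := by
    change (1 : ℂ) ⊗ₜ[R] (0 : g) ∈ G.complex.pos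
    rw [TensorProduct.tmul_zero]; exact zero_mem _
  add_mem' {x y} hx hy := by
    change (1 : ℂ) ⊗ₜ[R] (x + y) ∈ G.complex.pos
    rw [TensorProduct.tmul_add]; exact add_mem hx hy
  smul_mem' c x hx := by
    change (1 : ℂ) ⊗ₜ[R] (c • x) ∈ G.complex.pos
    have h : (1 : ℂ) ⊗ₜ[R] (c • x) = (c : ℂ) • ((1 : ℂ) ⊗ₜ[R] x) := by
      rw [← TensorProduct.smul_tmul, TensorProduct.smul_tmul']
      congr 1
    rw [h]
    exact G.complex.pos.smul_mem _ hx
  lie_mem' {x y} hx hy := by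
    have h := G.complex.pos.lie_mem hx hy
    rwa [LieAlgebra.ExtendScalars.bracket_tmul, mul_one] at h

/-- The map from the positive subalgebra of `g` to that of `g ⊗ ℂ`. -/
def posToComplex : G.pos →ₗ[R] G.complex.pos where
  toFun x := ⟨(1 : ℂ) ⊗ₜ[R] (x : g), x.2⟩
  map_add' _ _ := Subtype.ext (TensorProduct.tmul_add _ _ _)
  map_smul' _ _ := Subtype.ext (TensorProduct.tmul_smul _ _ _)

/-- The exterior algebra over `R` of the positive subalgebra. -/
abbrev Ext : Type _ := ExteriorAlgebra R G.pos

/-- The map of exterior algebras induced by the inclusion of `g` in `g ⊗ ℂ`. -/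
def extToComplex : G.Ext →ₐ[R] G.complex.Ext :=
  ExteriorAlgebra.lift R ⟨((ExteriorAlgebra.ι ℂ).restrictScalars R) ∘ₗ G.posToComplex,
    fun x => ExteriorAlgebra.ι_sq_zero (R := ℂ) (G.posToComplex x)⟩

/-- A nondegenerate contravariant hermitian form on a BKM algebra `g` over `R`. It is given by its
sesquilinear extension to `g ⊗ ℂ` (linear in the first variable). Contravariance refers to a
conjugate-linear involution `ω` of the Lie algebra `g ⊗ ℂ` that exchanges `eᵢ` and `fᵢ`, up to a
common sign. -/
structure ContravariantForm where
  form : (ℂ ⊗[R] g) →ₗ[ℂ] (ℂ ⊗[R] g) →ₗ⋆[ℂ] ℂ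
  mem_R : ∀ x y : g, form (1 ⊗ₜ[R] x) (1 ⊗ₜ[R] y) ∈ R
  hermitian : ∀ x y, form y x = conj (form x y)
  nondegenerate : ∀ x : g, (∀ y : g, form (1 ⊗ₜ[R] x) (1 ⊗ₜ[R] y) = 0) → x = 0
  ω : (ℂ ⊗[R] g) →ₗ⋆[ℂ] (ℂ ⊗[R] g)
  ω_lie : ∀ x y, ω ⁅x, y⁆ = ⁅ω x, ω y⁆
  ω_ω : ∀ x, ω (ω x) = x
  sign : ℤˣ
  ω_e : ∀ i, ω (G.complex.e i) = sign • G.complex.f i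
  contravariant : ∀ u x y, form ⁅u, x⁆ y = -form x ⁅ω u, y⁆

namespace ContravariantForm

variable {G} (Φ : G.ContravariantForm)

/-- `t` represents the functional `α` on the Cartan subalgebra, with respect to the invariant
bilinear form `(x, y) = ⟨x, ω y⟩`. -/
def Represents (t : G.complex.cartan) (α : Module.Dual ℂ G.complex.cartan) : Prop :=
  ∀ s : G.complex.cartan, Φ.form s (Φ.ω t) = α s

open Classical in
/-- The vector `t_α` of the Cartan subalgebra that represents `α` (zero if there is none). -/
def dualVector (α : Module.Dual ℂ G.complex.cartan) : G.complex.cartan :=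
  if h : ∃ t, Φ.Represents t α then h.choose else 0

/-- The pairing `(α, β) = β (t_α)` of functionals on the Cartan subalgebra, for `α` represented by
a vector `t_α`, in particular for `α` in the root lattice. -/
def pairing (α β : Module.Dual ℂ G.complex.cartan) : ℂ := β (Φ.dualVector α)

/-- Weyl vectors: `(ρ, α) = -(α, α) / 2` for all simple roots `α`. -/
def IsWeylVector (ρ : Module.Dual ℂ G.complex.cartan) : Prop :=
  ∀ α, G.complex.IsSimpleRoot α → Φ.pairing α ρ = -Φ.pairing α α / 2

/-- The hermitian form on the exterior algebra of the positive subalgebra of `g ⊗ ℂ` induced by the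
contravariant form. -/
def formExt : G.complex.Ext →ₗ[ℂ] G.complex.Ext →ₗ⋆[ℂ] ℂ :=
  extForm ((Φ.form.domRestrict (G.complex.pos : Submodule ℂ (ℂ ⊗[R] g))).compl₂
    (G.complex.pos : Submodule ℂ (ℂ ⊗[R] g)).subtype)

/-- `d` is adjoint to the Chevalley–Eilenberg boundary `δ` of the positive subalgebra of `g ⊗ ℂ`. -/
def IsAdjoint (d : G.complex.Ext →ₗ[ℂ] G.complex.Ext) : Prop :=
  ∀ x y, Φ.formExt (d x) y = Φ.formExt x (ceBoundary ℂ G.complex.pos y)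

/-- `d` is adjoint to the Chevalley–Eilenberg boundary `δ` of the positive subalgebra of `g`. -/
def IsIntegralAdjoint (d : G.Ext →ₗ[R] G.Ext) : Prop :=
  ∀ x y, Φ.formExt (G.extToComplex (d x)) (G.extToComplex y)
    = Φ.formExt (G.extToComplex x) (G.extToComplex (ceBoundary R G.pos y))

end ContravariantForm

end IntegralStructure

end BKM

end

/-! Since `[x, y] ∧ w = x · (y ∧ w) - y ∧ (x · w)` and the `eᵢ` generate `𝔫`, the exterior algebra
of `𝔫` is generated from `1` by two families of operators: exterior multiplication by `eᵢ`, and the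
adjoint action `θᵢ` of `eᵢ` (`ext_eq_top_of_stable`). Existence of `d` and the formula for `Δ` are
checked at `1` and propagated along these operators. No Casimir element and no dual bases occur, so
root spaces may be infinite-dimensional.

The adjoint of `eᵢ ∧` is the contraction by `⟨·, eᵢ⟩`, which vanishes on `[𝔫, 𝔫]` and therefore
anticommutes with `δ`. The adjoint of `ad eᵢ` on `𝔫` is `-ε ad fᵢ`, corrected by a multiple of `hᵢ`
so that its values stay in `𝔫`. The correction spoils the derivation property by a term that
involves the vector `tᵢ` representing the weight `αᵢ` of `eᵢ` (`adjoint_lie`). Dualizing gives `d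
(eᵢ ∧ w) = -eᵢ ∧ d w` and `d (θᵢ w) = θᵢ (d w) + eᵢ ∧ (tᵢ · w)`. Hence `d` exists, and combining
with `δ` gives `Δ (eᵢ ∧ w) = eᵢ ∧ (tᵢ · w + Δ w)` and `Δ (θᵢ w) = θᵢ (tᵢ · w + Δ w)`. Passing from
weight `β` to `β + αᵢ` thus adds `(β, αᵢ)` to the eigenvalue. By the Weyl vector condition `(α, α +
2ρ) / 2` obeys the same recursion (`eigenvalue_add`), and both start at `0`.

The groundwork is nondegeneracy. The root decomposition makes the Cartan subalgebra its own
centralizer, and `ω` preserves it (`ω_mem_cartan`). The whole algebra is `𝔥 + 𝔫 + ω 𝔫`, and because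
no root is both positive and negative the weights of the three parts are distinct. So the form is
nondegenerate on `𝔥` and on `𝔫`, hence on the exterior algebra of `𝔫` (`extForm_nondegenerate`),
which yields all the uniqueness statements.

Over `R`, every weight vector lies in `𝔫` or in `𝔥 + ω 𝔫`, so the positive subalgebra of `𝔤` spans
`𝔫` over `ℂ`. An `R`-linear adjoint is then the restriction of the complex one. -/

/-! ### Derivations and contractions of exterior algebras -/

section Exterior

variable {k M : Type*} [CommRing k] [AddCommGroup M] [Module k M]

/-- Induction on the exterior algebra, by adding vectors from the left. -/
theorem ExteriorAlgebra.ι_mul_induction {p : ExteriorAlgebra k M → Prop} (one : p 1)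
    (smul : ∀ (c : k) x, p x → p (c • x)) (add : ∀ x y, p x → p y → p (x + y))
    (ι_mul : ∀ y x, p x → p (ExteriorAlgebra.ι k y * x)) (x : ExteriorAlgebra k M) : p x := by
  refine CliffordAlgebra.left_induction (0 : QuadraticForm k M) (fun c => ?_) add
    (fun x y hx => ι_mul y x hx) x
  rw [Algebra.algebraMap_eq_smul_one]
  exact smul c 1 one

/-- Two linear maps on the exterior algebra that satisfy the same recursion agree. -/
theorem ExteriorAlgebra.linearMap_ext_ι_mul {V : Type*} [AddCommGroup V] [Module k V]
    {f g : ExteriorAlgebra k M →ₗ[k] V} (one : f 1 = g 1)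
    (ι_mul : ∀ y x, f x = g x → f (ExteriorAlgebra.ι k y * x) = g (ExteriorAlgebra.ι k y * x)) :
    f = g := by
  refine LinearMap.ext fun x => ?_
  induction x using ExteriorAlgebra.ι_mul_induction with
  | one => exact one
  | smul c x hx => rw [map_smul, map_smul, hx]
  | add x y hx hy => rw [map_add, map_add, hx, hy]
  | ι_mul y x hx => exact ι_mul y x hx

/-- The left contraction of the exterior algebra by a functional. -/
noncomputable def extContract (φ : Module.Dual k M) :
    ExteriorAlgebra k M →ₗ[k] ExteriorAlgebra k M :=
  CliffordAlgebra.contractLeft (Q := (0 : QuadraticForm k M)) φ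

theorem extContract_one (φ : Module.Dual k M) : extContract φ 1 = 0 :=
  CliffordAlgebra.contractLeft_one (Q := (0 : QuadraticForm k M)) φ

theorem extContract_ι_mul (φ : Module.Dual k M) (y : M) (w : ExteriorAlgebra k M) :
    extContract φ (ExteriorAlgebra.ι k y * w) = φ y • w - ExteriorAlgebra.ι k y * extContract φ w :=
  CliffordAlgebra.contractLeft_ι_mul φ y w

/-- The derivation of the exterior algebra that extends an endomorphism. -/
noncomputable def extD (T : Module.End k M) : ExteriorAlgebra k M →ₗ[k] ExteriorAlgebra k M :=
  (LinearMap.applyₗ T) ∘ₗ extDer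

theorem extD_apply (T : Module.End k M) (w : ExteriorAlgebra k M) : extD T w = extDer w T := rfl

theorem extD_one (T : Module.End k M) : extD T 1 = 0 := extDer_one T

theorem extD_ι_mul (T : Module.End k M) (y : M) (w : ExteriorAlgebra k M) :
    extD T (ExteriorAlgebra.ι k y * w)
      = ExteriorAlgebra.ι k (T y) * w + ExteriorAlgebra.ι k y * extD T w :=
  extDer_ι_mul T y w

theorem extD_add (S T : Module.End k M) (w : ExteriorAlgebra k M) :
    extD (S + T) w = extD S w + extD T w := map_add (extDer w) S T

theorem extD_sub (S T : Module.End k M) (w : ExteriorAlgebra k M) :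
    extD (S - T) w = extD S w - extD T w := map_sub (extDer w) S T

theorem extD_smul (c : k) (T : Module.End k M) (w : ExteriorAlgebra k M) :
    extD (c • T) w = c • extD T w := map_smul (extDer w) c T

/-- A commutator of derivations is a derivation, so it is determined in degree one. -/
theorem extD_comm (S T : Module.End k M) (w : ExteriorAlgebra k M) :
    extD S (extD T w) = extD T (extD S w) + extD (S * T - T * S) w := by
  suffices h : extD S ∘ₗ extD T = extD T ∘ₗ extD S + extD (S * T - T * S) from
    LinearMap.congr_fun h w
  refine ExteriorAlgebra.linearMap_ext_ι_mul ?_ fun y x hx => ?_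
  · simp [extD_one]
  · simp only [LinearMap.comp_apply, LinearMap.add_apply, extD_ι_mul, map_add,
      LinearMap.sub_apply, Module.End.mul_apply, map_sub, sub_mul] at hx ⊢
    rw [hx, mul_add]
    abel

/-- The commutator of a contraction with a derivation is again an antiderivation of degree `-1`,
hence the contraction read off in degree one. -/
theorem extContract_extD (φ : Module.Dual k M) (T : Module.End k M) (w : ExteriorAlgebra k M) :
    extContract φ (extD T w) = extD T (extContract φ w) + extContract (φ ∘ₗ T) w := by
  suffices h : extContract φ ∘ₗ extD T = extD T ∘ₗ extContract φ + extContract (φ ∘ₗ T) from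
    LinearMap.congr_fun h w
  refine ExteriorAlgebra.linearMap_ext_ι_mul ?_ fun y x hx => ?_
  · simp [extD_one, extContract_one]
  · simp only [LinearMap.comp_apply, LinearMap.add_apply, extD_ι_mul, map_add,
      extContract_ι_mul, map_sub, map_smul] at hx ⊢
    rw [hx, mul_add]
    abel

/-- Contraction followed by exterior multiplication is a derivation, because the two signs cancel.
This makes the rank one terms in `extD_ceBoundary` explicit. -/
theorem extD_smulRight (φ : Module.Dual k M) (z : M) (w : ExteriorAlgebra k M) :
    extD (φ.smulRight z) w = ExteriorAlgebra.ι k z * extContract φ w := by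
  suffices h : extD (φ.smulRight z) = LinearMap.mulLeft k (ExteriorAlgebra.ι k z) ∘ₗ extContract φ
    from LinearMap.congr_fun h w
  refine ExteriorAlgebra.linearMap_ext_ι_mul ?_ fun y x hx => ?_
  · simp [extD_one, extContract_one]
  · simp only [LinearMap.comp_apply, extD_ι_mul, LinearMap.mulLeft_apply,
      extContract_ι_mul, LinearMap.smulRight_apply, map_smul, mul_sub, mul_smul_comm,
      smul_mul_assoc] at hx ⊢
    rw [hx, ← mul_assoc, ← mul_assoc,
      eq_neg_of_add_eq_zero_left (ExteriorAlgebra.ι_add_mul_swap y z), neg_mul, sub_eq_add_neg]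

theorem map_extD {M' : Type*} [AddCommGroup M'] [Module k M'] (f : M →ₗ[k] M')
    (T : Module.End k M) (T' : Module.End k M') (h : ∀ x, f (T x) = T' (f x))
    (w : ExteriorAlgebra k M) :
    ExteriorAlgebra.map f (extD T w) = extD T' (ExteriorAlgebra.map f w) := by
  suffices h : (ExteriorAlgebra.map f).toLinearMap ∘ₗ extD T
      = extD T' ∘ₗ (ExteriorAlgebra.map f).toLinearMap from LinearMap.congr_fun h w
  refine ExteriorAlgebra.linearMap_ext_ι_mul ?_ fun y x hx => ?_
  · simp [extD_one]
  · simp only [LinearMap.comp_apply, extD_ι_mul, AlgHom.toLinearMap_apply, map_add, map_mul,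
      ExteriorAlgebra.map_apply_ι, h] at hx ⊢
    rw [hx]

end Exterior

/-! ### Commutation rules for the boundary -/

section ChevalleyEilenberg

variable {k n : Type*} [CommRing k] [LieRing n] [LieAlgebra k n]

/-- The boundary and a derivation of the exterior algebra commute up to a term that measures the
failure of the endomorphism to be a derivation of the Lie algebra. -/
theorem extD_ceBoundary (T U : Module.End k n) (φ : Module.Dual k n)
    (h : ∀ x y, T ⁅x, y⁆ = ⁅T x, y⁆ + ⁅x, T y⁆ + (φ y • U x - φ x • U y))
    (w : ExteriorAlgebra k n) :
    extD T (ceBoundary k n w) = ceBoundary k n (extD T w) - extD U (extContract φ w) := by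
  suffices h : extD T ∘ₗ ceBoundary k n = ceBoundary k n ∘ₗ extD T - extD U ∘ₗ extContract φ from
    LinearMap.congr_fun h w
  refine ExteriorAlgebra.linearMap_ext_ι_mul ?_ fun x w hw => ?_
  · simp [extD_one, extContract_one, ceBoundary_one]
  · simp only [LinearMap.comp_apply, LinearMap.sub_apply] at hw ⊢
    -- For fixed `x`, the commutator of `T` and `ad x` is `ad (T x)` plus the defect, which is the
    -- rank one map `y ↦ φ y • U x` minus a multiple of `U`.
    have key : extD T (extD (LieAlgebra.ad k n x) w)
        = extD (LieAlgebra.ad k n x) (extD T w) + extD (LieAlgebra.ad k n (T x)) w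
          + (ExteriorAlgebra.ι k (U x) * extContract φ w - φ x • extD U w) := by
      rw [extD_comm, add_assoc, add_right_inj, ← extD_smulRight, ← extD_smul, ← extD_sub,
        ← extD_add]
      have hT : T * LieAlgebra.ad k n x - LieAlgebra.ad k n x * T
          = LieAlgebra.ad k n (T x) + (φ.smulRight (U x) - φ x • U) := by
        refine LinearMap.ext fun y => ?_
        simp [h x y]
        abel
      rw [hT]
    simp only [ceBoundary_ι_mul, ← extD_apply, map_sub, extD_ι_mul, map_add, extContract_ι_mul,
      map_smul, hw, key, mul_sub]
    abel

/-- Derivations of the Lie algebra commute with the boundary. -/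
theorem extD_ceBoundary_of_derivation (T : Module.End k n)
    (h : ∀ x y, T ⁅x, y⁆ = ⁅T x, y⁆ + ⁅x, T y⁆) (w : ExteriorAlgebra k n) :
    extD T (ceBoundary k n w) = ceBoundary k n (extD T w) := by
  have h' := extD_ceBoundary T 0 0 (fun y z => by simp [h]) w
  rwa [← zero_smul k (0 : Module.End k n), extD_smul, zero_smul, sub_zero] at h'

theorem extD_ad_ceBoundary (x : n) (w : ExteriorAlgebra k n) :
    extD (LieAlgebra.ad k n x) (ceBoundary k n w)
      = ceBoundary k n (extD (LieAlgebra.ad k n x) w) :=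
  extD_ceBoundary_of_derivation _ (fun y z => by simp) w

/-- Such a `φ` is a 1-cocycle: `φ ∘ ad x = 0`, so the contraction commutes with the adjoint action,
and only the sign from passing `x` remains. -/
theorem extContract_ceBoundary (φ : Module.Dual k n) (h : ∀ x y : n, φ ⁅x, y⁆ = 0)
    (w : ExteriorAlgebra k n) :
    extContract φ (ceBoundary k n w) = -ceBoundary k n (extContract φ w) := by
  suffices h : extContract φ ∘ₗ ceBoundary k n = -(ceBoundary k n ∘ₗ extContract φ) from
    LinearMap.congr_fun h w
  refine ExteriorAlgebra.linearMap_ext_ι_mul ?_ fun x w hw => ?_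
  · simp [extContract_one, ceBoundary_one]
  · simp only [LinearMap.comp_apply, LinearMap.neg_apply] at hw ⊢
    have h0 : φ ∘ₗ LieAlgebra.ad k n x = 0 := by ext y; simp [h]
    have h1 : extContract (0 : Module.Dual k n) w = 0 := by
      simp [extContract]
    simp only [ceBoundary_ι_mul, ← extD_apply, map_sub, extContract_ι_mul, map_smul, hw,
      extContract_extD, h0, h1, add_zero, mul_neg]
    abel

/-- The Leibniz rule solved for the bracket: multiplication by a bracket is expressed by
multiplications and adjoint actions of its entries. -/
theorem extD_ad_ι_mul (x y : n) (w : ExteriorAlgebra k n) :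
    ExteriorAlgebra.ι k ⁅x, y⁆ * w = extD (LieAlgebra.ad k n x) (ExteriorAlgebra.ι k y * w)
      - ExteriorAlgebra.ι k y * extD (LieAlgebra.ad k n x) w := by
  rw [extD_ι_mul, LieAlgebra.ad_apply, add_sub_cancel_right]

theorem algebraMapInv_ι_mul {M : Type*} [AddCommGroup M] [Module k M] (x : M)
    (w : ExteriorAlgebra k M) :
    ExteriorAlgebra.algebraMapInv (ExteriorAlgebra.ι k x * w) = 0 := by
  rw [map_mul]
  simp [ExteriorAlgebra.algebraMapInv]

theorem algebraMapInv_extD {M : Type*} [AddCommGroup M] [Module k M] (T : Module.End k M)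
    (w : ExteriorAlgebra k M) : ExteriorAlgebra.algebraMapInv (extD T w) = 0 := by
  induction w using ExteriorAlgebra.ι_mul_induction with
  | one => simp [extD_one]
  | smul c x hx => simp [hx]
  | add x y hx hy => simp [hx, hy]
  | ι_mul y x hx => simp [extD_ι_mul, algebraMapInv_ι_mul]

theorem algebraMapInv_ceBoundary (w : ExteriorAlgebra k n) :
    ExteriorAlgebra.algebraMapInv (ceBoundary k n w) = 0 := by
  induction w using ExteriorAlgebra.ι_mul_induction with
  | one => simp [ceBoundary_one]
  | smul c x hx => simp [hx]
  | add x y hx hy => simp [hx, hy]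
  | ι_mul y x hx =>
    rw [ceBoundary_ι_mul, map_sub, algebraMapInv_ι_mul, ← extD_apply, algebraMapInv_extD, sub_zero]

/-- The boundary is natural with respect to maps of Lie algebras over different base rings. -/
theorem ceBoundary_natural {k' n' : Type*} [CommRing k'] [LieRing n'] [LieAlgebra k' n']
    [Algebra k k'] [Algebra k (ExteriorAlgebra k' n')]
    [IsScalarTower k k' (ExteriorAlgebra k' n')]
    (j : ExteriorAlgebra k n →ₐ[k] ExteriorAlgebra k' n') (i : n → n')
    (hj : ∀ x, j (ExteriorAlgebra.ι k x) = ExteriorAlgebra.ι k' (i x))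
    (hi : ∀ x y, i ⁅x, y⁆ = ⁅i x, i y⁆) (w : ExteriorAlgebra k n) :
    j (ceBoundary k n w) = ceBoundary k' n' (j w) := by
  have hD : ∀ (x : n) (w : ExteriorAlgebra k n), j (extD (LieAlgebra.ad k n x) w)
      = extD (LieAlgebra.ad k' n' (i x)) (j w) := by
    intro x w
    induction w using ExteriorAlgebra.ι_mul_induction with
    | one => simp [extD_one]
    | smul c w hw =>
      rw [map_smul, map_smul, map_smul, hw, ← algebraMap_smul k' c, ← algebraMap_smul k' c,
        map_smul]
    | add w v hw hv => simp [hw, hv]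
    | ι_mul y w hw => simp [extD_ι_mul, hj, hi, hw]
  induction w using ExteriorAlgebra.ι_mul_induction with
  | one => simp [ceBoundary_one]
  | smul c w hw =>
    rw [map_smul, map_smul, map_smul, hw, ← algebraMap_smul k' c, ← algebraMap_smul k' c, map_smul]
  | add w v hw hv => simp [hw, hv]
  | ι_mul y w hw => simp [ceBoundary_ι_mul, ← extD_apply, hj, hw, hD]

end ChevalleyEilenberg

/-! ### The form of determinants and its nondegeneracy -/

section ExteriorForm

variable {M : Type*} [AddCommGroup M] [Module ℂ M] (H : M →ₗ[ℂ] M →ₗ⋆[ℂ] ℂ)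

theorem extForm_one_left (y : ExteriorAlgebra ℂ M) :
    extForm H 1 y = conj (ExteriorAlgebra.algebraMapInv y) := by
  have h := CliffordAlgebra.foldr_one (0 : QuadraticForm ℂ M) (extFormStep H)
    (extFormStep_step H) extFormInit
  exact DFunLike.congr_fun h y

theorem extForm_ι_mul_left (x : M) (w y : ExteriorAlgebra ℂ M) :
    extForm H (ExteriorAlgebra.ι ℂ x * w) y = extForm H w (extContract (conjFunctional H x) y) := by
  have h := CliffordAlgebra.foldr_mul (0 : QuadraticForm ℂ M) (extFormStep H)
    (extFormStep_step H) extFormInit (ExteriorAlgebra.ι ℂ x) w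
  rw [show CliffordAlgebra.foldr (0 : QuadraticForm ℂ M) (extFormStep H) (extFormStep_step H)
    (CliffordAlgebra.foldr (0 : QuadraticForm ℂ M) (extFormStep H) (extFormStep_step H)
      extFormInit w) (ExteriorAlgebra.ι ℂ x) = _ from
    CliffordAlgebra.foldr_ι (0 : QuadraticForm ℂ M) (extFormStep H)
    (extFormStep_step H) _ x] at h
  exact DFunLike.congr_fun h y

theorem extForm_one_right (x : ExteriorAlgebra ℂ M) :
    extForm H x 1 = ExteriorAlgebra.algebraMapInv x := by
  induction x using ExteriorAlgebra.ι_mul_induction with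
  | one => simp [extForm_one_left]
  | smul c x hx => simp [hx]
  | add x y hx hy => simp [hx, hy]
  | ι_mul y x hx => rw [extForm_ι_mul_left, extContract_one, map_zero, algebraMapInv_ι_mul]

variable {H}

/-- The form is defined by expansion along rows; hermitian symmetry of `H` allows expansion along
columns as well. -/
theorem extForm_ι_mul_right (hH : ∀ x y, H y x = conj (H x y)) (x : M)
    (v w : ExteriorAlgebra ℂ M) :
    extForm H v (ExteriorAlgebra.ι ℂ x * w) = extForm H (extContract (conjFunctional H x) v) w := by
  induction v using ExteriorAlgebra.ι_mul_induction generalizing w with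
  | one => simp [extForm_one_left, algebraMapInv_ι_mul, extContract_one]
  | smul c v hv => simp [hv]
  | add v v' hv hv' => simp [hv, hv']
  | ι_mul y v hv =>
    simp only [extForm_ι_mul_left, extContract_ι_mul, map_sub, hv, LinearMap.sub_apply, map_smul,
      LinearMap.smul_apply, LinearMap.map_smulₛₗ]
    simp only [conjFunctional, LinearMap.coe_mk, AddHom.coe_mk, hH y x]

theorem extForm_hermitian (hH : ∀ x y, H y x = conj (H x y)) (v w : ExteriorAlgebra ℂ M) :
    extForm H w v = conj (extForm H v w) := by
  induction v using ExteriorAlgebra.ι_mul_induction generalizing w with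
  | one => simp [extForm_one_left, extForm_one_right]
  | smul c v hv => simp [hv w, LinearMap.map_smulₛₗ]
  | add v v' hv hv' => simp [hv w, hv' w]
  | ι_mul y v hv => rw [extForm_ι_mul_left, extForm_ι_mul_right hH, hv]

/-- Adjoint endomorphisms extend to adjoint derivations. -/
theorem extForm_extD {S T : Module.End ℂ M} (h : ∀ x y, H (S x) y = H x (T y))
    (v w : ExteriorAlgebra ℂ M) : extForm H (extD S v) w = extForm H v (extD T w) := by
  induction v using ExteriorAlgebra.ι_mul_induction generalizing w with
  | one => simp [extForm_one_left, extD_one, algebraMapInv_extD]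
  | smul c v hv => simp [hv]
  | add v v' hv hv' => simp [hv, hv']
  | ι_mul y v hv =>
    have h' : conjFunctional H y ∘ₗ T = conjFunctional H (S y) := by
      refine LinearMap.ext fun x => ?_
      simp [conjFunctional, h]
    rw [extD_ι_mul, map_add, LinearMap.add_apply, extForm_ι_mul_left, extForm_ι_mul_left,
      extForm_ι_mul_left, hv, extContract_extD, map_add, h', add_comm]

/-- If no `z` separated `b` from `s`, the functional `⟨·, b⟩` would vanish on the common kernel of
finitely many functionals `⟨·, x⟩` and so be a combination of them. By nondegeneracy `b` would be in
the span. No finiteness of `M` is used. -/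
theorem exists_separating (hH : ∀ x y, H y x = conj (H x y))
    (hnd : ∀ x, (∀ y, H x y = 0) → x = 0) (s : Finset M) (b : M)
    (hb : b ∉ Submodule.span ℂ (s : Set M)) :
    ∃ z, conjFunctional H z b = 1 ∧ ∀ x ∈ s, conjFunctional H z x = 0 := by
  let K : M → M →ₗ[ℂ] ℂ := fun x => ⟨⟨fun z => H z x, by simp⟩, by simp⟩
  have hK : ∀ x z, K x z = H z x := fun _ _ => rfl
  suffices h : ∃ z, K b z ≠ 0 ∧ ∀ x ∈ s, K x z = 0 by
    obtain ⟨z, hz, hz'⟩ := h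
    refine ⟨(K b z)⁻¹ • z, ?_, fun x hx => ?_⟩
    · rw [hK] at hz
      simp [conjFunctional, hK, inv_mul_cancel₀ ((map_ne_zero (starRingEnd ℂ)).2 hz)]
    · have h0 : H z x = 0 := hz' x hx
      simp [conjFunctional, h0]
  by_contra! hcon
  have hle : (⨅ x : s, LinearMap.ker (K x)) ≤ LinearMap.ker (K b) := by
    intro z hz
    by_contra h0
    obtain ⟨x, hx, hx0⟩ := hcon z h0
    exact hx0 ((Submodule.mem_iInf _).1 hz ⟨x, hx⟩)
  obtain ⟨c, hc⟩ := (Submodule.mem_span_range_iff_exists_fun ℂ).1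
    (mem_span_of_iInf_ker_le_ker hle)
  refine hb ?_
  -- The coefficients are conjugated because `x ↦ K x` is conjugate-linear.
  have h0 : b - ∑ x : s, conj (c x) • (x : M) = 0 := by
    refine hnd _ fun y => ?_
    have h1 : H y (b - ∑ x : s, conj (c x) • (x : M)) = 0 := by
      have h2 := LinearMap.congr_fun hc y
      simp only [LinearMap.sum_apply, LinearMap.smul_apply, hK, smul_eq_mul] at h2
      rw [map_sub, map_sum, ← h2, sub_eq_zero]
      refine Finset.sum_congr rfl fun x _ => ?_
      simp [LinearMap.map_smulₛₗ]
    rw [hH, h1, map_zero]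
  rw [sub_eq_zero.1 h0]
  exact Submodule.sum_mem _ fun x _ => Submodule.smul_mem _ _ (Submodule.subset_span x.2)

theorem extContract_map_eq_zero (F : Submodule ℂ M) (φ : Module.Dual ℂ M) (h : ∀ x ∈ F, φ x = 0)
    (u : ExteriorAlgebra ℂ F) : extContract φ (ExteriorAlgebra.map F.subtype u) = 0 := by
  induction u using ExteriorAlgebra.ι_mul_induction with
  | one => simp [extContract_one]
  | smul c v hv => simp [hv]
  | add v v' hv hv' => simp [hv, hv']
  | ι_mul y v hv =>
    rw [map_mul, ExteriorAlgebra.map_apply_ι, extContract_ι_mul, hv]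
    simp [h y y.2]

theorem exists_map_eq_algebraMap (F : Submodule ℂ M) (h : ∀ x ∈ F, x = 0)
    (u : ExteriorAlgebra ℂ F) :
    ∃ c : ℂ, ExteriorAlgebra.map F.subtype u = algebraMap ℂ _ c := by
  induction u using ExteriorAlgebra.ι_mul_induction with
  | one => exact ⟨1, by simp⟩
  | smul c v hv =>
    obtain ⟨a, ha⟩ := hv
    exact ⟨c * a, by rw [map_smul, ha, map_mul, Algebra.smul_def]⟩
  | add v v' hv hv' =>
    obtain ⟨a, ha⟩ := hv
    obtain ⟨a', ha'⟩ := hv'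
    exact ⟨a + a', by simp [ha, ha']⟩
  | ι_mul y v hv => exact ⟨0, by simp [h y y.2]⟩

theorem range_extMap_mono {F F' : Submodule ℂ M} (h : F ≤ F') :
    LinearMap.range (ExteriorAlgebra.map F.subtype).toLinearMap
      ≤ LinearMap.range (ExteriorAlgebra.map F'.subtype).toLinearMap := by
  rintro _ ⟨u, rfl⟩
  refine ⟨ExteriorAlgebra.map (Submodule.inclusion h) u, ?_⟩
  change ((ExteriorAlgebra.map F'.subtype).comp (ExteriorAlgebra.map (Submodule.inclusion h))) u = _
  rw [ExteriorAlgebra.map_comp_map]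
  rfl

theorem exists_mem_range_extMap (y : ExteriorAlgebra ℂ M) : ∃ s : Finset M,
    y ∈ LinearMap.range (ExteriorAlgebra.map (Submodule.span ℂ (s : Set M)).subtype).toLinearMap := by
  classical
  induction y using ExteriorAlgebra.ι_mul_induction with
  | one => exact ⟨∅, 1, by simp⟩
  | smul c v hv =>
    obtain ⟨s, hs⟩ := hv
    exact ⟨s, Submodule.smul_mem _ _ hs⟩
  | add v v' hv hv' =>
    obtain ⟨s, hs⟩ := hv
    obtain ⟨s', hs'⟩ := hv'
    exact ⟨s ∪ s', add_mem (range_extMap_mono (Submodule.span_mono (by simp)) hs)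
      (range_extMap_mono (Submodule.span_mono (by simp)) hs')⟩
  | ι_mul y v hv =>
    obtain ⟨s, hs⟩ := hv
    obtain ⟨u, hu⟩ := range_extMap_mono (Submodule.span_mono
      (show (s : Set M) ⊆ (insert y s : Finset M) by simp)) hs
    refine ⟨insert y s, ExteriorAlgebra.ι ℂ ⟨y, Submodule.subset_span (by simp)⟩ * u, ?_⟩
    rw [← hu]
    simp

/-- This isolates the last vector of a finite spanning set, so that nondegeneracy can be proved by
induction on the set. -/
theorem exists_add_ι_mul (s : Finset M) (b : M) [DecidableEq M]
    (u : ExteriorAlgebra ℂ (Submodule.span ℂ ((insert b s : Finset M) : Set M))) :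
    ∃ p q : ExteriorAlgebra ℂ (Submodule.span ℂ (s : Set M)),
      ExteriorAlgebra.map (Submodule.subtype _) u = ExteriorAlgebra.map (Submodule.subtype _) p
        + ExteriorAlgebra.ι ℂ b * ExteriorAlgebra.map (Submodule.subtype _) q := by
  induction u using ExteriorAlgebra.ι_mul_induction with
  | one => exact ⟨1, 0, by simp⟩
  | smul c v hv =>
    obtain ⟨p, q, h⟩ := hv
    exact ⟨c • p, c • q, by simp [h]⟩
  | add v v' hv hv' =>
    obtain ⟨p, q, h⟩ := hv
    obtain ⟨p', q', h'⟩ := hv'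
    exact ⟨p + p', q + q', by simp only [map_add, h, h', mul_add]; abel⟩
  | ι_mul y v hv =>
    obtain ⟨p, q, h⟩ := hv
    obtain ⟨y, hy⟩ := y
    obtain ⟨t, z, hz, rfl⟩ := Submodule.mem_span_insert.1 (by simpa using hy)
    -- The new factor is `t b + z`, and `(t b + z) ∧ (p + b ∧ q) = z ∧ p + b ∧ (t p - z ∧ q)`.
    refine ⟨ExteriorAlgebra.ι ℂ ⟨z, hz⟩ * p, t • p - ExteriorAlgebra.ι ℂ ⟨z, hz⟩ * q, ?_⟩
    have hb : ExteriorAlgebra.ι ℂ b * ExteriorAlgebra.ι ℂ b = 0 := ExteriorAlgebra.ι_sq_zero b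
    have hz' : ExteriorAlgebra.ι ℂ b * ExteriorAlgebra.ι ℂ z
        = -(ExteriorAlgebra.ι ℂ z * ExteriorAlgebra.ι ℂ b) :=
      eq_neg_of_add_eq_zero_left (ExteriorAlgebra.ι_add_mul_swap b z)
    simp only [map_mul, ExteriorAlgebra.map_apply_ι, Submodule.subtype_apply, h, map_add, map_smul,
      map_sub, add_mul, mul_add, mul_sub, smul_mul_assoc, mul_smul_comm, ← mul_assoc, hb, hz',
      zero_mul, smul_zero, neg_mul]
    abel

/-- The form on the exterior algebra induced by a nondegenerate hermitian form is nondegenerate. -/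
theorem extForm_nondegenerate (hH : ∀ x y, H y x = conj (H x y))
    (hnd : ∀ x, (∀ y, H x y = 0) → x = 0) (v : ExteriorAlgebra ℂ M)
    (hv : ∀ w, extForm H w v = 0) : v = 0 := by
  classical
  obtain ⟨s, u, rfl⟩ := exists_mem_range_extMap v
  rw [AlgHom.toLinearMap_apply] at hv ⊢
  induction s using Finset.induction_on with
  | empty =>
    obtain ⟨c, hc⟩ := exists_map_eq_algebraMap _ (by simp) u
    have h := hv 1
    rw [hc, extForm_one_left] at h
    simp at h
    rw [hc, h, map_zero]
  | insert b s hb ih =>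
    obtain ⟨p, q, h⟩ := exists_add_ι_mul s b u
    rw [h] at hv ⊢
    by_cases hbs : b ∈ Submodule.span ℂ (s : Set M)
    · have e : ExteriorAlgebra.map (Submodule.span ℂ (s : Set M)).subtype
          (p + ExteriorAlgebra.ι ℂ ⟨b, hbs⟩ * q)
          = ExteriorAlgebra.map (Submodule.subtype _) p
            + ExteriorAlgebra.ι ℂ b * ExteriorAlgebra.map (Submodule.subtype _) q := by
        rw [map_add, map_mul, ExteriorAlgebra.map_apply_ι, Submodule.subtype_apply]
      rw [← e] at hv ⊢
      exact ih _ hv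
    -- Contraction by `⟨·, z⟩` kills `p` and turns `b ∧ q` into `q`. So `q` is in the radical and
    -- vanishes by induction, and then so does `p`.
    · obtain ⟨z, hz1, hz0⟩ := exists_separating hH hnd s b hbs
      have hker : ∀ x ∈ Submodule.span ℂ (s : Set M), conjFunctional H z x = 0 := fun x hx =>
        (Submodule.span_le (p := LinearMap.ker (conjFunctional H z))).2 hz0 hx
      have hq : ExteriorAlgebra.map (Submodule.span ℂ (s : Set M)).subtype q = 0 := by
        refine ih q fun w => ?_
        have h1 := hv (ExteriorAlgebra.ι ℂ z * w)
        rwa [extForm_ι_mul_left, map_add, extContract_map_eq_zero _ _ hker, zero_add,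
          extContract_ι_mul, hz1, one_smul, extContract_map_eq_zero _ _ hker, mul_zero,
          sub_zero] at h1
      rw [hq, mul_zero, add_zero] at hv ⊢
      exact ih p hv

end ExteriorForm

/-! ### Simultaneous eigenvectors -/

section Weights

variable {K V S : Type*} [Field K] [AddCommGroup V] [Module K V] [AddCommGroup S] [Module K S]
  (T : S → Module.End K V)

/-- `v` is a simultaneous eigenvector of the operators `T s`, with eigenvalues `α s`. -/
def IsWeightVector (α : Module.Dual K S) (v : V) : Prop := ∀ s, T s v = α s • v

variable {T}

/-- A subspace that is stable under the operators contains the components, of different weights,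
of its elements. -/
theorem IsWeightVector.mem_of_sum_mem {W : Submodule K V} (hW : ∀ s, ∀ v ∈ W, T s v ∈ W)
    (F : Finset (Module.Dual K S)) (x : Module.Dual K S → V)
    (hx : ∀ α ∈ F, IsWeightVector T α (x α)) (h : ∑ α ∈ F, x α ∈ W) : ∀ α ∈ F, x α ∈ W := by
  classical
  induction F using Finset.induction_on generalizing x with
  | empty => simp
  | insert a F ha ih =>
    have hF : ∀ b ∈ F, x b ∈ W := by
      intro b hb
      have hab : ∃ s, b s - a s ≠ 0 := by
        by_contra! hcon
        exact ha ((LinearMap.ext fun s => sub_eq_zero.1 (hcon s) : b = a) ▸ hb)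
      obtain ⟨s, hs⟩ := hab
      -- The operator `T s - a s` removes the component of weight `a` and multiplies the one of
      -- weight `b` by a nonzero scalar.
      have h1 : ∑ c ∈ F, (c s - a s) • x c ∈ W := by
        have h2 := W.sub_mem (hW s _ h) (W.smul_mem (a s) h)
        rw [Finset.sum_insert ha, map_add, smul_add, hx a (Finset.mem_insert_self a F) s,
          add_sub_add_left_eq_sub, map_sum, Finset.smul_sum, ← Finset.sum_sub_distrib] at h2
        convert h2 using 2 with c hc
        rw [hx c (Finset.mem_insert_of_mem hc) s, sub_smul]
      have h3 := ih (fun c => (c s - a s) • x c) (fun c hc t => by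
        rw [map_smul, hx c (Finset.mem_insert_of_mem hc) t, smul_comm]) h1 b hb
      exact (Submodule.smul_mem_iff W hs).1 h3
    intro α hα
    rcases Finset.mem_insert.1 hα with rfl | hα
    · rw [Finset.sum_insert ha] at h
      exact (Submodule.add_mem_iff_left W (W.sum_mem hF)).1 h
    · exact hF α hα

theorem Submodule.exists_sum_of_mem_span {A : Type*} (Q : Set A) (E : A → Submodule K V) {y : V}
    (hy : y ∈ Submodule.span K {v | ∃ α ∈ Q, v ∈ E α}) :
    ∃ (F : Finset A) (x : A → V), (∀ α ∈ F, α ∈ Q) ∧ (∀ α, x α ∈ E α) ∧ y = ∑ α ∈ F, x α := by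
  classical
  induction hy using Submodule.span_induction with
  | mem v hv =>
    obtain ⟨α, hα, hv⟩ := hv
    refine ⟨{α}, fun β => if β = α then v else 0, by simpa using hα, fun β => ?_, by simp⟩
    by_cases h : β = α
    · simpa [h] using hv
    · simp [h]
  | zero => exact ⟨∅, 0, by simp, fun _ => zero_mem _, by simp⟩
  | add y z _ _ hy hz =>
    obtain ⟨F, x, hF, hx, rfl⟩ := hy
    obtain ⟨F', x', hF', hx', rfl⟩ := hz
    refine ⟨F ∪ F', fun α => (if α ∈ F then x α else 0) + if α ∈ F' then x' α else 0, ?_, ?_, ?_⟩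
    · intro α hα
      rcases Finset.mem_union.1 hα with h | h
      exacts [hF α h, hF' α h]
    · intro α
      refine add_mem ?_ ?_ <;> split_ifs
      exacts [hx α, zero_mem _, hx' α, zero_mem _]
    · rw [Finset.sum_add_distrib, Finset.sum_ite_mem, Finset.sum_ite_mem,
        Finset.union_inter_cancel_left, Finset.union_inter_cancel_right]
  | smul c y _ hy =>
    obtain ⟨F, x, hF, hx, rfl⟩ := hy
    exact ⟨F, fun α => c • x α, hF, fun α => Submodule.smul_mem _ _ (hx α), Finset.smul_sum⟩

/-- A weight vector that is a sum of weight vectors is zero or equal to one of them. -/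
theorem IsWeightVector.eq_component (F : Finset (Module.Dual K S)) (x : Module.Dual K S → V)
    (hx : ∀ α ∈ F, IsWeightVector T α (x α)) {β : Module.Dual K S}
    (hβ : IsWeightVector T β (∑ α ∈ F, x α)) (h0 : ∑ α ∈ F, x α ≠ 0) :
    β ∈ F ∧ ∑ α ∈ F, x α = x β := by
  classical
  have hβF : β ∈ F := by
    by_contra hβF
    refine h0 ?_
    -- If `β` were a new weight, the sum with an added component `-∑ x` of weight `β` would be zero,
    -- so each component, in particular this one, would be zero.
    have h := IsWeightVector.mem_of_sum_mem (T := T) (W := ⊥) (fun s v hv => by simp_all)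
      (insert β F) (fun α => if α = β then -∑ α ∈ F, x α else x α) (fun α hα => by
        by_cases h : α = β
        · rw [if_pos h, h]
          intro s
          rw [map_neg, hβ s, smul_neg]
        · rw [if_neg h]
          exact hx α (Finset.mem_of_mem_insert_of_ne hα h)) (by
        rw [Finset.sum_insert hβF, if_pos rfl, Submodule.mem_bot, neg_add_eq_zero]
        exact Finset.sum_congr rfl fun α hα => by
          rw [if_neg (show ¬α = β from fun h => hβF (h ▸ hα))])
      β (Finset.mem_insert_self β F)
    simpa using h
  refine ⟨hβF, ?_⟩
  -- Subtracting the total from the component of weight `β` gives a family with sum zero.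
  have h := IsWeightVector.mem_of_sum_mem (T := T) (W := ⊥) (fun s v hv => by simp_all)
    F (fun α => x α - if α = β then ∑ α ∈ F, x α else 0) (fun α hα => by
      by_cases h : α = β
      · rw [if_pos h]
        intro s
        rw [map_sub, hx α hα s, h, hβ s, smul_sub]
      · rw [if_neg h, sub_zero]
        exact hx α hα) (by
      rw [Finset.sum_sub_distrib, Finset.sum_ite_eq' F β, if_pos hβF, sub_self]
      exact zero_mem _) β hβF
  rw [if_pos rfl, Submodule.mem_bot, sub_eq_zero] at h
  exact h.symm

end Weights

/-! ### Generation of Lie algebras -/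

section Generation

variable {k L ι : Type*} [CommRing k] [LieRing L] [LieAlgebra k L]

/-- The Lie algebra generated by a family is spanned by its left-normed brackets. -/
theorem LieSubalgebra.lieSpan_range_induction (e : ι → L) {p : L → Prop} (zero : p 0)
    (add : ∀ x y, p x → p y → p (x + y)) (smul : ∀ (c : k) x, p x → p (c • x))
    (gen : ∀ i, p (e i))
    (lie : ∀ i, ∀ x ∈ LieSubalgebra.lieSpan k L (Set.range e), p x → p ⁅e i, x⁆) :
    ∀ x ∈ LieSubalgebra.lieSpan k L (Set.range e), p x := by
  have mem : ∀ i, e i ∈ LieSubalgebra.lieSpan k L (Set.range e) := fun i =>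
    LieSubalgebra.subset_lieSpan ⟨i, rfl⟩
  let N := LieSubalgebra.lieSpan k L (Set.range e)
  -- The elements whose bracket preserves both `N` and `p` form a subalgebra by the Jacobi identity.
  -- It contains the generators, hence `N`, and this makes `B` below closed under brackets.
  let A : LieSubalgebra k L :=
    { carrier := {u | ∀ x ∈ N, p x → ⁅u, x⁆ ∈ N ∧ p ⁅u, x⁆}
      zero_mem' := fun x _ _ => by rw [zero_lie]; exact ⟨zero_mem _, zero⟩
      add_mem' := fun {u v} hu hv x hx h => by
        rw [add_lie]
        exact ⟨add_mem (hu x hx h).1 (hv x hx h).1, add _ _ (hu x hx h).2 (hv x hx h).2⟩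
      smul_mem' := fun c u hu x hx h => by
        rw [smul_lie]
        exact ⟨N.smul_mem c (hu x hx h).1, smul _ _ (hu x hx h).2⟩
      lie_mem' := fun {u v} hu hv x hx h => by
        have h1 := hv x hx h
        have h2 := hu x hx h
        have h3 := hu _ h1.1 h1.2
        have h4 := hv _ h2.1 h2.2
        rw [lie_lie, sub_eq_add_neg, ← neg_one_smul k]
        exact ⟨add_mem h3.1 (N.smul_mem _ h4.1), add _ _ h3.2 (smul _ _ h4.2)⟩ }
  have hA : N ≤ A := LieSubalgebra.lieSpan_le.2 (by
    rintro _ ⟨i, rfl⟩ x hx h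
    exact ⟨N.lie_mem (mem i) hx, lie i x hx h⟩)
  let B : LieSubalgebra k L :=
    { carrier := {u | u ∈ N ∧ p u}
      zero_mem' := ⟨zero_mem _, zero⟩
      add_mem' := fun {u v} hu hv => ⟨add_mem hu.1 hv.1, add _ _ hu.2 hv.2⟩
      smul_mem' := fun c u hu => ⟨N.smul_mem c hu.1, smul _ _ hu.2⟩
      lie_mem' := fun {u v} hu hv => hA hu.1 v hv.1 hv.2 }
  have hB : N ≤ B := LieSubalgebra.lieSpan_le.2 (by
    rintro _ ⟨i, rfl⟩
    exact ⟨mem i, gen i⟩)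
  exact fun x hx => (hB hx).2

/-- The universal property lifts the generators to `A`, and the lift followed by the inclusion is
the identity. -/
theorem FreeLieAlgebra.mem_of_forall_of_mem {X : Type*} (A : LieSubalgebra k (FreeLieAlgebra k X))
    (h : ∀ x, FreeLieAlgebra.of k x ∈ A) (u : FreeLieAlgebra k X) : u ∈ A := by
  have e : A.incl.comp (FreeLieAlgebra.lift k fun x => (⟨FreeLieAlgebra.of k x, h x⟩ : A))
      = LieHom.id := FreeLieAlgebra.hom_ext fun x => by simp
  have h := LieHom.congr_fun e u
  rw [LieHom.coe_id, id] at h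
  rw [← h]
  exact Subtype.property _

end Generation

/-! ### The algebra of generators and relations -/

namespace BKM

section Algebra

variable {ι : Type} (A : Matrix ι ι ℝ)

/-- A homomorphism from the free Lie algebra that kills the relators kills the ideal that they
generate. -/
theorem map_eq_zero_of_mk_eq_zero {L : Type*} [LieRing L] [LieAlgebra ℂ L] (φ : Free ι →ₗ⁅ℂ⁆ L)
    (h : ∀ x, Relator A x → φ x = 0) (u : Free ι)
    (hu : (LieSubmodule.Quotient.mk u : Alg A) = 0) : φ u = 0 := by
  have hle : (LieSubmodule.lieSpan ℂ (Free ι) {x | Relator A x} : LieIdeal ℂ (Free ι)) ≤ φ.ker :=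
    LieSubmodule.lieSpan_le.2 fun x hx => φ.mem_ker.2 (h x hx)
  exact φ.mem_ker.1 (hle ((LieSubmodule.Quotient.mk_eq_zero').1 hu))

theorem mk_eq_zero_of_relator {x : Free ι} (h : Relator A x) :
    (LieSubmodule.Quotient.mk x : Alg A) = 0 :=
  LieSubmodule.Quotient.mk_eq_zero'.2 (LieSubmodule.subset_lieSpan h)

theorem algH_lie_algH (i j : ι) : ⁅algH A i, algH A j⁆ = 0 :=
  mk_eq_zero_of_relator A (.hh i j)

theorem algH_lie_algE (i j : ι) : ⁅algH A i, algE A j⁆ = (A i j : ℂ) • algE A j :=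
  sub_eq_zero.1 (mk_eq_zero_of_relator A (.he i j))

theorem algH_lie_algF (i j : ι) : ⁅algH A i, algF A j⁆ = -((A i j : ℂ) • algF A j) :=
  eq_neg_of_add_eq_zero_left (mk_eq_zero_of_relator A (.hf i j))

theorem algE_lie_algF (i : ι) : ⁅algE A i, algF A i⁆ = algH A i :=
  sub_eq_zero.1 (mk_eq_zero_of_relator A (.ef i))

theorem algE_lie_algF_ne (i j : ι) (h : i ≠ j) : ⁅algE A i, algF A j⁆ = 0 :=
  mk_eq_zero_of_relator A (.ef_ne i j h)

theorem algCartan_eq_span :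
    (algCartan A : Submodule ℂ (Alg A)) = Submodule.span ℂ (Set.range (algH A)) := by
  refine LieSubalgebra.coe_lieSpan_eq_span_of_forall_lie_eq_zero ?_
  rintro _ ⟨i, rfl⟩ _ ⟨j, rfl⟩
  exact algH_lie_algH A i j

/-- The endomorphism of the free Lie algebra that multiplies `eᵢ` by `2` and `fᵢ` by `1 / 2`, with
values in `𝔤(A)`. -/
noncomputable def scale : Free ι →ₗ⁅ℂ⁆ Alg A :=
  FreeLieAlgebra.lift ℂ fun x => match x with
    | .H i => algH A i
    | .E i => (2 : ℂ) • algE A i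
    | .F i => (2⁻¹ : ℂ) • algF A i

theorem scale_genH (i : ι) : scale A (genH i) = algH A i := FreeLieAlgebra.lift_of_apply _ _

theorem scale_genE (i : ι) : scale A (genE i) = (2 : ℂ) • algE A i :=
  FreeLieAlgebra.lift_of_apply _ _

theorem scale_genF (i : ι) : scale A (genF i) = (2⁻¹ : ℂ) • algF A i :=
  FreeLieAlgebra.lift_of_apply _ _

theorem map_ad_pow {L L' : Type*} [LieRing L] [LieAlgebra ℂ L] [LieRing L'] [LieAlgebra ℂ L']
    (φ : L →ₗ⁅ℂ⁆ L') (x y : L) (m : ℕ) :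
    φ ((LieAlgebra.ad ℂ L x ^ m) y) = (LieAlgebra.ad ℂ L' (φ x) ^ m) (φ y) := by
  induction m with
  | zero => simp
  | succ m ih => rw [pow_succ', pow_succ', Module.End.mul_apply, Module.End.mul_apply,
      LieAlgebra.ad_apply, LieAlgebra.ad_apply, LieHom.map_lie, ih]

/-- The relators are homogeneous for the grading with `eᵢ`, `fᵢ`, `hᵢ` in degrees `1`, `-1`, `0`, so
each is only multiplied by a power of `2`. -/
theorem scale_relator (x : Free ι) (h : Relator A x) : scale A x = 0 := by
  have hq : ∀ x y m, (LieSubmodule.Quotient.mk ((LieAlgebra.ad ℂ (Free ι) x ^ m) y) : Alg A)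
      = (LieAlgebra.ad ℂ (Alg A) (LieSubmodule.Quotient.mk x) ^ m)
        (LieSubmodule.Quotient.mk y) := by
    intro x y m
    induction m with
    | zero => rfl
    | succ m ih => rw [pow_succ', pow_succ', Module.End.mul_apply, Module.End.mul_apply,
        LieAlgebra.ad_apply, LieAlgebra.ad_apply, ← ih, LieSubmodule.Quotient.mk_bracket]
  have h0 := mk_eq_zero_of_relator A h
  cases h with
  | hh i j => rw [LieHom.map_lie, scale_genH, scale_genH, algH_lie_algH]
  | he i j =>
    rw [map_sub, LieHom.map_lie, map_smul, scale_genH, scale_genE, lie_smul, algH_lie_algE,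
      smul_comm, sub_self]
  | hf i j =>
    rw [map_add, LieHom.map_lie, map_smul, scale_genH, scale_genF, lie_smul, algH_lie_algF,
      smul_neg, smul_comm, neg_add_cancel]
  | ef i =>
    rw [map_sub, LieHom.map_lie, scale_genH, scale_genE, scale_genF, lie_smul, smul_lie,
      smul_smul, algE_lie_algF]
    norm_num
  | ef_ne i j hij =>
    rw [LieHom.map_lie, scale_genE, scale_genF, lie_smul, smul_lie, algE_lie_algF_ne A i j hij,
      smul_zero, smul_zero]
  | serreE i j m hij hi hm =>
    rw [hq] at h0
    rw [map_ad_pow, scale_genE, scale_genE, map_smul, map_smul, smul_pow, LinearMap.smul_apply]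
    exact (congrArg _ (congrArg _ h0)).trans (by simp)
  | serreF i j m hij hi hm =>
    rw [hq] at h0
    rw [map_ad_pow, scale_genF, scale_genF, map_smul, map_smul, smul_pow, LinearMap.smul_apply]
    exact (congrArg _ (congrArg _ h0)).trans (by simp)
  | ee i j hij =>
    rw [LieHom.map_lie, scale_genE, scale_genE, lie_smul, smul_lie]
    exact (congrArg _ (congrArg _ h0)).trans (by simp)
  | ff i j hij =>
    rw [LieHom.map_lie, scale_genF, scale_genF, lie_smul, smul_lie]
    exact (congrArg _ (congrArg _ h0)).trans (by simp)

/-- A Chevalley generator `eᵢ` that lies in the Cartan subalgebra is zero. -/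
theorem algE_eq_zero_of_mem_span (i : ι)
    (h : algE A i ∈ Submodule.span ℂ (Set.range (algH A))) : algE A i = 0 := by
  obtain ⟨c, hc⟩ := Finsupp.mem_span_range_iff_exists_finsupp.1 h
  -- The scaling fixes the combination of the `hⱼ` and doubles `eᵢ`, so `eᵢ = 2 eᵢ`.
  have h1 := map_eq_zero_of_mk_eq_zero A (scale A) (scale_relator A)
    ((c.sum fun j a => a • genH j) - genE i) (by
      have e : (LieSubmodule.Quotient.mk ((c.sum fun j a => a • genH j) - genE i) : Alg A)
          = (c.sum fun j a => a • algH A j) - algE A i := by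
        have e1 := map_sub (LieSubmodule.Quotient.mk'
          (LieSubmodule.lieSpan ℂ (Free ι) {x | Relator A x})) (c.sum fun j a => a • genH j)
            (genE i)
        rw [map_finsuppSum] at e1
        simp only [map_smul] at e1
        exact e1
      rw [e, hc, sub_self])
  rw [map_sub, map_finsuppSum, scale_genE] at h1
  simp only [map_smul, scale_genH] at h1
  rw [hc, two_smul, sub_add_cancel_left, neg_eq_zero] at h1
  exact h1

end Algebra

end BKM

/-! ### The Cartan subalgebra and the weights of the generators -/

namespace BKM.Structure

variable {L : Type*} [LieRing L] [LieAlgebra ℂ L] (P : Structure L)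

theorem ofAlg_lie (x y : Alg P.A) : P.ofAlg ⁅x, y⁆ = ⁅P.ofAlg x, P.ofAlg y⁆ := by
  simp only [ofAlg, LieSubmodule.Quotient.mk_bracket, LieHom.map_lie, LieEquiv.map_lie]

theorem ofAlg_add (x y : Alg P.A) : P.ofAlg (x + y) = P.ofAlg x + P.ofAlg y := by
  have h : (LieSubmodule.Quotient.mk (x + y) : Alg P.A ⧸ P.C)
      = LieSubmodule.Quotient.mk x + LieSubmodule.Quotient.mk y := rfl
  simp only [ofAlg, h, map_add]

theorem ofAlg_smul (c : ℂ) (x : Alg P.A) : P.ofAlg (c • x) = c • P.ofAlg x := by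
  have h : (LieSubmodule.Quotient.mk (c • x) : Alg P.A ⧸ P.C)
      = c • LieSubmodule.Quotient.mk x := rfl
  simp only [ofAlg, h, map_smul]

theorem ofAlg_zero : P.ofAlg 0 = 0 := by
  simpa using P.ofAlg_smul 0 0

theorem ofAlg_neg (x : Alg P.A) : P.ofAlg (-x) = -P.ofAlg x := by
  simpa using P.ofAlg_smul (-1) x

theorem h_lie_h (i j : P.ι) : ⁅P.h i, P.h j⁆ = 0 := by
  rw [h, h, ← ofAlg_lie, algH_lie_algH, ofAlg_zero]

theorem h_lie_e (i j : P.ι) : ⁅P.h i, P.e j⁆ = (P.A i j : ℂ) • P.e j := by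
  rw [h, e, ← ofAlg_lie, algH_lie_algE, ofAlg_smul]

theorem h_lie_f (i j : P.ι) : ⁅P.h i, P.f j⁆ = -((P.A i j : ℂ) • P.f j) := by
  rw [h, f, ← ofAlg_lie, algH_lie_algF, ofAlg_neg, ofAlg_smul]

theorem e_lie_f (i : P.ι) : ⁅P.e i, P.f i⁆ = P.h i := by
  rw [e, f, ← ofAlg_lie, algE_lie_algF, h]

theorem e_lie_f_ne (i j : P.ι) (hij : i ≠ j) : ⁅P.e i, P.f j⁆ = 0 := by
  rw [e, f, ← ofAlg_lie, algE_lie_algF_ne _ i j hij, ofAlg_zero]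

theorem ofDer_lie_ofAlg (d : P.D) (x : Alg P.A) : ⁅P.ofDer d, P.ofAlg x⁆
    = P.equiv.symm (LieAlgebra.SemiDirectSum.inl P.D.incl
      ((d : LieDerivation ℂ (Alg P.A ⧸ P.C) (Alg P.A ⧸ P.C)) (LieSubmodule.Quotient.mk x))) := by
  rw [ofDer, ofAlg, ← LieEquiv.map_lie]
  congr 1
  simp

theorem exists_ofDer_lie (d : P.D) (i : P.ι) : ∃ c : ℂ,
    ⁅P.ofDer d, P.e i⁆ = c • P.e i ∧ ⁅P.ofDer d, P.f i⁆ = -(c • P.f i) := by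
  obtain ⟨c, h1, h2⟩ := P.diagonal d d.2 i
  refine ⟨c, ?_, ?_⟩
  · rw [e, ofDer_lie_ofAlg, h1, map_smul, map_smul, ofAlg]
  · rw [f, ofDer_lie_ofAlg, h2, map_smul, map_smul, ofAlg, neg_smul]

theorem ofDer_lie_h (d : P.D) (i : P.ι) : ⁅P.ofDer d, P.h i⁆ = 0 := by
  obtain ⟨c, h1, h2⟩ := P.exists_ofDer_lie d i
  rw [← e_lie_f, leibniz_lie, h1, h2, lie_neg, lie_smul, smul_lie, add_neg_cancel]

theorem ofDer_lie_ofDer (d d' : P.D) : ⁅P.ofDer d, P.ofDer d'⁆ = 0 := by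
  have h : ⁅d, d'⁆ = 0 := Subtype.ext (P.commutative d d.2 d' d'.2)
  rw [ofDer, ofDer, ← LieEquiv.map_lie, ← LieHom.map_lie, h, map_zero, map_zero]

theorem cartan_generators_lie {x y : L} (hx : x ∈ Set.range P.h ∪ Set.range P.ofDer)
    (hy : y ∈ Set.range P.h ∪ Set.range P.ofDer) : ⁅x, y⁆ = 0 := by
  rcases hx with ⟨i, rfl⟩ | ⟨d, rfl⟩ <;> rcases hy with ⟨j, rfl⟩ | ⟨d', rfl⟩
  · exact P.h_lie_h i j
  · rw [← lie_skew, P.ofDer_lie_h, neg_zero]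
  · exact P.ofDer_lie_h d j
  · exact P.ofDer_lie_ofDer d d'

theorem cartan_eq_span :
    (P.cartan : Submodule ℂ L) = Submodule.span ℂ (Set.range P.h ∪ Set.range P.ofDer) :=
  LieSubalgebra.coe_lieSpan_eq_span_of_forall_lie_eq_zero fun _ hx _ hy =>
    P.cartan_generators_lie hx hy

theorem h_mem_cartan (i : P.ι) : P.h i ∈ P.cartan := LieSubalgebra.subset_lieSpan (.inl ⟨i, rfl⟩)

theorem ofDer_mem_cartan (d : P.D) : P.ofDer d ∈ P.cartan :=
  LieSubalgebra.subset_lieSpan (.inr ⟨d, rfl⟩)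

theorem e_mem_pos (i : P.ι) : P.e i ∈ P.pos := LieSubalgebra.subset_lieSpan ⟨i, rfl⟩

theorem cartan_lie_cartan {x y : L} (hx : x ∈ P.cartan) (hy : y ∈ P.cartan) : ⁅x, y⁆ = 0 := by
  rw [← LieSubalgebra.mem_toSubmodule, cartan_eq_span] at hx hy
  induction hx, hy using Submodule.span_induction₂ with
  | mem_mem x y hx hy => exact P.cartan_generators_lie hx hy
  | zero_left => simp
  | zero_right => simp
  | add_left _ _ _ _ _ _ h h' => rw [add_lie, h, h', add_zero]
  | add_right _ _ _ _ _ _ h h' => rw [lie_add, h, h', add_zero]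
  | smul_left _ _ _ _ _ h => rw [smul_lie, h, smul_zero]
  | smul_right _ _ _ _ _ h => rw [lie_smul, h, smul_zero]

theorem exists_cartan_lie {x : L} (hx : x ∈ P.cartan) (i : P.ι) : ∃ c : ℂ,
    ⁅x, P.e i⁆ = c • P.e i ∧ ⁅x, P.f i⁆ = -(c • P.f i) := by
  rw [← LieSubalgebra.mem_toSubmodule, cartan_eq_span] at hx
  induction hx using Submodule.span_induction with
  | mem x hx =>
    rcases hx with ⟨j, rfl⟩ | ⟨d, rfl⟩
    · exact ⟨P.A j i, P.h_lie_e j i, P.h_lie_f j i⟩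
    · exact P.exists_ofDer_lie d i
  | zero => exact ⟨0, by simp, by simp⟩
  | add x y _ _ hx hy =>
    obtain ⟨a, h1, h2⟩ := hx
    obtain ⟨b, h3, h4⟩ := hy
    exact ⟨a + b, by rw [add_lie, h1, h3, add_smul], by rw [add_lie, h2, h4, add_smul, neg_add]⟩
  | smul c x _ hx =>
    obtain ⟨a, h1, h2⟩ := hx
    exact ⟨c * a, by rw [smul_lie, h1, mul_smul], by rw [smul_lie, h2, mul_smul, smul_neg]⟩

/-- Eigenvalues are linear in `s` as soon as they are unique, which holds unless `eᵢ` and `fᵢ` both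
vanish; in that case any functional serves. -/
theorem exists_weight (i : P.ι) : ∃ α : Module.Dual ℂ P.cartan,
    (∀ s : P.cartan, ⁅(s : L), P.e i⁆ = α s • P.e i) ∧
    ∀ s : P.cartan, ⁅(s : L), P.f i⁆ = -(α s • P.f i) := by
  by_cases h0 : P.e i = 0 ∧ P.f i = 0
  · exact ⟨0, by simp [h0.1], by simp [h0.2]⟩
  choose c hc using fun s : P.cartan => P.exists_cartan_lie s.2 i
  -- Both vectors are needed, because at this stage one of them could be zero without the other.
  have huniq : ∀ a b : ℂ, a • P.e i = b • P.e i → a • P.f i = b • P.f i → a = b := by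
    intro a b h1 h2
    by_contra hab
    rw [← sub_eq_zero, ← sub_smul, smul_eq_zero, or_iff_right (sub_ne_zero.2 hab)] at h1 h2
    exact h0 ⟨h1, h2⟩
  refine ⟨⟨⟨c, fun s t => huniq _ _ ?_ ?_⟩, fun a s => huniq _ _ ?_ ?_⟩, fun s => (hc s).1,
    fun s => (hc s).2⟩
  · rw [← (hc (s + t)).1, add_smul, ← (hc s).1, ← (hc t).1, ← add_lie]
    rfl
  · rw [← neg_inj, ← (hc (s + t)).2, add_smul, neg_add, ← (hc s).2, ← (hc t).2, ← add_lie]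
    rfl
  · rw [← (hc (a • s)).1, smul_eq_mul, mul_smul, RingHom.id_apply, ← (hc s).1, ← smul_lie]
    rfl
  · rw [← neg_inj, ← (hc (a • s)).2, smul_eq_mul, mul_smul, RingHom.id_apply, ← smul_neg,
      ← (hc s).2, ← smul_lie]
    rfl

/-- The weight of the Chevalley generator `eᵢ`. -/
noncomputable def rt (i : P.ι) : Module.Dual ℂ P.cartan := (P.exists_weight i).choose

theorem cartan_lie_e (i : P.ι) (s : P.cartan) : ⁅(s : L), P.e i⁆ = P.rt i s • P.e i :=
  (P.exists_weight i).choose_spec.1 s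

theorem cartan_lie_f (i : P.ι) (s : P.cartan) : ⁅(s : L), P.f i⁆ = -(P.rt i s • P.f i) :=
  (P.exists_weight i).choose_spec.2 s

/-- Since `C ⊆ 𝔥(A)`, membership lifts from the quotient to `𝔤(A)`, where the scaling argument
applies. -/
theorem e_eq_zero_of_mem_cartan (i : P.ι) (h : P.e i ∈ P.cartan) : P.e i = 0 := by
  have hS : ∀ x ∈ P.cartan, ∃ y ∈ Submodule.span ℂ (Set.range (algH P.A)),
      (P.equiv x).left = LieSubmodule.Quotient.mk y := by
    intro x hx
    rw [← LieSubalgebra.mem_toSubmodule, cartan_eq_span] at hx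
    induction hx using Submodule.span_induction with
    | mem x hx =>
      rcases hx with ⟨j, rfl⟩ | ⟨d, rfl⟩
      · exact ⟨algH P.A j, Submodule.subset_span ⟨j, rfl⟩, by simp [Structure.h, ofAlg]⟩
      · exact ⟨0, zero_mem _, by simp [ofDer]⟩
    | zero => exact ⟨0, zero_mem _, by rw [map_zero]; rfl⟩
    | add x y _ _ hx hy =>
      obtain ⟨a, ha, h1⟩ := hx
      obtain ⟨b, hb, h2⟩ := hy
      exact ⟨a + b, add_mem ha hb, by
        rw [map_add, LieAlgebra.SemiDirectSum.add_eq_mk, h1, h2]; rfl⟩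
    | smul c x _ hx =>
      obtain ⟨a, ha, h1⟩ := hx
      exact ⟨c • a, Submodule.smul_mem _ c ha, by
        rw [map_smul, LieAlgebra.SemiDirectSum.smul_eq_mk, h1]; rfl⟩
  obtain ⟨y, hy, hxy⟩ := hS _ h
  rw [e, ofAlg, LieEquiv.apply_symm_apply, LieAlgebra.SemiDirectSum.inl_eq_mk] at hxy
  have hC : algE P.A i - y ∈ P.C := (LieSubmodule.Quotient.mk_eq_zero' (N := P.C)).1 (by
    change (LieSubmodule.Quotient.mk (algE P.A i) : Alg P.A ⧸ P.C) - LieSubmodule.Quotient.mk y = 0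
    exact sub_eq_zero.2 hxy)
  have h1 := P.C_le _ hC
  rw [← LieSubalgebra.mem_toSubmodule, algCartan_eq_span] at h1
  have h2 := add_mem h1 hy
  rw [sub_add_cancel] at h2
  rw [e, algE_eq_zero_of_mem_span P.A i h2, ofAlg_zero]

/-- A subspace that contains the Chevalley generators and the derivations, and is stable under
brackets with the Chevalley generators, is everything. -/
theorem eq_top_of_stable (M : Submodule ℂ L) (hD : ∀ d, P.ofDer d ∈ M) (he : ∀ i, P.e i ∈ M)
    (hf : ∀ i, P.f i ∈ M) (hE : ∀ i, ∀ x ∈ M, ⁅P.e i, x⁆ ∈ M)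
    (hF : ∀ i, ∀ x ∈ M, ⁅P.f i, x⁆ ∈ M) : M = ⊤ := by
  let φ : Free P.ι → L := fun u => P.ofAlg (LieSubmodule.Quotient.mk u)
  have φ_add : ∀ u v, φ (u + v) = φ u + φ v := fun u v =>
    P.ofAlg_add (LieSubmodule.Quotient.mk u) (LieSubmodule.Quotient.mk v)
  have φ_smul : ∀ (c : ℂ) u, φ (c • u) = c • φ u := fun c u =>
    P.ofAlg_smul c (LieSubmodule.Quotient.mk u)
  have φ_lie : ∀ u v, φ ⁅u, v⁆ = ⁅φ u, φ v⁆ := fun u v =>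
    P.ofAlg_lie (LieSubmodule.Quotient.mk u) (LieSubmodule.Quotient.mk v)
  have φ_zero : φ 0 = 0 := P.ofAlg_zero
  have φH : ∀ i, φ (FreeLieAlgebra.of ℂ (.H i)) = ⁅P.e i, P.f i⁆ := fun i => (P.e_lie_f i).symm
  -- The elements whose adjoint action preserves `M`; the `hᵢ` belong to them because `hᵢ = [eᵢ,
  -- fᵢ]`.
  let A : LieSubalgebra ℂ (Free P.ι) :=
    { carrier := {u | ∀ x ∈ M, ⁅φ u, x⁆ ∈ M}
      zero_mem' := fun x _ => by rw [φ_zero, zero_lie]; exact zero_mem M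
      add_mem' := fun {u v} hu hv x hx => by
        rw [φ_add, add_lie]; exact add_mem (hu x hx) (hv x hx)
      smul_mem' := fun c u hu x hx => by
        rw [φ_smul, smul_lie]; exact M.smul_mem c (hu x hx)
      lie_mem' := fun {u v} hu hv x hx => by
        rw [φ_lie, lie_lie]
        exact sub_mem (hu _ (hv x hx)) (hv _ (hu x hx)) }
  have hA : ∀ u, u ∈ A := FreeLieAlgebra.mem_of_forall_of_mem A fun g => by
    cases g with
    | H i =>
      intro x hx
      rw [φH, lie_lie]
      exact sub_mem (hE i _ (hF i x hx)) (hF i _ (hE i x hx))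
    | E i => exact hE i
    | F i => exact hF i
  let B : LieSubalgebra ℂ (Free P.ι) :=
    { carrier := {u | φ u ∈ M}
      zero_mem' := by
        change φ 0 ∈ M
        rw [φ_zero]; exact zero_mem M
      add_mem' := fun {u v} hu hv => by
        change φ (u + v) ∈ M
        rw [φ_add]; exact add_mem hu hv
      smul_mem' := fun c u hu => by
        change φ (c • u) ∈ M
        rw [φ_smul]; exact M.smul_mem c hu
      lie_mem' := fun {u v} _ hv => by
        change φ ⁅u, v⁆ ∈ M
        rw [φ_lie]
        exact hA u _ hv }
  have hB : ∀ u, u ∈ B := FreeLieAlgebra.mem_of_forall_of_mem B fun g => by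
    cases g with
    | H i =>
      change φ _ ∈ M
      rw [φH]
      exact hE i _ (hf i)
    | E i => exact he i
    | F i => exact hf i
  refine eq_top_iff.2 fun x _ => ?_
  obtain ⟨u, hu⟩ : ∃ u : Free P.ι, (P.equiv x).left
      = LieSubmodule.Quotient.mk (LieSubmodule.Quotient.mk u : Alg P.A) := by
    obtain ⟨a, ha⟩ := LieSubmodule.Quotient.surjective_mk' P.C (P.equiv x).left
    obtain ⟨u, rfl⟩ := LieSubmodule.Quotient.surjective_mk' _ a
    exact ⟨u, ha.symm⟩
  have hx : x = φ u + P.ofDer (P.equiv x).right := by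
    apply P.equiv.injective
    change P.equiv x = P.equiv (P.ofAlg (LieSubmodule.Quotient.mk u) + P.ofDer (P.equiv x).right)
    rw [ofAlg, ofDer, map_add, LieEquiv.apply_symm_apply, LieEquiv.apply_symm_apply, ← hu]
    simp
  rw [hx]
  exact add_mem (hB u) (hD _)

end BKM.Structure

/-! ### Triangular decomposition, and the form on `𝔥` and `𝔫` -/

namespace BKM.Structure

variable {L : Type*} [LieRing L] [LieAlgebra ℂ L] (P : Structure L)

/-- A nondegenerate contravariant hermitian form on a complex BKM algebra whose Cartan subalgebra is
its own centralizer, and in which no root is both positive and negative. -/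
structure ComplexForm where
  form : L →ₗ[ℂ] L →ₗ⋆[ℂ] ℂ
  hermitian : ∀ x y, form y x = conj (form x y)
  nondegenerate : ∀ x, (∀ y, form x y = 0) → x = 0
  ω : L →ₗ⋆[ℂ] L
  ω_lie : ∀ x y, ω ⁅x, y⁆ = ⁅ω x, ω y⁆
  ω_ω : ∀ x, ω (ω x) = x
  ε : ℂ
  ε_sq : ε * ε = 1
  conj_ε : conj ε = ε
  ω_e : ∀ i, ω (P.e i) = ε • P.f i
  contravariant : ∀ u x y, form ⁅u, x⁆ y = -form x ⁅ω u, y⁆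
  centralizer : ∀ x : L, (∀ s ∈ P.cartan, ⁅s, x⁆ = 0) → x ∈ P.cartan
  positive_negative : ∀ α, ¬ (P.IsPositiveRoot α ∧ P.IsNegativeRoot α)

/-- The adjoint action of the Cartan subalgebra. -/
noncomputable def adCartan (s : P.cartan) : Module.End ℂ L := LieAlgebra.ad ℂ L (s : L)

/-- The non-empty sums of weights of nonzero Chevalley generators. -/
def weightCone : AddSubsemigroup (Module.Dual ℂ P.cartan) :=
  AddSubsemigroup.closure {α | ∃ i, P.e i ≠ 0 ∧ P.rt i = α}

variable {P}

theorem lie_pos_mem (s : P.cartan) {x : L} (hx : x ∈ P.pos) : ⁅(s : L), x⁆ ∈ P.pos := by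
  refine LieSubalgebra.lieSpan_range_induction (k := ℂ) P.e (p := fun x => ⁅(s : L), x⁆ ∈ P.pos)
    ?_ ?_ ?_ ?_ ?_ x hx
  · simp
  · intro x y hx hy
    rw [lie_add]
    exact add_mem hx hy
  · intro c x hx
    rw [lie_smul]
    exact P.pos.smul_mem c hx
  · intro i
    rw [cartan_lie_e]
    exact P.pos.smul_mem _ (P.e_mem_pos i)
  · intro i x hx h
    rw [leibniz_lie, cartan_lie_e, smul_lie]
    exact add_mem (P.pos.smul_mem _ (P.pos.lie_mem (P.e_mem_pos i) hx))
      (P.pos.lie_mem (P.e_mem_pos i) h)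

theorem f_lie_pos (i : P.ι) {x : L} (hx : x ∈ P.pos) :
    ∃ y ∈ P.pos, ∃ c : ℂ, ⁅P.f i, x⁆ = y + c • P.h i := by
  refine LieSubalgebra.lieSpan_range_induction (k := ℂ) P.e
    (p := fun x => ∃ y ∈ P.pos, ∃ c : ℂ, ⁅P.f i, x⁆ = y + c • P.h i) ?_ ?_ ?_ ?_ ?_ x hx
  · exact ⟨0, zero_mem _, 0, by simp⟩
  · rintro x x' ⟨y, hy, c, h⟩ ⟨y', hy', c', h'⟩
    exact ⟨y + y', add_mem hy hy', c + c', by rw [lie_add, h, h', add_smul]; abel⟩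
  · rintro a x ⟨y, hy, c, h⟩
    exact ⟨a • y, P.pos.smul_mem a hy, a * c, by rw [lie_smul, h, smul_add, mul_smul]⟩
  · intro j
    by_cases hij : j = i
    · subst hij
      exact ⟨0, zero_mem _, -1, by rw [← lie_skew, e_lie_f]; simp⟩
    · exact ⟨0, zero_mem _, 0, by rw [← lie_skew, P.e_lie_f_ne j i hij]; simp⟩
  · rintro j x hx ⟨y, hy, c, h⟩
    have h1 : ⁅P.e j, ⁅P.f i, x⁆⁆ ∈ P.pos := by
      rw [h, lie_add, lie_smul, ← lie_skew (P.e j) (P.h i), h_lie_e]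
      exact add_mem (P.pos.lie_mem (P.e_mem_pos j) hy) (P.pos.smul_mem _ (neg_mem
        (P.pos.smul_mem _ (P.e_mem_pos j))))
    -- A term in `hᵢ` arises only from a single generator; on a longer bracket the coefficient is
    -- `0`.
    refine ⟨⁅P.f i, ⁅P.e j, x⁆⁆, ?_, 0, by simp⟩
    rw [leibniz_lie, ← lie_skew (P.f i) (P.e j)]
    by_cases hij : j = i
    · subst hij
      rw [e_lie_f, neg_lie]
      exact add_mem (neg_mem (lie_pos_mem ⟨_, P.h_mem_cartan j⟩ hx)) h1
    · rw [P.e_lie_f_ne j i hij, neg_zero, zero_lie, zero_add]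
      exact h1

namespace ComplexForm

variable (Ψ : P.ComplexForm)

theorem ω_f (i : P.ι) : Ψ.ω (P.f i) = Ψ.ε • P.e i := by
  have h := congrArg Ψ.ω (Ψ.ω_e i)
  rw [Ψ.ω_ω, LinearMap.map_smulₛₗ, Ψ.conj_ε] at h
  rw [h, smul_smul, Ψ.ε_sq, one_smul]

theorem ω_h (i : P.ι) : Ψ.ω (P.h i) = -P.h i := by
  rw [← e_lie_f, Ψ.ω_lie, Ψ.ω_e, Ψ.ω_f, smul_lie, lie_smul, smul_smul, Ψ.ε_sq, one_smul, ← lie_skew]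

theorem f_ne_zero (Ψ : P.ComplexForm) {i : P.ι} (h : P.e i ≠ 0) : P.f i ≠ 0 := by
  intro h0
  have h1 := Ψ.ω_e i
  rw [h0, smul_zero] at h1
  exact h (by rw [← Ψ.ω_ω (P.e i), h1, map_zero])

theorem f_eq_zero (Ψ : P.ComplexForm) {i : P.ι} (h : P.e i = 0) : P.f i = 0 := by
  have h1 := Ψ.ω_f i
  rw [h, smul_zero] at h1
  rw [← Ψ.ω_ω (P.f i), h1, map_zero]

theorem form_lie_right (u x y : L) : Ψ.form x ⁅u, y⁆ = -Ψ.form ⁅Ψ.ω u, x⁆ y := by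
  rw [Ψ.contravariant, Ψ.ω_ω, neg_neg]

theorem form_e_lie (i : P.ι) (x y : L) : Ψ.form ⁅P.e i, x⁆ y = -(Ψ.ε * Ψ.form x ⁅P.f i, y⁆) := by
  rw [Ψ.contravariant, Ψ.ω_e, smul_lie, LinearMap.map_smulₛₗ, Ψ.conj_ε, smul_eq_mul]

/-- A generator of weight zero centralizes the Cartan subalgebra, so it lies in it, and is then
zero. -/
theorem rt_ne_zero (Ψ : P.ComplexForm) {i : P.ι} (h : P.e i ≠ 0) : P.rt i ≠ 0 := by
  intro h0
  refine h (P.e_eq_zero_of_mem_cartan i (Ψ.centralizer _ fun s hs => ?_))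
  have := P.cartan_lie_e i ⟨s, hs⟩
  rwa [h0, LinearMap.zero_apply, zero_smul] at this

theorem exists_rt_ne_zero (Ψ : P.ComplexForm) {i : P.ι} (h : P.e i ≠ 0) : ∃ s, P.rt i s ≠ 0 := by
  by_contra! h0
  exact Ψ.rt_ne_zero h (LinearMap.ext h0)

theorem isSimpleRoot_rt (Ψ : P.ComplexForm) {i : P.ι} (h : P.e i ≠ 0) : P.IsSimpleRoot (P.rt i) :=
  ⟨⟨Ψ.rt_ne_zero h, P.e i, P.cartan_lie_e i, h⟩, i, P.cartan_lie_e i⟩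

/-- If a non-empty sum vanished, minus one of its summands `αᵢ` would be the sum of the others. As
`-αᵢ` is the root of `fᵢ`, the root `αᵢ` would be both positive and negative. -/
theorem weightCone_ne_zero (Ψ : P.ComplexForm) {α : Module.Dual ℂ P.cartan} (hα : α ∈ P.weightCone) : α ≠ 0 := by
  have key : ∃ i, P.e i ≠ 0 ∧ ∃ β ∈ AddSubmonoid.closure {β | P.IsSimpleRoot β},
      α = P.rt i + β := by
    induction hα using AddSubsemigroup.closure_induction with
    | mem α hα =>
      obtain ⟨i, hi, rfl⟩ := hα
      exact ⟨i, hi, 0, zero_mem _, (add_zero _).symm⟩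
    | add α β _ _ hα hβ =>
      obtain ⟨i, hi, α', hα', rfl⟩ := hα
      obtain ⟨j, hj, β', hβ', rfl⟩ := hβ
      exact ⟨i, hi, α' + (P.rt j + β'), add_mem hα' (add_mem
        (AddSubmonoid.subset_closure (Ψ.isSimpleRoot_rt hj)) hβ'), add_assoc _ _ _⟩
  obtain ⟨i, hi, β, hβ, rfl⟩ := key
  intro h0
  have hroot := (Ψ.isSimpleRoot_rt hi).1
  rw [add_eq_zero_iff_neg_eq] at h0
  refine Ψ.positive_negative (P.rt i) ⟨⟨hroot, AddSubmonoid.subset_closure (Ψ.isSimpleRoot_rt hi)⟩,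
    hroot, ⟨neg_ne_zero.2 hroot.1, P.f i, fun s => ?_, Ψ.f_ne_zero hi⟩, h0 ▸ hβ⟩
  rw [cartan_lie_f, LinearMap.neg_apply, neg_smul]

theorem weightCone_ne_neg (Ψ : P.ComplexForm) {α β : Module.Dual ℂ P.cartan} (hα : α ∈ P.weightCone)
    (hβ : β ∈ P.weightCone) : α ≠ -β := fun h =>
  Ψ.weightCone_ne_zero (add_mem hα hβ) (by rw [h, neg_add_cancel])

theorem rt_mem_weightCone {i : P.ι} (h : P.e i ≠ 0) : P.rt i ∈ P.weightCone :=
  AddSubsemigroup.subset_closure ⟨i, h, rfl⟩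

/-- The weight of `ω v` is carried along in the induction: it cannot be deduced from that of `v`
before `ω` is known to preserve the Cartan subalgebra. -/
theorem pos_le_span {x : L} (hx : x ∈ P.pos) : x ∈ Submodule.span ℂ {v | v ∈ P.pos ∧
    ∃ α ∈ P.weightCone, v ∈ P.rootSpace α ∧ Ψ.ω v ∈ P.rootSpace (-α)} := by
  refine LieSubalgebra.lieSpan_range_induction (k := ℂ) P.e
    (p := fun x => x ∈ Submodule.span ℂ {v | v ∈ P.pos ∧
      ∃ α ∈ P.weightCone, v ∈ P.rootSpace α ∧ Ψ.ω v ∈ P.rootSpace (-α)})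
    (zero_mem _) (fun _ _ => add_mem) (fun c _ => Submodule.smul_mem _ c) ?_ ?_ x hx
  · intro i
    by_cases hi : P.e i = 0
    · rw [hi]; exact zero_mem _
    · refine Submodule.subset_span ⟨P.e_mem_pos i, P.rt i, rt_mem_weightCone hi,
        P.cartan_lie_e i, fun s => ?_⟩
      rw [Ψ.ω_e, lie_smul, cartan_lie_f, LinearMap.neg_apply, neg_smul, smul_neg, smul_comm]
  · intro i x _ hx
    by_cases hi : P.e i = 0
    · rw [hi, zero_lie]; exact zero_mem _
    · clear * - hx hi
      induction hx using Submodule.span_induction with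
      | mem x hx =>
        obtain ⟨hx, α, hα, h1, h2⟩ := hx
        refine Submodule.subset_span ⟨P.pos.lie_mem (P.e_mem_pos i) hx, P.rt i + α,
          add_mem (rt_mem_weightCone hi) hα, fun s => ?_, fun s => ?_⟩
        · rw [leibniz_lie, cartan_lie_e, h1 s, smul_lie, lie_smul, ← add_smul, LinearMap.add_apply]
        · rw [Ψ.ω_lie, Ψ.ω_e, leibniz_lie, h2 s]
          simp only [lie_smul, smul_lie, cartan_lie_f, neg_lie, LinearMap.neg_apply,
            LinearMap.add_apply]
          module
      | zero => rw [lie_zero]; exact zero_mem _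
      | add x y _ _ hx hy => rw [lie_add]; exact add_mem hx hy
      | smul c x _ hx => rw [lie_smul]; exact Submodule.smul_mem _ c hx

theorem pos_induction {p : L → Prop} (zero : p 0) (add : ∀ x y, p x → p y → p (x + y))
    (smul : ∀ (c : ℂ) x, p x → p (c • x))
    (weight : ∀ v ∈ P.pos, ∀ α ∈ P.weightCone, v ∈ P.rootSpace α → Ψ.ω v ∈ P.rootSpace (-α) → p v)
    {x : L} (hx : x ∈ P.pos) : p x :=
  Submodule.span_induction (p := fun x _ => p x)
    (fun v hv => by
      obtain ⟨hv, α, hα, h1, h2⟩ := hv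
      exact weight v hv α hα h1 h2) zero (fun x y _ _ => add x y)
    (fun c x _ => smul c x) (Ψ.pos_le_span hx)

theorem lie_ω_pos (s : P.cartan) {x : L} (hx : x ∈ P.pos) :
    ∃ y ∈ P.pos, ⁅(s : L), Ψ.ω x⁆ = Ψ.ω y := by
  refine Ψ.pos_induction (p := fun x => ∃ y ∈ P.pos, ⁅(s : L), Ψ.ω x⁆ = Ψ.ω y) ?_ ?_ ?_ ?_ hx
  · exact ⟨0, zero_mem _, by simp⟩
  · rintro x y ⟨x', hx', h⟩ ⟨y', hy', h'⟩
    exact ⟨x' + y', add_mem hx' hy', by rw [map_add, lie_add, h, h', map_add]⟩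
  · rintro c x ⟨x', hx', h⟩
    exact ⟨c • x', P.pos.smul_mem c hx', by
      rw [LinearMap.map_smulₛₗ, lie_smul, h, LinearMap.map_smulₛₗ]⟩
  · intro v hv α _ _ h
    exact ⟨conj (-α s) • v, P.pos.smul_mem _ hv, by
      rw [h s, LinearMap.map_smulₛₗ, Complex.conj_conj, LinearMap.neg_apply]⟩

/-- The triangular decomposition. -/
theorem exists_triangular (x : L) :
    ∃ s ∈ P.cartan, ∃ a ∈ P.pos, ∃ b ∈ P.pos, x = s + a + Ψ.ω b := by
  let M : Submodule ℂ L :=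
    { carrier := {x | ∃ s ∈ P.cartan, ∃ a ∈ P.pos, ∃ b ∈ P.pos, x = s + a + Ψ.ω b}
      zero_mem' := ⟨0, zero_mem _, 0, zero_mem _, 0, zero_mem _, by simp⟩
      add_mem' := by
        rintro _ _ ⟨s, hs, a, ha, b, hb, rfl⟩ ⟨s', hs', a', ha', b', hb', rfl⟩
        exact ⟨s + s', add_mem hs hs', a + a', add_mem ha ha', b + b', add_mem hb hb', by
          rw [map_add]; abel⟩
      smul_mem' := by
        rintro c _ ⟨s, hs, a, ha, b, hb, rfl⟩
        exact ⟨c • s, P.cartan.smul_mem c hs, c • a, P.pos.smul_mem c ha, conj c • b,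
          P.pos.smul_mem _ hb, by
            rw [LinearMap.map_smulₛₗ, Complex.conj_conj, smul_add, smul_add]⟩ }
  have hH : ∀ s ∈ P.cartan, s ∈ M := fun s hs =>
    ⟨s, hs, 0, zero_mem _, 0, zero_mem _, by simp⟩
  have hN : ∀ a ∈ P.pos, a ∈ M := fun a ha => ⟨0, zero_mem _, a, ha, 0, zero_mem _, by simp⟩
  have hN' : ∀ a ∈ P.pos, Ψ.ω a ∈ M := fun a ha => ⟨0, zero_mem _, 0, zero_mem _, a, ha, by simp⟩
  have hω : ∀ i, ∀ y ∈ P.pos, ∀ c : ℂ, Ψ.ω (y + c • P.h i) ∈ M := fun i y hy c => by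
    rw [map_add, LinearMap.map_smulₛₗ, Ψ.ω_h]
    exact add_mem (hN' y hy) (M.smul_mem _ (M.neg_mem (hH _ (P.h_mem_cartan i))))
  -- Writing the generators as values of `ω` transports brackets with `ω 𝔫` to brackets with `𝔫`.
  have hωf : ∀ i, P.f i = Ψ.ω (Ψ.ε • P.e i) := fun i => by
    rw [LinearMap.map_smulₛₗ, Ψ.ω_e, Ψ.conj_ε, smul_smul, Ψ.ε_sq, one_smul]
  have hωe : ∀ i, P.e i = Ψ.ω (Ψ.ε • P.f i) := fun i => by
    rw [LinearMap.map_smulₛₗ, Ψ.ω_f, Ψ.conj_ε, smul_smul, Ψ.ε_sq, one_smul]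
  have hM : M = ⊤ := by
    refine P.eq_top_of_stable M (fun d => hH _ (P.ofDer_mem_cartan d)) (fun i => hN _ (P.e_mem_pos i))
      (fun i => ?_) ?_ ?_
    · rw [hωf]
      exact hN' _ (P.pos.smul_mem _ (P.e_mem_pos i))
    · rintro i _ ⟨s, hs, a, ha, b, hb, rfl⟩
      rw [lie_add, lie_add]
      refine add_mem (add_mem ?_ (hN _ (P.pos.lie_mem (P.e_mem_pos i) ha))) ?_
      · rw [← lie_skew, P.cartan_lie_e i ⟨s, hs⟩]
        exact M.neg_mem (M.smul_mem _ (hN _ (P.e_mem_pos i)))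
      · obtain ⟨y, hy, c, h⟩ := f_lie_pos i hb
        rw [hωe, ← Ψ.ω_lie, smul_lie, LinearMap.map_smulₛₗ, h]
        exact M.smul_mem _ (hω i y hy c)
    · rintro i _ ⟨s, hs, a, ha, b, hb, rfl⟩
      rw [lie_add, lie_add]
      refine add_mem (add_mem ?_ ?_) ?_
      · rw [← lie_skew, P.cartan_lie_f i ⟨s, hs⟩, hωf]
        exact M.neg_mem (M.neg_mem (M.smul_mem _ (hN' _ (P.pos.smul_mem _ (P.e_mem_pos i)))))
      · obtain ⟨y, hy, c, h⟩ := f_lie_pos i ha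
        rw [h]
        exact add_mem (hN y hy) (M.smul_mem _ (hH _ (P.h_mem_cartan i)))
      · rw [hωf, ← Ψ.ω_lie]
        exact hN' _ (P.pos.lie_mem (P.pos.smul_mem _ (P.e_mem_pos i)) hb)
  exact (hM ▸ Submodule.mem_top : x ∈ M)

theorem mem_span_rootSpace (Ψ : P.ComplexForm) (x : L) :
    x ∈ Submodule.span ℂ {v | ∃ α ∈ (Set.univ : Set (Module.Dual ℂ P.cartan)),
      v ∈ P.rootSpace α} := by
  set W := Submodule.span ℂ {v | ∃ α ∈ (Set.univ : Set (Module.Dual ℂ P.cartan)),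
      v ∈ P.rootSpace α}
  have hW : ∀ α : Module.Dual ℂ P.cartan, ∀ v ∈ P.rootSpace α, v ∈ W := fun α v hv =>
    Submodule.subset_span ⟨α, trivial, hv⟩
  obtain ⟨s, hs, a, ha, b, hb, rfl⟩ := Ψ.exists_triangular x
  refine add_mem (add_mem ?_ ?_) ?_
  · refine hW 0 s fun t => ?_
    rw [P.cartan_lie_cartan t.2 hs, LinearMap.zero_apply, zero_smul]
  · exact Ψ.pos_induction (p := (· ∈ W)) (zero_mem _) (fun _ _ => add_mem)
      (fun c _ => Submodule.smul_mem _ c) (fun v _ α _ h _ => hW α v h) ha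
  · refine Ψ.pos_induction (p := (Ψ.ω · ∈ W)) ?_ ?_ ?_ (fun v _ α _ _ h => hW (-α) _ h) hb
    · rw [map_zero]; exact zero_mem _
    · intro x y hx hy
      rw [map_add]; exact add_mem hx hy
    · intro c x hx
      rw [LinearMap.map_smulₛₗ]; exact Submodule.smul_mem _ _ hx

/-- With `ω_cartan_lie_f`: `ω s` acts on `eᵢ` and `fᵢ` by opposite scalars, as a Cartan element
would. This is the input for `ω_mem_cartan`. -/
theorem ω_cartan_lie_e {s : L} (hs : s ∈ P.cartan) (i : P.ι) :
    ⁅P.e i, Ψ.ω s⁆ = conj (P.rt i ⟨s, hs⟩) • P.e i := by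
  have h := congrArg Ψ.ω (P.cartan_lie_f i ⟨s, hs⟩)
  rw [Ψ.ω_lie, Ψ.ω_f, map_neg, LinearMap.map_smulₛₗ, Ψ.ω_f, lie_smul, smul_comm, ← smul_neg] at h
  have h1 := congrArg (Ψ.ε • ·) h
  simp only [smul_smul, Ψ.ε_sq, one_smul] at h1
  rw [← lie_skew, h1, neg_neg]

theorem ω_cartan_lie_f {s : L} (hs : s ∈ P.cartan) (i : P.ι) :
    ⁅P.f i, Ψ.ω s⁆ = -(conj (P.rt i ⟨s, hs⟩) • P.f i) := by
  have h := congrArg Ψ.ω (P.cartan_lie_e i ⟨s, hs⟩)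
  rw [Ψ.ω_lie, Ψ.ω_e, LinearMap.map_smulₛₗ, Ψ.ω_e, lie_smul, smul_comm] at h
  have h1 := congrArg (Ψ.ε • ·) h
  simp only [smul_smul, ← mul_assoc, Ψ.ε_sq, one_mul, one_smul] at h1
  rw [← lie_skew, h1]

/-- A weight vector, of nonzero weight, that commutes with the Chevalley generators is zero. -/
theorem eq_zero_of_central (Ψ : P.ComplexForm) {z : L} (he : ∀ i, ⁅P.e i, z⁆ = 0) (hf : ∀ i, ⁅P.f i, z⁆ = 0)
    {β : Module.Dual ℂ P.cartan} (hβ : z ∈ P.rootSpace β) (h0 : β ≠ 0) : z = 0 := by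
  -- By contravariance `z` is orthogonal to the images of `ad eᵢ` and `ad fᵢ`.
  have hE : ∀ i v, Ψ.form z ⁅P.e i, v⁆ = 0 := fun i v => by
    rw [Ψ.form_lie_right, Ψ.ω_e, smul_lie, hf, smul_zero, map_zero, LinearMap.zero_apply, neg_zero]
  have hF : ∀ i v, Ψ.form z ⁅P.f i, v⁆ = 0 := fun i v => by
    rw [Ψ.form_lie_right, Ψ.ω_f, smul_lie, he, smul_zero, map_zero, LinearMap.zero_apply, neg_zero]
  -- A nonzero `eᵢ` is, up to a scalar, its own bracket with some `s` of the Cartan subalgebra;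
  -- likewise `fᵢ`.
  have hgen : ∀ i, Ψ.form z (P.e i) = 0 ∧ Ψ.form z (P.f i) = 0 := by
    intro i
    by_cases hi : P.e i = 0
    · rw [hi, Ψ.f_eq_zero hi, map_zero]
      exact ⟨rfl, rfl⟩
    obtain ⟨s, hs⟩ := Ψ.exists_rt_ne_zero hi
    have hs' : conj (P.rt i s) ≠ 0 := (map_ne_zero _).2 hs
    constructor
    · have h := hE i s
      rw [← lie_skew, cartan_lie_e, map_neg, LinearMap.map_smulₛₗ, neg_eq_zero] at h
      exact (smul_eq_zero.1 h).resolve_left hs'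
    · have h := hF i s
      rw [← lie_skew, cartan_lie_f, neg_neg, LinearMap.map_smulₛₗ] at h
      exact (smul_eq_zero.1 h).resolve_left hs'
  have hN : ∀ a ∈ P.pos, Ψ.form z a = 0 :=
    LieSubalgebra.lieSpan_range_induction (k := ℂ) P.e (by simp)
      (fun x y hx hy => by rw [map_add, hx, hy, add_zero])
      (fun c x hx => by rw [LinearMap.map_smulₛₗ, hx, smul_zero]) (fun i => (hgen i).1)
      (fun i x _ _ => hE i x)
  have hN' : ∀ a ∈ P.pos, Ψ.form z (Ψ.ω a) = 0 :=
    LieSubalgebra.lieSpan_range_induction (k := ℂ) P.e (by simp)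
      (fun x y hx hy => by rw [map_add, map_add, hx, hy, add_zero])
      (fun c x hx => by rw [LinearMap.map_smulₛₗ, LinearMap.map_smulₛₗ, hx, smul_zero])
      (fun i => by rw [Ψ.ω_e, LinearMap.map_smulₛₗ, (hgen i).2, smul_zero])
      (fun i x _ _ => by rw [Ψ.ω_lie, Ψ.ω_e, smul_lie, LinearMap.map_smulₛₗ, hF, smul_zero])
  -- Here `β s ⟨z, t⟩ = -⟨z, [ω s, t]⟩`, and `[ω s, t]` has no Cartan component, so it lies in `𝔫 +
  -- ω 𝔫`, to which `z` is orthogonal.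
  have hH : ∀ t ∈ P.cartan, Ψ.form z t = 0 := by
    intro t ht
    obtain ⟨s, hs⟩ : ∃ s, β s ≠ 0 := by
      by_contra! h
      exact h0 (LinearMap.ext h)
    have h := Ψ.contravariant s z t
    obtain ⟨s', hs', a, ha, b, hb, hab⟩ := Ψ.exists_triangular (Ψ.ω s)
    obtain ⟨b', hb', hbb⟩ := Ψ.lie_ω_pos ⟨t, ht⟩ hb
    have ha' := lie_pos_mem ⟨t, ht⟩ ha
    rw [hβ s, hab, add_lie, add_lie, P.cartan_lie_cartan hs' ht, ← lie_skew a, ← lie_skew (Ψ.ω b),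
      hbb, zero_add, map_add, map_neg, map_neg, hN _ ha', hN' _ hb', map_smul,
      LinearMap.smul_apply] at h
    simpa [hs] using h
  refine Ψ.nondegenerate z fun y => ?_
  obtain ⟨s, hs, a, ha, b, hb, rfl⟩ := Ψ.exists_triangular y
  rw [map_add, map_add, hH s hs, hN a ha, hN' b hb, add_zero, add_zero]

/-- As `ω s` and `t` both act on the generators by scalars, `[t, ω s]` commutes with them. So do its
weight components; those of nonzero weight vanish by `eq_zero_of_central`, and the one of weight
zero is killed by `t`. Thus `ω s` centralizes the Cartan subalgebra. -/
theorem ω_mem_cartan {s : L} (hs : s ∈ P.cartan) : Ψ.ω s ∈ P.cartan := by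
  refine Ψ.centralizer _ fun t ht => ?_
  obtain ⟨F, x, -, hx, hsum⟩ := Submodule.exists_sum_of_mem_span _ _ (Ψ.mem_span_rootSpace (Ψ.ω s))
  let Z : Submodule ℂ L :=
    { carrier := {z | ∀ i, ⁅P.e i, z⁆ = 0 ∧ ⁅P.f i, z⁆ = 0}
      zero_mem' := fun i => by simp
      add_mem' := fun {z w} hz hw i => by
        rw [lie_add, lie_add, (hz i).1, (hz i).2, (hw i).1, (hw i).2]; simp
      smul_mem' := fun c z hz i => by
        rw [lie_smul, lie_smul, (hz i).1, (hz i).2]; simp }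
  have hZ : ∀ (r : P.cartan), ∀ z ∈ Z, P.adCartan r z ∈ Z := by
    intro r z hz i
    have h1 := hz i
    change ⁅P.e i, ⁅(r : L), z⁆⁆ = 0 ∧ ⁅P.f i, ⁅(r : L), z⁆⁆ = 0
    rw [leibniz_lie, leibniz_lie (P.f i), h1.1, h1.2, ← lie_skew (P.e i) (r : L),
      ← lie_skew (P.f i) (r : L), cartan_lie_e,
      cartan_lie_f, neg_neg, neg_lie, smul_lie, smul_lie, h1.1, h1.2]
    simp
  have hmem : ∑ α ∈ F, α ⟨t, ht⟩ • x α ∈ Z := by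
    have h1 : ∑ α ∈ F, α ⟨t, ht⟩ • x α = ⁅t, Ψ.ω s⁆ := by
      rw [hsum, lie_sum]
      exact Finset.sum_congr rfl fun α _ => (hx α ⟨t, ht⟩).symm
    rw [h1]
    intro i
    have h2 := P.cartan_lie_e i ⟨t, ht⟩
    have h3 := P.cartan_lie_f i ⟨t, ht⟩
    dsimp only at h2 h3
    rw [leibniz_lie, leibniz_lie (P.f i), Ψ.ω_cartan_lie_e hs, Ψ.ω_cartan_lie_f hs,
      ← lie_skew (P.e i) t, ← lie_skew (P.f i) t, h2, h3, neg_neg, neg_lie, smul_lie, smul_lie, lie_neg,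
      lie_smul, lie_smul, h2, h3, Ψ.ω_cartan_lie_e hs, Ψ.ω_cartan_lie_f hs]
    constructor
    · rw [smul_comm, neg_add_cancel]
    · rw [smul_neg, smul_neg, neg_neg, smul_comm, neg_add_cancel]
  have hcomp := IsWeightVector.mem_of_sum_mem (T := P.adCartan) hZ F _ (fun α _ r => by
    have h1 : ⁅(r : L), x α⁆ = α r • x α := hx α r
    rw [map_smul, smul_comm, ← h1]
    rfl) hmem
  rw [hsum, lie_sum]
  refine Finset.sum_eq_zero fun α hα => ?_
  have h1 : ⁅t, x α⁆ = α ⟨t, ht⟩ • x α := hx α ⟨t, ht⟩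
  rw [h1]
  by_cases h0 : α = 0
  · rw [h0, LinearMap.zero_apply, zero_smul]
  · exact Ψ.eq_zero_of_central (fun i => (hcomp α hα i).1) (fun i => (hcomp α hα i).2)
      ((P.rootSpace α).smul_mem _ (hx α)) h0

/-- The involution of the Cartan subalgebra. -/
def ωCartan (s : P.cartan) : P.cartan := ⟨Ψ.ω s, Ψ.ω_mem_cartan s.2⟩

theorem rt_ωCartan {i : P.ι} (hi : P.e i ≠ 0) (s : P.cartan) :
    P.rt i (Ψ.ωCartan s) = -conj (P.rt i s) := by
  have h := P.cartan_lie_e i (Ψ.ωCartan s)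
  have h1 := Ψ.ω_cartan_lie_e s.2 i
  rw [← lie_skew] at h1
  change ⁅Ψ.ω s, P.e i⁆ = _ at h
  rw [h, ← neg_smul] at h1
  have h2 := smul_left_injective ℂ hi h1
  exact neg_eq_iff_eq_neg.1 h2

theorem weightCone_ωCartan {α : Module.Dual ℂ P.cartan} (hα : α ∈ P.weightCone) (s : P.cartan) :
    α (Ψ.ωCartan s) = -conj (α s) := by
  induction hα using AddSubsemigroup.closure_induction with
  | mem α hα =>
    obtain ⟨i, hi, rfl⟩ := hα
    exact Ψ.rt_ωCartan hi s
  | add α β _ _ hα hβ =>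
    rw [LinearMap.add_apply, hα, hβ, LinearMap.add_apply, map_add, neg_add]

/-- Contravariance compares the eigenvalues `α s` and `β s`. The condition on `y` is stated through
`ω s`, which also covers `y` in the Cartan subalgebra with `β = 0`. -/
theorem form_eq_zero_of_ne {α β : Module.Dual ℂ P.cartan} {x y : L} (hx : x ∈ P.rootSpace α)
    (hy : ∀ s : P.cartan, ⁅Ψ.ω s, y⁆ = -conj (β s) • y) (h : α ≠ β) : Ψ.form x y = 0 := by
  by_contra h0
  refine h (LinearMap.ext fun s => ?_)
  have h1 := Ψ.contravariant s x y
  rw [hx s, hy s, map_smul, LinearMap.smul_apply, LinearMap.map_smulₛₗ, map_neg, Complex.conj_conj,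
    neg_smul, neg_neg] at h1
  exact smul_left_injective ℂ h0 h1

theorem ω_lie_of_mem_rootSpace {β : Module.Dual ℂ P.cartan} (hβ : β ∈ P.weightCone) {y : L}
    (hy : y ∈ P.rootSpace β) (s : P.cartan) : ⁅Ψ.ω s, y⁆ = -conj (β s) • y := by
  rw [← Ψ.weightCone_ωCartan hβ]
  exact hy (Ψ.ωCartan s)

theorem form_cartan_pos {s a : L} (hs : s ∈ P.cartan) (ha : a ∈ P.pos) : Ψ.form s a = 0 := by
  refine Ψ.pos_induction (p := fun a => Ψ.form s a = 0) (by simp)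
    (fun x y hx hy => by rw [map_add, hx, hy, add_zero])
    (fun c x hx => by rw [LinearMap.map_smulₛₗ, hx, smul_zero]) (fun v _ α hα h _ => ?_) ha
  refine Ψ.form_eq_zero_of_ne (α := 0) (fun t => ?_) (Ψ.ω_lie_of_mem_rootSpace hα h)
    (Ψ.weightCone_ne_zero hα).symm
  rw [P.cartan_lie_cartan t.2 hs, LinearMap.zero_apply, zero_smul]

theorem form_ω_pos_cartan {s a : L} (hs : s ∈ P.cartan) (ha : a ∈ P.pos) :
    Ψ.form (Ψ.ω a) s = 0 := by
  refine Ψ.pos_induction (p := fun a => Ψ.form (Ψ.ω a) s = 0) (by simp)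
    (fun x y hx hy => by rw [map_add, map_add, LinearMap.add_apply, hx, hy, add_zero])
    (fun c x hx => by rw [LinearMap.map_smulₛₗ, map_smul, LinearMap.smul_apply, hx, smul_zero])
    (fun v _ α hα _ h => ?_) ha
  refine Ψ.form_eq_zero_of_ne (β := 0) h (fun t => ?_) (neg_ne_zero.2 (Ψ.weightCone_ne_zero hα))
  rw [P.cartan_lie_cartan (Ψ.ω_mem_cartan t.2) hs]
  simp

theorem form_ω_pos_pos {a b : L} (ha : a ∈ P.pos) (hb : b ∈ P.pos) : Ψ.form (Ψ.ω a) b = 0 := by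
  refine Ψ.pos_induction (p := fun a => Ψ.form (Ψ.ω a) b = 0) (by simp)
    (fun x y hx hy => by rw [map_add, map_add, LinearMap.add_apply, hx, hy, add_zero])
    (fun c x hx => by rw [LinearMap.map_smulₛₗ, map_smul, LinearMap.smul_apply, hx, smul_zero])
    (fun v _ α hα _ hv => ?_) ha
  refine Ψ.pos_induction (p := fun b => Ψ.form (Ψ.ω v) b = 0) (by simp)
    (fun x y hx hy => by rw [map_add, hx, hy, add_zero])
    (fun c x hx => by rw [LinearMap.map_smulₛₗ, hx, smul_zero])
    (fun w _ β hβ hw _ => ?_) hb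
  exact Ψ.form_eq_zero_of_ne hv (Ψ.ω_lie_of_mem_rootSpace hβ hw)
    (Ψ.weightCone_ne_neg hβ hα).symm

theorem form_symm_zero {x y : L} (h : Ψ.form x y = 0) : Ψ.form y x = 0 := by
  rw [Ψ.hermitian, h, map_zero]

/-- The other two parts of the triangular decomposition are orthogonal to `𝔫`. -/
theorem nondegenerate_pos {a : L} (ha : a ∈ P.pos) (h : ∀ b ∈ P.pos, Ψ.form a b = 0) : a = 0 := by
  refine Ψ.nondegenerate a fun y => ?_
  obtain ⟨s, hs, b, hb, c, hc, rfl⟩ := Ψ.exists_triangular y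
  rw [map_add, map_add, h b hb, Ψ.form_symm_zero (Ψ.form_cartan_pos hs ha),
    Ψ.form_symm_zero (Ψ.form_ω_pos_pos hc ha), add_zero, add_zero]

theorem nondegenerate_cartan {s : L} (hs : s ∈ P.cartan) (h : ∀ t ∈ P.cartan, Ψ.form t s = 0) :
    s = 0 := by
  refine Ψ.nondegenerate s fun y => ?_
  obtain ⟨t, ht, b, hb, c, hc, rfl⟩ := Ψ.exists_triangular y
  rw [map_add, map_add, Ψ.form_cartan_pos hs hb, Ψ.form_symm_zero (h t ht),
    Ψ.form_symm_zero (Ψ.form_ω_pos_cartan hs hc), add_zero, add_zero]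

/-- Moving `eⱼ` to the other side produces a multiple of `[fⱼ, eᵢ]`, which lies in the Cartan
subalgebra and so is orthogonal to `𝔫`. -/
theorem form_e_lie_pos (i j : P.ι) {x : L} (hx : x ∈ P.pos) :
    Ψ.form (P.e i) ⁅P.e j, x⁆ = 0 := by
  rw [Ψ.form_lie_right, Ψ.ω_e, smul_lie, ← lie_skew]
  by_cases hij : i = j
  · subst hij
    rw [e_lie_f, smul_neg, map_neg, map_smul, LinearMap.neg_apply, LinearMap.smul_apply,
      Ψ.form_cartan_pos (P.h_mem_cartan i) hx]
    simp
  · rw [P.e_lie_f_ne i j hij]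
    simp

/-- Distinct generators may have equal weights, so weights do not suffice. Instead `αᵢ s ⟨eᵢ, eⱼ⟩`
is a multiple of `⟨s, [fᵢ, eⱼ]⟩ = 0`. -/
theorem form_e_e_ne {i j : P.ι} (hij : i ≠ j) : Ψ.form (P.e i) (P.e j) = 0 := by
  by_cases hi : P.e i = 0
  · rw [hi, map_zero, LinearMap.zero_apply]
  obtain ⟨s, hs⟩ := Ψ.exists_rt_ne_zero hi
  have h : Ψ.form ⁅(s : L), P.e i⁆ (P.e j) = 0 := by
    rw [← lie_skew, map_neg, LinearMap.neg_apply, form_e_lie, ← lie_skew,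
      P.e_lie_f_ne j i hij.symm]
    simp
  rw [cartan_lie_e, map_smul, LinearMap.smul_apply] at h
  exact (smul_eq_zero.1 h).resolve_left hs

/-- Two evaluations of `⟨[s, eᵢ], eᵢ⟩`. -/
theorem form_h (i : P.ι) (s : P.cartan) :
    Ψ.form s (P.h i) = -(Ψ.ε * (P.rt i s * Ψ.form (P.e i) (P.e i))) := by
  have h : Ψ.form ⁅(s : L), P.e i⁆ (P.e i) = -(Ψ.ε * Ψ.form s (P.h i)) := by
    rw [← lie_skew, map_neg, LinearMap.neg_apply, form_e_lie, ← lie_skew, P.e_lie_f]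
    simp
  rw [cartan_lie_e, map_smul, LinearMap.smul_apply, smul_eq_mul] at h
  rw [h]
  linear_combination (-Ψ.form s (P.h i)) * Ψ.ε_sq

/-- The other generators and all longer brackets are orthogonal to `eᵢ`, so an isotropic `eᵢ` would
be in the radical of `𝔫`. -/
theorem form_e_e_ne_zero {i : P.ι} (hi : P.e i ≠ 0) : Ψ.form (P.e i) (P.e i) ≠ 0 := by
  intro h0
  refine hi (Ψ.nondegenerate_pos (P.e_mem_pos i) ?_)
  refine LieSubalgebra.lieSpan_range_induction (k := ℂ) P.e (by simp)
      (fun x y hx hy => by rw [map_add, hx, hy, add_zero])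
      (fun c x hx => by rw [LinearMap.map_smulₛₗ, hx, smul_zero]) (fun j => ?_)
      (fun j x hx _ => Ψ.form_e_lie_pos i j hx)
  by_cases hij : i = j
  · rw [← hij, h0]
  · exact Ψ.form_e_e_ne hij

theorem conj_form_self (x : L) : conj (Ψ.form x x) = Ψ.form x x := (Ψ.hermitian x x).symm

/-- The factor `κ` for which `κ hᵢ` represents the weight of `eᵢ`. -/
noncomputable def κ (i : P.ι) : ℂ := Ψ.ε * (Ψ.form (P.e i) (P.e i))⁻¹

theorem conj_κ (i : P.ι) : conj (Ψ.κ i) = Ψ.κ i := by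
  rw [κ, map_mul, map_inv₀, Ψ.conj_ε, Ψ.conj_form_self]

/-- The vector of the Cartan subalgebra that represents the weight of `eᵢ`. -/
noncomputable def coroot (i : P.ι) : P.cartan := Ψ.κ i • ⟨P.h i, P.h_mem_cartan i⟩

theorem form_ω_coroot {i : P.ι} (hi : P.e i ≠ 0) (s : P.cartan) :
    Ψ.form s (Ψ.ω (Ψ.coroot i)) = P.rt i s := by
  change Ψ.form s (Ψ.ω (Ψ.κ i • P.h i)) = _
  rw [LinearMap.map_smulₛₗ, Ψ.ω_h, smul_neg, map_neg, LinearMap.map_smulₛₗ, Complex.conj_conj,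
    Ψ.form_h, κ, smul_eq_mul]
  have := Ψ.form_e_e_ne_zero hi
  field_simp
  linear_combination (P.rt i s) * Ψ.ε_sq

theorem rt_coroot_comm {i j : P.ι} (hi : P.e i ≠ 0) (hj : P.e j ≠ 0) :
    P.rt i (Ψ.coroot j) = P.rt j (Ψ.coroot i) := by
  have hr : ∀ i j : P.ι, P.e i ≠ 0 → P.rt i ⟨P.h j, P.h_mem_cartan j⟩ = P.A j i := by
    intro i j hi
    have h := P.cartan_lie_e i ⟨P.h j, P.h_mem_cartan j⟩
    dsimp only at h
    rw [h_lie_e] at h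
    exact (smul_left_injective ℂ hi h).symm
  have h1 := Ψ.form_h i ⟨P.h j, P.h_mem_cartan j⟩
  have h2 := Ψ.form_h j ⟨P.h i, P.h_mem_cartan i⟩
  have h3 := Ψ.hermitian (P.h i) (P.h j)
  dsimp only at h1 h2
  rw [h1, h2, hr i j hi, hr j i hj, map_neg, map_mul, map_mul, Ψ.conj_ε, Ψ.conj_form_self,
    Complex.conj_ofReal] at h3
  -- The form symmetrizes the Cartan matrix: `⟨hᵢ, hⱼ⟩` is hermitian and all the numbers involved
  -- are real.
  have h4 : (P.A j i : ℂ) * Ψ.form (P.e i) (P.e i) = (P.A i j : ℂ) * Ψ.form (P.e j) (P.e j) := by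
    linear_combination (-Ψ.ε) * h3 - ((P.A j i : ℂ) * Ψ.form (P.e i) (P.e i)
      - (P.A i j : ℂ) * Ψ.form (P.e j) (P.e j)) * Ψ.ε_sq
  rw [coroot, coroot, map_smul, map_smul, hr i j hi, hr j i hj, κ, κ, smul_eq_mul, smul_eq_mul]
  have := Ψ.form_e_e_ne_zero hi
  have := Ψ.form_e_e_ne_zero hj
  field_simp
  linear_combination Ψ.ε * h4

/-- The operator on the positive subalgebra that is adjoint to `ad eᵢ` maps it to itself. -/
theorem adjoint_mem (i : P.ι) (hi : P.e i ≠ 0) {y : L} (hy : y ∈ P.pos) :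
    -(Ψ.ε • ⁅P.f i, y⁆) - (Ψ.κ i * Ψ.form y (P.e i)) • P.h i ∈ P.pos := by
  refine LieSubalgebra.lieSpan_range_induction (k := ℂ) P.e
    (p := fun y => -(Ψ.ε • ⁅P.f i, y⁆) - (Ψ.κ i * Ψ.form y (P.e i)) • P.h i ∈ P.pos)
    ?_ ?_ ?_ ?_ ?_ y hy
  · simp
  · intro x y hx hy
    convert add_mem hx hy using 1
    rw [lie_add, map_add, LinearMap.add_apply, mul_add, add_smul, smul_add]
    abel
  · intro c x hx
    convert P.pos.smul_mem c hx using 1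
    rw [lie_smul, map_smul, LinearMap.smul_apply, smul_eq_mul]
    module
  · intro j
    by_cases hij : j = i
    · subst hij
      -- On `eᵢ` itself, `-ε [fᵢ, eᵢ] = ε hᵢ`, which the correction cancels because `κ ⟨eᵢ, eᵢ⟩ =
      -- ε`.
      rw [← lie_skew, e_lie_f, κ, inv_mul_cancel_right₀ (Ψ.form_e_e_ne_zero hi)]
      simp
    · rw [← lie_skew, P.e_lie_f_ne j i hij, Ψ.form_e_e_ne hij]
      simp
  · intro j x hx _
    have h0 : Ψ.form ⁅P.e j, x⁆ (P.e i) = 0 := Ψ.form_symm_zero (Ψ.form_e_lie_pos i j hx)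
    rw [h0, mul_zero, zero_smul, sub_zero]
    refine neg_mem (P.pos.smul_mem _ ?_)
    obtain ⟨y, hy, c, h⟩ := f_lie_pos i hx
    rw [leibniz_lie, h, lie_add, lie_smul, ← lie_skew (P.e j) (P.h i), h_lie_e,
      ← lie_skew (P.f i) (P.e j)]
    refine add_mem ?_ (add_mem (P.pos.lie_mem (P.e_mem_pos j) hy) (P.pos.smul_mem _ (neg_mem
      (P.pos.smul_mem _ (P.e_mem_pos j)))))
    by_cases hij : j = i
    · subst hij
      rw [e_lie_f, neg_lie]
      exact neg_mem (lie_pos_mem ⟨_, P.h_mem_cartan j⟩ hx)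
    · rw [P.e_lie_f_ne j i hij, neg_zero, zero_lie]
      exact zero_mem _

end ComplexForm

end BKM.Structure

/-! ### The exterior algebra of `𝔫` and the adjoint of the boundary -/

namespace BKM.Structure

variable {L : Type*} [LieRing L] [LieAlgebra ℂ L] (P : Structure L)

/-- The adjoint action of the Cartan subalgebra on the positive subalgebra. -/
noncomputable def adCartanPos (s : P.cartan) : Module.End ℂ P.pos where
  toFun x := ⟨⁅(s : L), (x : L)⁆, lie_pos_mem s x.2⟩
  map_add' _ _ := Subtype.ext (lie_add _ _ _)
  map_smul' _ _ := Subtype.ext (lie_smul _ _ _)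

/-- The action of the Cartan subalgebra on the exterior algebra of the positive subalgebra. -/
noncomputable def adCartanExt (s : P.cartan) : Module.End ℂ P.Ext := extD (P.adCartanPos s)

/-- The Chevalley generator `eᵢ`, in the positive subalgebra. -/
noncomputable def ePos (i : P.ι) : P.pos := ⟨P.e i, P.e_mem_pos i⟩

/-- The sums of weights of nonzero Chevalley generators. -/
def weightMonoid : AddSubmonoid (Module.Dual ℂ P.cartan) :=
  AddSubmonoid.closure {α | ∃ i, P.e i ≠ 0 ∧ P.rt i = α}

variable {P}

/-- Over a field the exterior algebra of a subspace embeds, so weights can be tested inside that of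
`𝔫`. -/
theorem mem_weightSpace_iff {α : Module.Dual ℂ P.cartan} {x : P.Ext} :
    x ∈ P.weightSpace α ↔ IsWeightVector P.adCartanExt α x := by
  have hinj : Function.Injective (ExteriorAlgebra.map (P.pos : Submodule ℂ L).subtype) :=
    ExteriorAlgebra.map_injective_field (Submodule.ker_subtype _)
  refine forall_congr' fun s => ?_
  have h := map_extD (P.pos : Submodule ℂ L).subtype (P.adCartanPos s)
    (LieAlgebra.ad ℂ L (s : L)) (fun _ => rfl) x
  rw [← extD_apply, ← h, ← map_smul]
  exact hinj.eq_iff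

/-- The exterior algebra of the positive subalgebra is generated from `1` by the exterior products
with the Chevalley generators and by their adjoint actions. -/
theorem ext_eq_top_of_stable (M : Submodule ℂ P.Ext) (one : 1 ∈ M)
    (hι : ∀ i, P.e i ≠ 0 → ∀ w ∈ M, ExteriorAlgebra.ι ℂ (P.ePos i) * w ∈ M)
    (hθ : ∀ i, P.e i ≠ 0 → ∀ w ∈ M, extD (LieAlgebra.ad ℂ P.pos (P.ePos i)) w ∈ M) : M = ⊤ := by
  -- The repeated membership `hx` turns a property of elements of `𝔫` into a predicate on all of
  -- `L`, as the induction principle requires.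
  have key : ∀ x ∈ P.pos, ∃ hx : x ∈ P.pos, ∀ w ∈ M,
      ExteriorAlgebra.ι ℂ (⟨x, hx⟩ : P.pos) * w ∈ M := by
    refine LieSubalgebra.lieSpan_range_induction (k := ℂ) P.e ?_ ?_ ?_ ?_ ?_
    · refine ⟨zero_mem _, fun w _ => ?_⟩
      rw [show (⟨0, zero_mem _⟩ : P.pos) = 0 from rfl, map_zero, zero_mul]
      exact zero_mem _
    · rintro x y ⟨hx, hx'⟩ ⟨hy, hy'⟩
      refine ⟨add_mem hx hy, fun w hw => ?_⟩
      rw [show (⟨x + y, add_mem hx hy⟩ : P.pos) = ⟨x, hx⟩ + ⟨y, hy⟩ from rfl, map_add, add_mul]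
      exact add_mem (hx' w hw) (hy' w hw)
    · rintro c x ⟨hx, hx'⟩
      refine ⟨P.pos.smul_mem c hx, fun w hw => ?_⟩
      rw [show (⟨c • x, P.pos.smul_mem c hx⟩ : P.pos) = c • ⟨x, hx⟩ from rfl, map_smul,
        smul_mul_assoc]
      exact M.smul_mem c (hx' w hw)
    · intro i
      refine ⟨P.e_mem_pos i, fun w hw => ?_⟩
      by_cases hi : P.e i = 0
      · rw [show (⟨P.e i, P.e_mem_pos i⟩ : P.pos) = 0 from Subtype.ext hi, map_zero, zero_mul]
        exact zero_mem _
      · exact hι i hi w hw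
    · rintro i x - ⟨hx, hx'⟩
      refine ⟨P.pos.lie_mem (P.e_mem_pos i) hx, fun w hw => ?_⟩
      rw [show (⟨⁅P.e i, x⁆, P.pos.lie_mem (P.e_mem_pos i) hx⟩ : P.pos) = ⁅P.ePos i, ⟨x, hx⟩⁆
        from rfl]
      by_cases hi : P.e i = 0
      · rw [show P.ePos i = 0 from Subtype.ext hi, zero_lie, map_zero, zero_mul]
        exact zero_mem _
      · rw [extD_ad_ι_mul]
        exact sub_mem (hθ i hi _ (hx' w hw)) (hx' _ (hθ i hi w hw))
  refine eq_top_iff.2 fun x _ => ?_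
  induction x using ExteriorAlgebra.ι_mul_induction with
  | one => exact one
  | smul c x hx => exact M.smul_mem c (hx trivial)
  | add x y hx hy => exact add_mem (hx trivial) (hy trivial)
  | ι_mul y x hx => exact (key y y.2).2 x (hx trivial)

theorem isWeightVector_one : IsWeightVector P.adCartanExt 0 1 := fun s => by
  rw [LinearMap.zero_apply, zero_smul]
  exact extD_one _

theorem isWeightVector_ι_mul (i : P.ι) {β : Module.Dual ℂ P.cartan} {w : P.Ext}
    (hw : IsWeightVector P.adCartanExt β w) :
    IsWeightVector P.adCartanExt (β + P.rt i) (ExteriorAlgebra.ι ℂ (P.ePos i) * w) := fun s => by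
  have h1 : P.adCartanPos s (P.ePos i) = P.rt i s • P.ePos i := Subtype.ext (P.cartan_lie_e i s)
  have h2 : extD (P.adCartanPos s) w = β s • w := hw s
  rw [adCartanExt, extD_ι_mul, h1, h2, map_smul, smul_mul_assoc, mul_smul_comm, ← add_smul,
    LinearMap.add_apply, add_comm]

theorem isWeightVector_extD_ad (i : P.ι) {β : Module.Dual ℂ P.cartan} {w : P.Ext}
    (hw : IsWeightVector P.adCartanExt β w) :
    IsWeightVector P.adCartanExt (β + P.rt i)
      (extD (LieAlgebra.ad ℂ P.pos (P.ePos i)) w) := fun s => by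
  have h1 : P.adCartanPos s * LieAlgebra.ad ℂ P.pos (P.ePos i)
      - LieAlgebra.ad ℂ P.pos (P.ePos i) * P.adCartanPos s
      = P.rt i s • LieAlgebra.ad ℂ P.pos (P.ePos i) := by
    refine LinearMap.ext fun x => Subtype.ext ?_
    change ⁅(s : L), ⁅P.e i, (x : L)⁆⁆ - ⁅P.e i, ⁅(s : L), (x : L)⁆⁆ = P.rt i s • ⁅P.e i, (x : L)⁆
    rw [leibniz_lie, add_sub_cancel_right, cartan_lie_e, smul_lie]
  have h2 : extD (P.adCartanPos s) w = β s • w := hw s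
  rw [adCartanExt, extD_comm, h1, h2, map_smul, extD_smul, ← add_smul, LinearMap.add_apply]

theorem adCartanExt_ceBoundary (s : P.cartan) (w : P.Ext) :
    P.adCartanExt s (ceBoundary ℂ P.pos w) = ceBoundary ℂ P.pos (P.adCartanExt s w) :=
  extD_ceBoundary_of_derivation _ (fun x y => Subtype.ext (leibniz_lie (s : L) (x : L) (y : L))) w

/-- The weights of the exterior algebra are sums of weights of Chevalley generators. -/
theorem mem_weightMonoid_of_isWeightVector {α : Module.Dual ℂ P.cartan} {x : P.Ext}
    (hx : IsWeightVector P.adCartanExt α x) (h0 : x ≠ 0) : α ∈ P.weightMonoid := by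
  let E : Module.Dual ℂ P.cartan → Submodule ℂ P.Ext := P.weightSpace
  let M := Submodule.span ℂ {v | ∃ α ∈ (P.weightMonoid : Set (Module.Dual ℂ P.cartan)), v ∈ E α}
  have hgen : ∀ i, P.e i ≠ 0 → P.rt i ∈ P.weightMonoid := fun i hi =>
    AddSubmonoid.subset_closure ⟨i, hi, rfl⟩
  have hM : M = ⊤ := by
    refine ext_eq_top_of_stable M (Submodule.subset_span ⟨0, zero_mem _, ?_⟩) ?_ ?_
    · exact mem_weightSpace_iff.2 isWeightVector_one
    · intro i hi w hw
      induction hw using Submodule.span_induction with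
      | mem w hw =>
        obtain ⟨α, hα, hw⟩ := hw
        exact Submodule.subset_span ⟨α + P.rt i, add_mem hα (hgen i hi),
          mem_weightSpace_iff.2 (isWeightVector_ι_mul i (mem_weightSpace_iff.1 hw))⟩
      | zero => rw [mul_zero]; exact zero_mem _
      | add x y _ _ hx hy => rw [mul_add]; exact add_mem hx hy
      | smul c x _ hx => rw [mul_smul_comm]; exact M.smul_mem c hx
    · intro i hi w hw
      induction hw using Submodule.span_induction with
      | mem w hw =>
        obtain ⟨α, hα, hw⟩ := hw
        exact Submodule.subset_span ⟨α + P.rt i, add_mem hα (hgen i hi),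
          mem_weightSpace_iff.2 (isWeightVector_extD_ad i (mem_weightSpace_iff.1 hw))⟩
      | zero => rw [map_zero]; exact zero_mem _
      | add x y _ _ hx hy => rw [map_add]; exact add_mem hx hy
      | smul c x _ hx => rw [map_smul]; exact M.smul_mem c hx
  obtain ⟨F, v, hF, hv, rfl⟩ := Submodule.exists_sum_of_mem_span _ E
    (hM ▸ Submodule.mem_top : x ∈ M)
  exact hF α (IsWeightVector.eq_component F v (fun β _ => mem_weightSpace_iff.1 (hv β)) hx h0).1

namespace ComplexForm

variable (Ψ : P.ComplexForm)

/-- The restriction of the form to the positive subalgebra. -/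
noncomputable def posForm : P.pos →ₗ[ℂ] P.pos →ₗ⋆[ℂ] ℂ :=
  (Ψ.form.domRestrict (P.pos : Submodule ℂ L)).compl₂ (P.pos : Submodule ℂ L).subtype

theorem posForm_apply (x y : P.pos) : Ψ.posForm x y = Ψ.form x y := rfl

theorem posForm_hermitian (x y : P.pos) : Ψ.posForm y x = conj (Ψ.posForm x y) :=
  Ψ.hermitian x y

theorem posForm_nondegenerate (x : P.pos) (h : ∀ y, Ψ.posForm x y = 0) : x = 0 :=
  Subtype.ext (Ψ.nondegenerate_pos x.2 fun y hy => h ⟨y, hy⟩)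

/-- The form on the exterior algebra of the positive subalgebra. -/
noncomputable def extPosForm : P.Ext →ₗ[ℂ] P.Ext →ₗ⋆[ℂ] ℂ := extForm Ψ.posForm

theorem extPosForm_nondegenerate {v w : P.Ext}
    (h : ∀ y, Ψ.extPosForm v y = Ψ.extPosForm w y) : v = w := by
  rw [← sub_eq_zero]
  refine extForm_nondegenerate Ψ.posForm_hermitian Ψ.posForm_nondegenerate _ fun y => ?_
  have h1 : extForm Ψ.posForm (v - w) y = 0 := by
    rw [map_sub, LinearMap.sub_apply, sub_eq_zero]
    exact h y
  rw [extForm_hermitian Ψ.posForm_hermitian, h1, map_zero]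

theorem form_e_lie_pos_pos (i : P.ι) {x y : L} (hx : x ∈ P.pos) (hy : y ∈ P.pos) :
    Ψ.form (P.e i) ⁅x, y⁆ = 0 := by
  refine LieSubalgebra.lieSpan_range_induction (k := ℂ) P.e
    (p := fun x => ∀ y ∈ P.pos, Ψ.form (P.e i) ⁅x, y⁆ = 0) ?_ ?_ ?_ ?_ ?_ x hx y hy
  · simp
  · intro x x' h h' y hy
    rw [add_lie, map_add, h y hy, h' y hy, add_zero]
  · intro c x h y hy
    rw [smul_lie, LinearMap.map_smulₛₗ, h y hy, smul_zero]
  · exact fun j y hy => Ψ.form_e_lie_pos i j hy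
  · intro j x hx h y hy
    rw [lie_lie, map_sub, Ψ.form_e_lie_pos i j (P.pos.lie_mem hx hy),
      h _ (P.pos.lie_mem (P.e_mem_pos j) hy), sub_zero]

/-- The functional `⟨·, eᵢ⟩` on the positive subalgebra. -/
noncomputable def eFunctional (i : P.ι) : Module.Dual ℂ P.pos :=
  conjFunctional Ψ.posForm (P.ePos i)

theorem eFunctional_apply (i : P.ι) (y : P.pos) : Ψ.eFunctional i y = Ψ.form y (P.e i) :=
  (Ψ.hermitian (P.e i) y).symm

theorem eFunctional_lie (i : P.ι) (x y : P.pos) : Ψ.eFunctional i ⁅x, y⁆ = 0 := by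
  rw [eFunctional_apply]
  exact Ψ.form_symm_zero (Ψ.form_e_lie_pos_pos i x.2 y.2)

/-- The adjoint of `ad eᵢ` on the positive subalgebra. -/
noncomputable def adjoint {i : P.ι} (hi : P.e i ≠ 0) : Module.End ℂ P.pos where
  toFun y := ⟨-(Ψ.ε • ⁅P.f i, (y : L)⁆) - (Ψ.κ i * Ψ.form y (P.e i)) • P.h i,
    Ψ.adjoint_mem i hi y.2⟩
  map_add' x y := Subtype.ext (by
    simp only [AddMemClass.coe_add, lie_add, map_add, LinearMap.add_apply]
    module)
  map_smul' c x := Subtype.ext (by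
    simp only [SetLike.val_smul, lie_smul, map_smul, LinearMap.smul_apply, smul_eq_mul,
      RingHom.id_apply]
    module)

theorem coe_adjoint {i : P.ι} (hi : P.e i ≠ 0) (y : P.pos) : (Ψ.adjoint hi y : L)
    = -(Ψ.ε • ⁅P.f i, (y : L)⁆) - (Ψ.κ i * Ψ.form y (P.e i)) • P.h i := rfl

/-- The correction by `hᵢ` is invisible to the form, since the Cartan subalgebra is orthogonal to
`𝔫`. -/
theorem posForm_ad {i : P.ι} (hi : P.e i ≠ 0) (x y : P.pos) :
    Ψ.posForm (LieAlgebra.ad ℂ P.pos (P.ePos i) x) y = Ψ.posForm x (Ψ.adjoint hi y) := by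
  rw [posForm_apply, posForm_apply, coe_adjoint]
  change Ψ.form ⁅P.e i, (x : L)⁆ y = _
  rw [form_e_lie, map_sub, map_neg, LinearMap.map_smulₛₗ, LinearMap.map_smulₛₗ,
    Ψ.form_symm_zero (Ψ.form_cartan_pos (P.h_mem_cartan i) x.2), smul_zero, sub_zero, Ψ.conj_ε,
    smul_eq_mul]

/-- The part `-ε ad fᵢ` is a derivation. The correction vanishes at `[x, y]`, because `⟨[x, y], eᵢ⟩
= 0`, but contributes brackets with `hᵢ` at `x` and at `y`. -/
theorem adjoint_lie {i : P.ι} (hi : P.e i ≠ 0) (x y : P.pos) :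
    Ψ.adjoint hi ⁅x, y⁆ = ⁅Ψ.adjoint hi x, y⁆ + ⁅x, Ψ.adjoint hi y⁆
      + (Ψ.eFunctional i y • (-P.adCartanPos (Ψ.coroot i)) x
        - Ψ.eFunctional i x • (-P.adCartanPos (Ψ.coroot i)) y) := by
  have h0 := Ψ.eFunctional_lie i x y
  have hc : ∀ z : P.pos, ((P.adCartanPos (Ψ.coroot i) z : P.pos) : L)
      = Ψ.κ i • ⁅P.h i, (z : L)⁆ := fun z => smul_lie _ _ _
  rw [eFunctional_apply] at h0
  apply Subtype.ext
  simp only [coe_adjoint, AddMemClass.coe_add, AddSubgroupClass.coe_sub, LieSubalgebra.coe_bracket,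
    SetLike.val_smul, LinearMap.neg_apply, NegMemClass.coe_neg, hc, eFunctional_apply]
  rw [← LieSubalgebra.coe_bracket, h0, LieSubalgebra.coe_bracket, leibniz_lie]
  simp only [sub_lie, lie_sub, neg_lie, lie_neg, smul_lie, lie_smul]
  rw [← lie_skew (x : L) (P.h i)]
  module

theorem extPosForm_adCartanExt_coroot (i : P.ι) (v w : P.Ext) :
    Ψ.extPosForm (P.adCartanExt (Ψ.coroot i) v) w
      = Ψ.extPosForm v (P.adCartanExt (Ψ.coroot i) w) := by
  refine extForm_extD (fun x y => ?_) v w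
  rw [posForm_apply, posForm_apply]
  change Ψ.form ⁅Ψ.κ i • P.h i, (x : L)⁆ y = Ψ.form x ⁅Ψ.κ i • P.h i, (y : L)⁆
  rw [Ψ.contravariant, LinearMap.map_smulₛₗ, Ψ.conj_κ, Ψ.ω_h, smul_neg, neg_lie, map_neg, neg_neg]

/-- The vector `v'` is the value at `v` of an adjoint of the boundary. -/
def IsAdjointAt (v v' : P.Ext) : Prop :=
  ∀ y, Ψ.extPosForm v' y = Ψ.extPosForm v (ceBoundary ℂ P.pos y)

variable {Ψ}

theorem IsAdjointAt.unique {v v' v'' : P.Ext} (h : Ψ.IsAdjointAt v v') (h' : Ψ.IsAdjointAt v v'') :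
    v' = v'' := Ψ.extPosForm_nondegenerate fun y => (h y).trans (h' y).symm

theorem isAdjointAt_one : Ψ.IsAdjointAt 1 0 := fun y => by
  rw [map_zero, LinearMap.zero_apply, extPosForm, extForm_one_left, algebraMapInv_ceBoundary,
    map_zero]

theorem IsAdjointAt.add {v v' w w' : P.Ext} (h : Ψ.IsAdjointAt v v') (h' : Ψ.IsAdjointAt w w') :
    Ψ.IsAdjointAt (v + w) (v' + w') := fun y => by
  rw [map_add, map_add, LinearMap.add_apply, LinearMap.add_apply, h y, h' y]

theorem IsAdjointAt.smul (c : ℂ) {v v' : P.Ext} (h : Ψ.IsAdjointAt v v') :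
    Ψ.IsAdjointAt (c • v) (c • v') := fun y => by
  rw [map_smul, map_smul, LinearMap.smul_apply, LinearMap.smul_apply, h y]

/-- The dual of `extContract_ceBoundary`: the contraction by `⟨·, eᵢ⟩` is adjoint to `eᵢ ∧`. -/
theorem IsAdjointAt.ι_mul (i : P.ι) {v v' : P.Ext} (h : Ψ.IsAdjointAt v v') :
    Ψ.IsAdjointAt (ExteriorAlgebra.ι ℂ (P.ePos i) * v)
      (-(ExteriorAlgebra.ι ℂ (P.ePos i) * v')) := fun y => by
  have h1 := extContract_ceBoundary (Ψ.eFunctional i) (Ψ.eFunctional_lie i) y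
  have h2 := h (extContract (Ψ.eFunctional i) y)
  rw [map_neg, LinearMap.neg_apply]
  rw [extPosForm, extForm_ι_mul_left, extForm_ι_mul_left]
  change -(Ψ.extPosForm v' (extContract (Ψ.eFunctional i) y))
    = Ψ.extPosForm v (extContract (Ψ.eFunctional i) (ceBoundary ℂ P.pos y))
  rw [h1, h2, map_neg]

/-- The dual of `extD_ceBoundary` for the adjoint of `ad eᵢ`. The defect, a contraction followed by
the action of `-tᵢ`, dualizes to the term with `eᵢ ∧`, because `tᵢ` acts as a self-adjoint operator.
-/
theorem IsAdjointAt.extD_ad {i : P.ι} (hi : P.e i ≠ 0) {v v' : P.Ext} (h : Ψ.IsAdjointAt v v') :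
    Ψ.IsAdjointAt (extD (LieAlgebra.ad ℂ P.pos (P.ePos i)) v)
      (extD (LieAlgebra.ad ℂ P.pos (P.ePos i)) v'
        + ExteriorAlgebra.ι ℂ (P.ePos i) * P.adCartanExt (Ψ.coroot i) v) := fun y => by
  have h1 := extD_ceBoundary (Ψ.adjoint hi) (-P.adCartanPos (Ψ.coroot i)) (Ψ.eFunctional i)
    (Ψ.adjoint_lie hi) y
  have h2 : ∀ a b, Ψ.extPosForm (extD (LieAlgebra.ad ℂ P.pos (P.ePos i)) a) b
      = Ψ.extPosForm a (extD (Ψ.adjoint hi) b) := fun a b => extForm_extD (Ψ.posForm_ad hi) a b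
  have h3 : Ψ.extPosForm (ExteriorAlgebra.ι ℂ (P.ePos i) * P.adCartanExt (Ψ.coroot i) v) y
      = Ψ.extPosForm v (P.adCartanExt (Ψ.coroot i) (extContract (Ψ.eFunctional i) y)) := by
    rw [← extPosForm_adCartanExt_coroot]
    exact extForm_ι_mul_left _ _ _ _
  have h4 : ∀ w, extD (-P.adCartanPos (Ψ.coroot i)) w = -P.adCartanExt (Ψ.coroot i) w := fun w => by
    rw [← neg_one_smul ℂ (P.adCartanPos _), extD_smul, neg_one_smul, adCartanExt]
  rw [map_add, LinearMap.add_apply, h2, h2, h1, h3, h, h4, sub_neg_eq_add, map_add]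

variable (Ψ)

/-- The boundary of the positive subalgebra has an adjoint. -/
theorem exists_adjoint : ∃ d : P.Ext →ₗ[ℂ] P.Ext, ∀ x, Ψ.IsAdjointAt x (d x) := by
  -- In infinite dimension an adjoint need not exist, so the vectors at which it has a value are
  -- collected.
  let M : Submodule ℂ P.Ext :=
    { carrier := {v | ∃ v', Ψ.IsAdjointAt v v'}
      zero_mem' := ⟨0, fun y => by simp⟩
      add_mem' := by
        rintro _ _ ⟨v', h⟩ ⟨w', h'⟩
        exact ⟨_, h.add h'⟩
      smul_mem' := by
        rintro c _ ⟨v', h⟩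
        exact ⟨_, h.smul c⟩ }
  have hM : M = ⊤ := by
    refine ext_eq_top_of_stable M ⟨0, isAdjointAt_one⟩ ?_ ?_
    · rintro i - w ⟨w', h⟩
      exact ⟨_, h.ι_mul i⟩
    · rintro i hi w ⟨w', h⟩
      exact ⟨_, h.extD_ad hi⟩
  choose d hd using fun x => (hM ▸ Submodule.mem_top : x ∈ M)
  exact ⟨⟨⟨d, fun x y => (hd _).unique ((hd x).add (hd y))⟩,
    fun c x => (hd _).unique ((hd x).smul c)⟩, hd⟩

/-- A vector of the Cartan subalgebra represents at most one functional. -/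
theorem represents_unique {α : Module.Dual ℂ P.cartan} {t t' : P.cartan}
    (h : ∀ s : P.cartan, Ψ.form s (Ψ.ω t) = α s) (h' : ∀ s : P.cartan, Ψ.form s (Ψ.ω t') = α s) :
    t = t' := by
  have h1 : Ψ.ω ((t - t' : P.cartan) : L) = 0 := by
    refine Ψ.nondegenerate_cartan (Ψ.ω_mem_cartan (t - t').2) fun s hs => ?_
    rw [AddSubgroupClass.coe_sub, map_sub, map_sub, sub_eq_zero, h ⟨s, hs⟩, h' ⟨s, hs⟩]
  rw [← sub_eq_zero]
  apply Subtype.ext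
  rw [← Ψ.ω_ω ((t - t' : P.cartan) : L), h1, map_zero]
  rfl

theorem exists_represents {α : Module.Dual ℂ P.cartan} (hα : α ∈ P.weightMonoid) :
    ∃ t : P.cartan, ∀ s : P.cartan, Ψ.form s (Ψ.ω t) = α s := by
  induction hα using AddSubmonoid.closure_induction with
  | mem α hα =>
    obtain ⟨i, hi, rfl⟩ := hα
    exact ⟨Ψ.coroot i, Ψ.form_ω_coroot hi⟩
  | zero => exact ⟨0, fun s => by simp⟩
  | add α β _ _ hα hβ =>
    obtain ⟨t, ht⟩ := hα
    obtain ⟨t', ht'⟩ := hβ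
    exact ⟨t + t', fun s => by
      rw [AddMemClass.coe_add, map_add, map_add, ht, ht', LinearMap.add_apply]⟩

/-! ### The eigenvalues of the Laplacian -/

section Laplacian

variable {Ψ} {t : Module.Dual ℂ P.cartan → P.cartan}

theorem represents_rt
    (ht : ∀ α ∈ P.weightMonoid, ∀ s : P.cartan, Ψ.form s (Ψ.ω (t α)) = α s)
    {i : P.ι} (hi : P.e i ≠ 0) : t (P.rt i) = Ψ.coroot i :=
  Ψ.represents_unique (ht _ (AddSubmonoid.subset_closure ⟨i, hi, rfl⟩)) (Ψ.form_ω_coroot hi)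

theorem represents_add
    (ht : ∀ α ∈ P.weightMonoid, ∀ s : P.cartan, Ψ.form s (Ψ.ω (t α)) = α s)
    {α β : Module.Dual ℂ P.cartan} (hα : α ∈ P.weightMonoid)
    (hβ : β ∈ P.weightMonoid) : t (α + β) = t α + t β :=
  Ψ.represents_unique (ht _ (add_mem hα hβ)) fun s => by
    rw [AddMemClass.coe_add, map_add, map_add, ht α hα, ht β hβ, LinearMap.add_apply]

/-- The symmetry `(β, αᵢ) = (αᵢ, β)`, extended additively from `rt_coroot_comm`. -/
theorem rt_represents
    (ht : ∀ α ∈ P.weightMonoid, ∀ s : P.cartan, Ψ.form s (Ψ.ω (t α)) = α s)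
    {i : P.ι} (hi : P.e i ≠ 0) {β : Module.Dual ℂ P.cartan}
    (hβ : β ∈ P.weightMonoid) : P.rt i (t β) = β (Ψ.coroot i) := by
  induction hβ using AddSubmonoid.closure_induction with
  | mem β hβ =>
    obtain ⟨j, hj, rfl⟩ := hβ
    rw [represents_rt ht hj, Ψ.rt_coroot_comm hi hj]
  | zero =>
    have h : t 0 = 0 := Ψ.represents_unique (ht _ (zero_mem _)) fun s => by simp
    rw [h, map_zero, LinearMap.zero_apply]
  | add α β hα hβ h h' => rw [represents_add ht hα hβ, map_add, h, h', LinearMap.add_apply]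

/-- In `(β + αᵢ, β + αᵢ + 2ρ)` the terms `(αᵢ, αᵢ)` and `2 (αᵢ, ρ)` cancel by the Weyl vector
condition; what is added to `(β, β + 2ρ)` is `2 (β, αᵢ)`. -/
theorem eigenvalue_add
    (ht : ∀ α ∈ P.weightMonoid, ∀ s : P.cartan, Ψ.form s (Ψ.ω (t α)) = α s)
    {ρ : Module.Dual ℂ P.cartan} {i : P.ι} (hi : P.e i ≠ 0)
    (hρ : ρ (t (P.rt i)) = -P.rt i (t (P.rt i)) / 2)
    {β : Module.Dual ℂ P.cartan} (hβ : β ∈ P.weightMonoid) :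
    (β + P.rt i + 2 • ρ) (t (β + P.rt i)) / 2
      = β (Ψ.coroot i) + (β + 2 • ρ) (t β) / 2 := by
  have h1 := rt_represents ht hi hβ
  rw [represents_rt ht hi] at hρ
  rw [represents_add ht hβ (AddSubmonoid.subset_closure ⟨i, hi, rfl⟩), represents_rt ht hi]
  simp only [map_add, LinearMap.add_apply, LinearMap.smul_apply, h1, hρ, nsmul_eq_mul]
  push_cast
  ring

theorem laplacian_apply
    (ht : ∀ α ∈ P.weightMonoid, ∀ s : P.cartan, Ψ.form s (Ψ.ω (t α)) = α s)
    {ρ : Module.Dual ℂ P.cartan}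
    (hρ : ∀ i, P.e i ≠ 0 → ρ (t (P.rt i)) = -P.rt i (t (P.rt i)) / 2)
    {d : P.Ext →ₗ[ℂ] P.Ext} (hd : ∀ x, Ψ.IsAdjointAt x (d x)) {α : Module.Dual ℂ P.cartan}
    {x : P.Ext} (hx : x ∈ P.weightSpace α) :
    d (ceBoundary ℂ P.pos x) + ceBoundary ℂ P.pos (d x) = ((α + 2 • ρ) (t α) / 2) • x := by
  by_cases hx0 : x = 0
  · rw [hx0]; simp
  let Δ : P.Ext →ₗ[ℂ] P.Ext := d ∘ₗ ceBoundary ℂ P.pos + ceBoundary ℂ P.pos ∘ₗ d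
  have hΔ : ∀ w, Δ w = d (ceBoundary ℂ P.pos w) + ceBoundary ℂ P.pos (d w) := fun _ => rfl
  have dι : ∀ i w, d (ExteriorAlgebra.ι ℂ (P.ePos i) * w)
      = -(ExteriorAlgebra.ι ℂ (P.ePos i) * d w) := fun i w => (hd _).unique ((hd w).ι_mul i)
  have dθ : ∀ i, P.e i ≠ 0 → ∀ w, d (extD (LieAlgebra.ad ℂ P.pos (P.ePos i)) w)
      = extD (LieAlgebra.ad ℂ P.pos (P.ePos i)) (d w)
        + ExteriorAlgebra.ι ℂ (P.ePos i) * P.adCartanExt (Ψ.coroot i) w :=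
    fun i hi w => (hd _).unique ((hd w).extD_ad hi)
  -- The terms `θᵢ (d w)` from `d δ` and `δ d` cancel.
  have hΔι : ∀ i, P.e i ≠ 0 → ∀ w, Δ (ExteriorAlgebra.ι ℂ (P.ePos i) * w)
      = ExteriorAlgebra.ι ℂ (P.ePos i) * (P.adCartanExt (Ψ.coroot i) w + Δ w) := fun i hi w => by
    rw [hΔ, hΔ, dι, map_neg, ceBoundary_ι_mul, ceBoundary_ι_mul, ← extD_apply, ← extD_apply,
      map_sub, dθ i hi, dι, mul_add, mul_add]
    abel
  -- The terms `eᵢ ∧ (tᵢ · δ w)` cancel, because `δ` commutes with `tᵢ`.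
  have hΔθ : ∀ i, P.e i ≠ 0 → ∀ w, Δ (extD (LieAlgebra.ad ℂ P.pos (P.ePos i)) w)
      = extD (LieAlgebra.ad ℂ P.pos (P.ePos i)) (P.adCartanExt (Ψ.coroot i) w + Δ w) :=
      fun i hi w => by
    rw [hΔ, hΔ, dθ i hi, map_add, ceBoundary_ι_mul, ← extD_ad_ceBoundary, dθ i hi,
      adCartanExt_ceBoundary, ← extD_ad_ceBoundary, ← extD_apply, map_add, map_add]
    abel
  -- The weight vectors with the expected eigenvalue. Once these spaces span, a vector of weight `α`
  -- is its own component in `E α`.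
  let E : Module.Dual ℂ P.cartan → Submodule ℂ P.Ext := fun β =>
    P.weightSpace β ⊓ LinearMap.ker (Δ - ((β + 2 • ρ) (t β) / 2) • LinearMap.id)
  have hE : ∀ β w, w ∈ E β ↔ IsWeightVector P.adCartanExt β w ∧
      Δ w = ((β + 2 • ρ) (t β) / 2) • w := fun β w => by
    rw [Submodule.mem_inf, mem_weightSpace_iff, LinearMap.mem_ker, LinearMap.sub_apply,
      sub_eq_zero]
    rfl
  let M := Submodule.span ℂ {v | ∃ α ∈ (P.weightMonoid : Set (Module.Dual ℂ P.cartan)), v ∈ E α}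
  have hgen : ∀ i, P.e i ≠ 0 → P.rt i ∈ P.weightMonoid := fun i hi =>
    AddSubmonoid.subset_closure ⟨i, hi, rfl⟩
  have hM : M = ⊤ := by
    refine ext_eq_top_of_stable M (Submodule.subset_span ⟨0, zero_mem _, (hE _ _).2
      ⟨isWeightVector_one, ?_⟩⟩) ?_ ?_
    · have h1 : d 1 = 0 := (hd 1).unique isAdjointAt_one
      have h2 : t 0 = 0 := Ψ.represents_unique (ht _ (zero_mem _)) fun s => by simp
      rw [hΔ, ceBoundary_one, h1, h2]
      simp
    · intro i hi w hw
      induction hw using Submodule.span_induction with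
      | mem w hw =>
        obtain ⟨β, hβ, hw⟩ := hw
        obtain ⟨hw1, hw2⟩ := (hE _ _).1 hw
        refine Submodule.subset_span ⟨β + P.rt i, add_mem hβ (hgen i hi), (hE _ _).2
          ⟨isWeightVector_ι_mul i hw1, ?_⟩⟩
        rw [hΔι i hi, hw2, hw1, ← add_smul, mul_smul_comm, eigenvalue_add ht hi (hρ i hi) hβ]
      | zero => rw [mul_zero]; exact zero_mem _
      | add x y _ _ hx hy => rw [mul_add]; exact add_mem hx hy
      | smul c x _ hx => rw [mul_smul_comm]; exact M.smul_mem c hx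
    · intro i hi w hw
      induction hw using Submodule.span_induction with
      | mem w hw =>
        obtain ⟨β, hβ, hw⟩ := hw
        obtain ⟨hw1, hw2⟩ := (hE _ _).1 hw
        refine Submodule.subset_span ⟨β + P.rt i, add_mem hβ (hgen i hi), (hE _ _).2
          ⟨isWeightVector_extD_ad i hw1, ?_⟩⟩
        rw [hΔθ i hi, hw2, hw1, ← add_smul, map_smul, eigenvalue_add ht hi (hρ i hi) hβ]
      | zero => rw [map_zero]; exact zero_mem _
      | add x y _ _ hx hy => rw [map_add]; exact add_mem hx hy
      | smul c x _ hx => rw [map_smul]; exact M.smul_mem c hx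
  obtain ⟨F, v, hF, hv, hsum⟩ := Submodule.exists_sum_of_mem_span _ E
    (hM ▸ Submodule.mem_top : x ∈ M)
  have hx' := mem_weightSpace_iff.1 hx
  rw [hsum] at hx' hx0
  have hvα := (IsWeightVector.eq_component F v (fun β _ => ((hE _ _).1 (hv β)).1) hx' hx0).2
  rw [← hΔ, hsum, hvα]
  exact ((hE _ _).1 (hv α)).2

end Laplacian

end ComplexForm

end BKM.Structure

/-! ### Consequences of the root decomposition -/

namespace BKM.Structure

/-- If a BKM algebra is spanned by the Cartan subalgebra and the root spaces, then the Cartan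
subalgebra is its own centralizer. -/
theorem mem_cartan_of_centralizes {L : Type*} [LieRing L] [LieAlgebra ℂ L] (P : Structure L)
    (hP : (P.cartan : Submodule ℂ L)
      ⊔ Submodule.span ℂ {v | ∃ α ∈ {α | P.IsRoot α}, v ∈ P.rootSpace α} = ⊤)
    (x : L) (hx : ∀ s ∈ P.cartan, ⁅s, x⁆ = 0) : x ∈ P.cartan := by
  obtain ⟨s, hs, y, hy, rfl⟩ := Submodule.mem_sup.1 (hP ▸ Submodule.mem_top : x ∈ _ ⊔ _)
  have hy0 : IsWeightVector P.adCartan 0 y := fun t => by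
    have h := hx t t.2
    rw [lie_add, P.cartan_lie_cartan t.2 hs, zero_add] at h
    rw [LinearMap.zero_apply, zero_smul]
    exact h
  obtain ⟨F, v, hF, hv, rfl⟩ := Submodule.exists_sum_of_mem_span _ _ hy
  suffices h : ∑ α ∈ F, v α = 0 by rwa [h, add_zero]
  by_contra h0
  exact (hF 0 (IsWeightVector.eq_component (T := P.adCartan) F v (fun β _ => hv β) hy0 h0).1).1 rfl

end BKM.Structure

namespace BKM.Structure.ComplexForm

variable {L : Type*} [LieRing L] [LieAlgebra ℂ L] {P : Structure L} (Ψ : P.ComplexForm)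

/-- The sum of the Cartan subalgebra and the negative subalgebra. -/
def nonpos : Submodule ℂ L where
  carrier := {x | ∃ s ∈ P.cartan, ∃ b ∈ P.pos, x = s + Ψ.ω b}
  zero_mem' := ⟨0, zero_mem _, 0, zero_mem _, by simp⟩
  add_mem' := by
    rintro _ _ ⟨s, hs, b, hb, rfl⟩ ⟨s', hs', b', hb', rfl⟩
    exact ⟨s + s', add_mem hs hs', b + b', add_mem hb hb', by rw [map_add]; abel⟩
  smul_mem' := by
    rintro c _ ⟨s, hs, b, hb, rfl⟩
    exact ⟨c • s, P.cartan.smul_mem c hs, conj c • b, P.pos.smul_mem _ hb, by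
      rw [LinearMap.map_smulₛₗ, Complex.conj_conj, smul_add]⟩

theorem cartan_le_nonpos {s : L} (hs : s ∈ P.cartan) : s ∈ Ψ.nonpos :=
  ⟨s, hs, 0, zero_mem _, by simp⟩

theorem eq_zero_of_mem_pos_of_mem_nonpos {x : L} (hx : x ∈ P.pos) (hx' : x ∈ Ψ.nonpos) :
    x = 0 := by
  obtain ⟨s, hs, b, hb, rfl⟩ := hx'
  refine Ψ.nondegenerate_pos hx fun y hy => ?_
  rw [map_add, LinearMap.add_apply, Ψ.form_cartan_pos hs hy, Ψ.form_ω_pos_pos hb hy, add_zero]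

/-- In the triangular decomposition, weights in the cone come only from `𝔫`, zero and negatives of
the cone only from `𝔥 + ω 𝔫`. A vector of a single weight therefore lies on one side. -/
theorem mem_pos_or_mem_nonpos {α : Module.Dual ℂ P.cartan} {v : L} (hv : v ∈ P.rootSpace α) :
    v ∈ P.pos ∨ v ∈ Ψ.nonpos := by
  classical
  let E : Module.Dual ℂ P.cartan → Submodule ℂ L := fun β =>
    P.rootSpace β ⊓ if β ∈ P.weightCone then (P.pos : Submodule ℂ L) else Ψ.nonpos
  have hE : ∀ β w, w ∈ E β → w ∈ P.pos ∨ w ∈ Ψ.nonpos := by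
    intro β w hw
    have h := hw.2
    split_ifs at h
    exacts [.inl h, .inr h]
  let W := Submodule.span ℂ {v | ∃ β ∈ (Set.univ : Set (Module.Dual ℂ P.cartan)), v ∈ E β}
  have hW : ∀ β, ∀ w ∈ P.rootSpace β, ((β ∈ P.weightCone → w ∈ P.pos) ∧
      (β ∉ P.weightCone → w ∈ Ψ.nonpos)) → w ∈ W := by
    intro β w hw h
    refine Submodule.subset_span ⟨β, trivial, hw, ?_⟩
    change w ∈ (if β ∈ P.weightCone then (P.pos : Submodule ℂ L) else Ψ.nonpos)
    split_ifs with hβ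
    exacts [h.1 hβ, h.2 hβ]
  have hvW : v ∈ W := by
    obtain ⟨s, hs, a, ha, b, hb, rfl⟩ := Ψ.exists_triangular v
    refine add_mem (add_mem ?_ ?_) ?_
    · refine hW 0 s (fun t => ?_) ⟨fun h => absurd rfl (Ψ.weightCone_ne_zero h), fun _ =>
        Ψ.cartan_le_nonpos hs⟩
      rw [P.cartan_lie_cartan t.2 hs, LinearMap.zero_apply, zero_smul]
    · exact Ψ.pos_induction (p := (· ∈ W)) (zero_mem _) (fun _ _ => add_mem)
        (fun c _ => Submodule.smul_mem _ c)
        (fun w hw β hβ h _ => hW β w h ⟨fun _ => hw, fun h => absurd hβ h⟩) ha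
    · refine Ψ.pos_induction (p := (Ψ.ω · ∈ W)) ?_ ?_ ?_ (fun w hw β hβ _ h => hW (-β) _ h
        ⟨fun h => absurd rfl (Ψ.weightCone_ne_neg h hβ), fun _ =>
          ⟨0, zero_mem _, w, hw, (zero_add _).symm⟩⟩) hb
      · rw [map_zero]; exact zero_mem _
      · intro x y hx hy
        rw [map_add]; exact add_mem hx hy
      · intro c x hx
        rw [LinearMap.map_smulₛₗ]; exact Submodule.smul_mem _ _ hx
  by_cases h0 : v = 0
  · exact .inl (h0 ▸ zero_mem _)
  obtain ⟨F, x, -, hx, rfl⟩ := Submodule.exists_sum_of_mem_span _ E hvW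
  rw [(IsWeightVector.eq_component (T := P.adCartan) F x (fun β _ => (hx β).1) hv h0).2]
  exact hE α _ (hx α)

theorem isAdjointAt_of_span {s : Set P.Ext} (hs : Submodule.span ℂ s = ⊤) {v v' : P.Ext}
    (h : ∀ y ∈ s, Ψ.extPosForm v' y = Ψ.extPosForm v (ceBoundary ℂ P.pos y)) :
    Ψ.IsAdjointAt v v' := fun y => by
  have hy : y ∈ Submodule.span ℂ s := hs ▸ Submodule.mem_top
  induction hy using Submodule.span_induction with
  | mem y hy => exact h y hy
  | zero => simp
  | add x y _ _ hx hy => rw [map_add, hx, hy, map_add, map_add]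
  | smul c x _ hx => rw [LinearMap.map_smulₛₗ, hx, map_smul, LinearMap.map_smulₛₗ]

end BKM.Structure.ComplexForm

/-! ### Passage from `R` to `ℂ` -/

namespace BKM.IntegralStructure

variable {R : Subring ℂ} {g : Type*} [LieRing g] [LieAlgebra R g] (G : IntegralStructure R g)

theorem one_tmul_smul (r : R) (x : g) :
    (1 : ℂ) ⊗ₜ[R] (r • x) = (r : ℂ) • ((1 : ℂ) ⊗ₜ[R] x) := by
  rw [← TensorProduct.smul_tmul, TensorProduct.smul_tmul']
  congr 1

theorem one_tmul_mem_cartan {x : g} (hx : x ∈ G.cartan) : (1 : ℂ) ⊗ₜ[R] x ∈ G.complex.cartan := by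
  rw [← LieSubalgebra.mem_toSubmodule, ← G.cartan_baseChange]
  exact Submodule.tmul_mem_baseChange_of_mem 1 hx

/-- A complex subspace that contains the images of the Cartan subalgebra and of the root spaces is
everything. -/
theorem eq_top_of_rootSpaces (W : Submodule ℂ (ℂ ⊗[R] g))
    (hH : ∀ x ∈ G.cartan, (1 : ℂ) ⊗ₜ[R] x ∈ W)
    (hα : ∀ α, G.complex.IsRoot α → ∀ x : g, (1 : ℂ) ⊗ₜ[R] x ∈ G.complex.rootSpace α →
      (1 : ℂ) ⊗ₜ[R] x ∈ W) : W = ⊤ := by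
  have hle : (⊤ : Submodule R g) ≤ (W.restrictScalars R).comap (TensorProduct.mk R ℂ g 1) := by
    rw [← G.iSup_eq_top]
    exact sup_le hH (iSup_le fun α x hx => hα α.1 α.2 x hx)
  refine eq_top_iff.2 fun x _ => ?_
  induction x using TensorProduct.induction_on with
  | zero => exact zero_mem W
  | tmul c y =>
    have h : c ⊗ₜ[R] y = c • ((1 : ℂ) ⊗ₜ[R] y) := by
      rw [TensorProduct.smul_tmul', smul_eq_mul, mul_one]
    rw [h]
    exact W.smul_mem c (hle trivial)
  | add x y hx hy => exact add_mem (hx trivial) (hy trivial)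

theorem mem_cartan_of_centralizes (x : ℂ ⊗[R] g) (hx : ∀ s ∈ G.complex.cartan, ⁅s, x⁆ = 0) :
    x ∈ G.complex.cartan := by
  refine G.complex.mem_cartan_of_centralizes (G.eq_top_of_rootSpaces _ ?_ ?_) x hx
  · exact fun x hx => Submodule.mem_sup_left (G.one_tmul_mem_cartan hx)
  · exact fun α hα x hx => Submodule.mem_sup_right (Submodule.subset_span ⟨α, hα, hx⟩)

namespace ContravariantForm

variable {G} (Φ : G.ContravariantForm)

/-- Elimination without denominators. If `∑ cᵢ ⊗ vᵢ` is in the radical, pairing with `y` gives a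
relation `∑ rᵢ cᵢ = 0` with `rᵢ = ⟨vᵢ, y⟩` in `R`. Multiplication by some `rₖ ≠ 0` then removes the
term with index `k`. -/
theorem form_nondegenerate (x : ℂ ⊗[R] g) (hx : ∀ y, Φ.form x y = 0) : x = 0 := by
  classical
  obtain ⟨S, rfl⟩ := TensorProduct.exists_finset x
  -- The elimination keeps the scalars and changes the vectors, so the vectors are generalized.
  suffices h : ∀ v : ℂ × g → g, (∀ y : g, Φ.form (∑ i ∈ S, i.1 ⊗ₜ[R] v i) (1 ⊗ₜ[R] y) = 0) →
      ∑ i ∈ S, i.1 ⊗ₜ[R] v i = 0 from h Prod.snd fun y => hx _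
  clear hx
  have htmul : ∀ (c : ℂ) (y : g), c ⊗ₜ[R] y = c • ((1 : ℂ) ⊗ₜ[R] y) := fun c y => by
    rw [TensorProduct.smul_tmul', smul_eq_mul, mul_one]
  induction S using Finset.strongInduction with
  | H S ih =>
    intro v hv
    by_cases hall : ∀ i ∈ S, v i = 0
    · exact Finset.sum_eq_zero fun i hi => by rw [hall i hi, TensorProduct.tmul_zero]
    push Not at hall
    obtain ⟨k, hk, hvk⟩ := hall
    obtain ⟨y, hy⟩ : ∃ y : g, Φ.form (1 ⊗ₜ[R] v k) (1 ⊗ₜ[R] y) ≠ 0 := by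
      by_contra! h
      exact hvk (Φ.nondegenerate _ h)
    let r : ℂ × g → R := fun i => ⟨Φ.form (1 ⊗ₜ[R] v i) (1 ⊗ₜ[R] y), Φ.mem_R _ _⟩
    have hr : ∑ i ∈ S, (r i : ℂ) • i.1 = 0 := by
      have h := hv y
      rw [map_sum, LinearMap.sum_apply] at h
      rw [← h]
      refine Finset.sum_congr rfl fun i _ => ?_
      rw [htmul, map_smul, LinearMap.smul_apply, smul_eq_mul, smul_eq_mul, mul_comm]
    have hsum : (r k : ℂ) • ∑ i ∈ S, i.1 ⊗ₜ[R] v i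
        = ∑ i ∈ S.erase k, i.1 ⊗ₜ[R] (r k • v i - r i • v k) := by
      have h1 : ∑ i ∈ S, i.1 ⊗ₜ[R] (r k • v i - r i • v k)
          = (r k : ℂ) • ∑ i ∈ S, i.1 ⊗ₜ[R] v i := by
        have h2 : ∑ i ∈ S, i.1 ⊗ₜ[R] (r i • v k) = (∑ i ∈ S, (r i : ℂ) • i.1) ⊗ₜ[R] v k := by
          rw [TensorProduct.sum_tmul]
          exact Finset.sum_congr rfl fun i _ => (TensorProduct.smul_tmul _ _ _).symm
        simp only [TensorProduct.tmul_sub, Finset.sum_sub_distrib]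
        rw [h2, hr, TensorProduct.zero_tmul, sub_zero, Finset.smul_sum]
        refine Finset.sum_congr rfl fun i _ => ?_
        rw [htmul, one_tmul_smul, htmul i.1 (v i), smul_comm]
      rw [← h1, ← Finset.sum_erase_add _ _ hk, sub_self, TensorProduct.tmul_zero, add_zero]
    have h0 := ih (S.erase k) (Finset.erase_ssubset hk) (fun i => r k • v i - r i • v k)
      (fun y => by rw [← hsum, map_smul, LinearMap.smul_apply, hv y, smul_zero])
    rw [← hsum] at h0
    exact (smul_eq_zero.1 h0).resolve_left hy

/-- The sesquilinear extension of a contravariant form. -/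
noncomputable def toComplexForm
    (hpos : ∀ α, ¬ (G.complex.IsPositiveRoot α ∧ G.complex.IsNegativeRoot α)) :
    G.complex.ComplexForm where
  form := Φ.form
  hermitian := Φ.hermitian
  nondegenerate := Φ.form_nondegenerate
  ω := Φ.ω
  ω_lie := Φ.ω_lie
  ω_ω := Φ.ω_ω
  ε := ((Φ.sign : ℤ) : ℂ)
  ε_sq := by
    rw [← Int.cast_mul, ← Units.val_mul, Int.units_mul_self, Units.val_one, Int.cast_one]
  conj_ε := map_intCast _ _
  ω_e i := by rw [Φ.ω_e, Units.smul_def, Int.cast_smul_eq_zsmul]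
  contravariant := Φ.contravariant
  centralizer := G.mem_cartan_of_centralizes
  positive_negative := hpos

end ContravariantForm

variable {G}

/-- The positive subalgebra of `g ⊗ ℂ` is spanned by that of `g`. -/
theorem pos_le_span (Ψ : G.complex.ComplexForm) {y : ℂ ⊗[R] g} (hy : y ∈ G.complex.pos) :
    y ∈ Submodule.span ℂ {v | ∃ x ∈ G.pos, v = (1 : ℂ) ⊗ₜ[R] x} := by
  set S := Submodule.span ℂ {v | ∃ x ∈ G.pos, v = (1 : ℂ) ⊗ₜ[R] x}
  have hS : S ≤ (G.complex.pos : Submodule ℂ (ℂ ⊗[R] g)) := Submodule.span_le.2 (by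
    rintro _ ⟨x, hx, rfl⟩
    exact hx)
  -- Each root vector of `g` lies in `S` or in `𝔥 + ω 𝔫`. The second component of an element of `𝔫`
  -- is again in `𝔫`, hence zero.
  have hW := G.eq_top_of_rootSpaces (S ⊔ Ψ.nonpos)
    (fun x hx => Submodule.mem_sup_right (Ψ.cartan_le_nonpos (G.one_tmul_mem_cartan hx)))
    (fun α _ x hx => (Ψ.mem_pos_or_mem_nonpos hx).elim
      (fun h => Submodule.mem_sup_left (Submodule.subset_span ⟨x, h, rfl⟩))
      fun h => Submodule.mem_sup_right h)
  obtain ⟨p, hp, q, hq, rfl⟩ := Submodule.mem_sup.1 (hW ▸ Submodule.mem_top : y ∈ S ⊔ Ψ.nonpos)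
  have h0 := Ψ.eq_zero_of_mem_pos_of_mem_nonpos
    (by simpa using sub_mem hy (hS hp)) hq
  rw [h0, add_zero]
  exact hp

theorem extToComplex_ι (x : G.pos) :
    G.extToComplex (ExteriorAlgebra.ι R x) = ExteriorAlgebra.ι ℂ (G.posToComplex x) :=
  ExteriorAlgebra.lift_ι_apply R _ _ x

theorem extToComplex_ceBoundary (x : G.Ext) :
    G.extToComplex (ceBoundary R G.pos x) = ceBoundary ℂ G.complex.pos (G.extToComplex x) :=
  ceBoundary_natural G.extToComplex G.posToComplex extToComplex_ι (fun x y => Subtype.ext (by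
    change (1 : ℂ) ⊗ₜ[R] ⁅(x : g), (y : g)⁆ = ⁅(1 : ℂ) ⊗ₜ[R] (x : g), (1 : ℂ) ⊗ₜ[R] (y : g)⁆
    rw [LieAlgebra.ExtendScalars.bracket_tmul, mul_one])) x

theorem span_range_extToComplex (Ψ : G.complex.ComplexForm) :
    Submodule.span ℂ (Set.range G.extToComplex) = ⊤ := by
  set M := Submodule.span ℂ (Set.range G.extToComplex)
  have key : ∀ y ∈ G.complex.pos, ∃ hy : y ∈ G.complex.pos, ∀ w ∈ M,
      ExteriorAlgebra.ι ℂ (⟨y, hy⟩ : G.complex.pos) * w ∈ M := by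
    intro y hy
    have h := pos_le_span Ψ hy
    clear hy
    induction h using Submodule.span_induction with
    | mem y hy =>
      obtain ⟨x, hx, rfl⟩ := hy
      refine ⟨hx, fun w hw => ?_⟩
      induction hw using Submodule.span_induction with
      | mem w hw =>
        obtain ⟨w, rfl⟩ := hw
        refine Submodule.subset_span ⟨ExteriorAlgebra.ι R ⟨x, hx⟩ * w, ?_⟩
        rw [map_mul, extToComplex_ι]
        rfl
      | zero => rw [mul_zero]; exact zero_mem _
      | add x y _ _ hx hy => rw [mul_add]; exact add_mem hx hy
      | smul c x _ hx => rw [mul_smul_comm]; exact M.smul_mem c hx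
    | zero =>
      refine ⟨zero_mem _, fun w _ => ?_⟩
      rw [show (⟨0, zero_mem _⟩ : G.complex.pos) = 0 from rfl, map_zero, zero_mul]
      exact zero_mem _
    | add x y _ _ hx hy =>
      obtain ⟨hx, hx'⟩ := hx
      obtain ⟨hy, hy'⟩ := hy
      refine ⟨add_mem hx hy, fun w hw => ?_⟩
      rw [show (⟨x + y, add_mem hx hy⟩ : G.complex.pos) = ⟨x, hx⟩ + ⟨y, hy⟩ from rfl, map_add,
        add_mul]
      exact add_mem (hx' w hw) (hy' w hw)
    | smul c x _ hx =>
      obtain ⟨hx, hx'⟩ := hx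
      refine ⟨G.complex.pos.smul_mem c hx, fun w hw => ?_⟩
      rw [show (⟨c • x, G.complex.pos.smul_mem c hx⟩ : G.complex.pos) = c • ⟨x, hx⟩ from rfl,
        map_smul, smul_mul_assoc]
      exact M.smul_mem c (hx' w hw)
  refine eq_top_iff.2 fun x _ => ?_
  induction x using ExteriorAlgebra.ι_mul_induction with
  | one => exact Submodule.subset_span ⟨1, map_one _⟩
  | smul c x hx => exact M.smul_mem c (hx trivial)
  | add x y hx hy => exact add_mem (hx trivial) (hy trivial)
  | ι_mul y x hx => exact (key y y.2).2 x (hx trivial)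

end BKM.IntegralStructure

theorem mainTheorem6 (R : Subring ℂ) (hR : ∀ z ∈ R, starRingEnd ℂ z ∈ R)
    (g : Type*) [LieRing g] [LieAlgebra R g] (G : BKM.IntegralStructure R g)
    (hpos : ∀ α, ¬ (G.complex.IsPositiveRoot α ∧ G.complex.IsNegativeRoot α))
    (Φ : G.ContravariantForm) (ρ : Module.Dual ℂ G.complex.cartan) (hρ : Φ.IsWeylVector ρ) :
    -- every weight of `⋀ 𝔫` is represented by a unique vector of the Cartan subalgebra
    (∀ α, ∀ x ∈ G.complex.weightSpace α, x ≠ 0 → ∃! t, Φ.Represents t α) ∧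
    -- the adjoint of `δ` exists over `ℂ`, and it is unique
    (∃! d : G.complex.Ext →ₗ[ℂ] G.complex.Ext, Φ.IsAdjoint d) ∧
    -- the Laplacian over `ℂ`
    (∀ d : G.complex.Ext →ₗ[ℂ] G.complex.Ext, Φ.IsAdjoint d →
      ∀ α, ∀ x ∈ G.complex.weightSpace α,
        d (ceBoundary ℂ G.complex.pos x) + ceBoundary ℂ G.complex.pos (d x)
          = (Φ.pairing α (α + 2 • ρ) / 2) • x) ∧
    -- the Laplacian over `R`
    (∀ d : G.Ext →ₗ[R] G.Ext, Φ.IsIntegralAdjoint d →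
      ∀ α, ∀ x : G.Ext, G.extToComplex x ∈ G.complex.weightSpace α →
        G.extToComplex (d (ceBoundary R G.pos x) + ceBoundary R G.pos (d x))
          = (Φ.pairing α (α + 2 • ρ) / 2) • G.extToComplex x) := by
  let Ψ := Φ.toComplexForm hpos
  -- On sums of weights of generators a representing vector exists, so the default value of
  -- `dualVector` does not occur.
  have ht : ∀ α ∈ G.complex.weightMonoid, ∀ s : G.complex.cartan,
      Ψ.form s (Ψ.ω (Φ.dualVector α)) = α s := by
    intro α hα
    have h : ∃ t, Φ.Represents t α := Ψ.exists_represents hα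
    rw [BKM.IntegralStructure.ContravariantForm.dualVector, dif_pos h]
    exact h.choose_spec
  have hρ' : ∀ i, G.complex.e i ≠ 0 → ρ (Φ.dualVector (G.complex.rt i))
      = -G.complex.rt i (Φ.dualVector (G.complex.rt i)) / 2 := fun i hi =>
    hρ _ (Ψ.isSimpleRoot_rt hi)
  have hadj : ∀ d : G.complex.Ext →ₗ[ℂ] G.complex.Ext, Φ.IsAdjoint d →
      ∀ x, Ψ.IsAdjointAt x (d x) := fun d hd x y => hd x y
  obtain ⟨d₀, hd₀⟩ := Ψ.exists_adjoint
  refine ⟨fun α x hx h0 => ?_, ⟨d₀, fun x y => hd₀ x y, fun d hd => ?_⟩, fun d hd α x hx => ?_,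
    fun d hd α x hx => ?_⟩
  · obtain ⟨t, h⟩ := Ψ.exists_represents (BKM.Structure.mem_weightMonoid_of_isWeightVector
      (BKM.Structure.mem_weightSpace_iff.1 hx) h0)
    exact ⟨t, h, fun t' h' => Ψ.represents_unique h' h⟩
  · exact LinearMap.ext fun x => (hadj d hd x).unique (hd₀ x)
  · exact BKM.Structure.ComplexForm.laplacian_apply ht hρ' (hadj d hd) hx
  -- Adjointness need only be tested on the image of the exterior algebra over `R`, which spans;
  -- uniqueness of the adjoint value then identifies `d` with `d₀`.
  · have hd' : ∀ w, G.extToComplex (d w) = d₀ (G.extToComplex w) := by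
      intro w
      refine (Ψ.isAdjointAt_of_span (BKM.IntegralStructure.span_range_extToComplex Ψ) ?_).unique
        (hd₀ _)
      rintro _ ⟨y, rfl⟩
      rw [← BKM.IntegralStructure.extToComplex_ceBoundary]
      exact hd w y
    rw [map_add, hd', BKM.IntegralStructure.extToComplex_ceBoundary,
      BKM.IntegralStructure.extToComplex_ceBoundary, hd']
    exact BKM.Structure.ComplexForm.laplacian_apply ht hρ' hd₀ hx
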